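/- Let $\omega>0$ be irrational and put $q=e^{2\pi i\omega}$, $q^{u}:=e^{2\pi i\omega u}$ for $u\in\mathbb C$. Let $S_2(x\,|\,\omega_1,\omega_2)$ be the double sine function: the meromorphic function given for $0<\mathrm{Re}\,x<\omega_1+\omega_2$ by $$S_2(x|\omega_1,\omega_2)=\exp\int_0^\infty\left(\frac{\sinh\big((x-\frac{\omega_1+\omega_2}2)t\big)}{2\sinh(\omega_1t/2)\sinh(\omega_2t/2)}-\frac{2x-\omega_1-\omega_2}{\omega_1\omega_2t}\right)\frac{dt}{t}$$ and satisfying $S_2(x+\omega_1|\omega_1,\omega_2)=S_2(x|\omega_1,\omega_2)/(2\sin(\pi x/\omega_2))$. Set $$\langle x\rangle=e^{\frac{\pi i}{2}((1+\omega)x-\omega x^2)}\,S_2(x|1,\tfrac1\omega),\qquad \sigma(x)=e^{\pi i((1+\omega)x-\omega x^2)} .$$ The Barnes-type $q$-hypergeometric function at $|q|=1$ is $$\Psi(\alpha,\beta,\gamma;x)=\frac{\langle\alpha\rangle\langle\beta\rangle}{\langle1\rangle\langle\gamma\rangle}\int_{C_0}q^{xz}\,\frac{\langle z+1+\frac1\omega\rangle\langle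 z+\gamma\rangle}{\langle z+\alpha\rangle\langle z+\beta\rangle}\,dz ,$$ where $C_0$ is any contour that agrees with the imaginary axis $(-i\infty,i\infty)$ outside a bounded set and has the points of $-\alpha+\mathbb Z_{\le0}+\frac1\omega\mathbb Z_{\le0}$ and $-\beta+\mathbb Z_{\le0}+\frac1\omega\mathbb Z_{\le0}$ on its left and those of $\mathbb Z_{\ge0}+\frac1\omega\mathbb Z_{\ge0}$ and $-\gamma+\mathbb Z_{\ge1}+\frac1\omega\mathbb Z_{\ge1}$ on its right. Let $\Lambda=\mathbb Z_{\ge0}+\frac1\omega\mathbb Z_{\ge0}$ and let $\alpha,\beta,\gamma,x\in\mathbb C$ be such that all factors and contours below are defined, namely none of $$-\alpha,\ -\beta,\ -\gamma,\ \alpha-1-\tfrac1\omega,\ \beta-1-\tfrac1\omega,\ \alpha-\beta,\ \beta-\alpha,\ \gamma-\alpha-1,\ \gamma-\beta-1,\ \alpha-\gamma-\tfrac1\omega,\ \beta-\gamma-\tfrac1\omega$$ lies in $\Lambda$, and $$0<\mathrm{Re}\,x<1+\tfrac1\omega+\mathrm{Re}\,\gamma-\mathrm{Re}\,\alpha-\mathrm{Re}\,\beta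 .$$ Then, for any choice of such contours for the three functions $\Psi$ below, the three integrals converge absolutely and $$\begin{aligned}\Psi(\alpha,\beta,\gamma;x)&=\frac{\langle\beta\rangle\langle\gamma-\alpha\rangle}{\langle\gamma\rangle\langle\beta-\alpha\rangle}\,\frac{\sigma(x+\alpha)}{\sigma(x)}\,\Psi\big(\alpha,1+\alpha-\gamma,1+\alpha-\beta;\,1+\tfrac1\omega+\gamma-\alpha-\beta-x\big)\\&\quad+\frac{\langle\alpha\rangle\langle\gamma-\beta\rangle}{\langle\gamma\rangle\langle\alpha-\beta\rangle}\,\frac{\sigma(x+\beta)}{\sigma(x)}\,\Psi\big(\beta,1+\beta-\gamma,1+\beta-\alpha;\,1+\tfrac1\omega+\gamma-\alpha-\beta-x\big).\end{aligned}$$ -/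

import Mathlib

/-- The logarithm of the double sine function `S₂(x | ω₁, ω₂)` on the strip `0 < Re x < ω₁ + ω₂`:
the regularised integral
`∫₀^∞ ( sinh((x - (ω₁+ω₂)/2) t) / (2 sinh(ω₁t/2) sinh(ω₂t/2)) - (2x - ω₁ - ω₂)/(ω₁ω₂t) ) dt/t`. -/
noncomputable def logDoubleSineStrip (ω₁ ω₂ : ℝ) (x : ℂ) : ℂ :=
  ∫ t : ℝ in Set.Ioi 0,
    (Complex.sinh ((x - ((ω₁ : ℂ) + ω₂) / 2) * t) /
        (2 * Complex.sinh ((ω₁ : ℂ) * t / 2) * Complex.sinh ((ω₂ : ℂ) * t / 2)) -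
      (2 * x - ω₁ - ω₂) / ((ω₁ : ℂ) * ω₂ * t)) / t

/-- The double sine function `S₂(x | ω₁, ω₂)`, `ω₁, ω₂ > 0`: the exponential of the integral above
on `0 < Re x ≤ ω₁`, continued meromorphically to the whole plane by the functional equation
`S₂(x + ω₁) / S₂(x) = 1 / (2 sin (π x / ω₂))`.  Here `x = y + n ω₁` with `0 < Re y ≤ ω₁`; one of
the two products is empty.  It has zeros at `ω₁ ℤ_{≤0} + ω₂ ℤ_{≤0}` and poles (where the value
below is `0`) at `ω₁ ℤ_{≥1} + ω₂ ℤ_{≥1}`. -/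
noncomputable def doubleSine (ω₁ ω₂ : ℝ) (x : ℂ) : ℂ :=
  let n : ℤ := ⌈x.re / ω₁⌉ - 1
  let y : ℂ := x - n * ω₁
  Complex.exp (logDoubleSineStrip ω₁ ω₂ y) *
    (∏ k ∈ Finset.range (-n).toNat,
      2 * Complex.sin (Real.pi * (y - ((k : ℂ) + 1) * ω₁) / ω₂)) /
    (∏ k ∈ Finset.range n.toNat,
      2 * Complex.sin (Real.pi * (y + (k : ℂ) * ω₁) / ω₂))

/-- `⟨x⟩ = exp (πi/2 ((1 + ω) x - ω x²)) S₂(x | 1, 1/ω)`. -/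
noncomputable def angleBr (ω : ℝ) (x : ℂ) : ℂ :=
  Complex.exp (Real.pi * Complex.I / 2 * ((1 + ω) * x - ω * x ^ 2)) * doubleSine 1 (1 / ω) x

/-- `σ(x) = exp (πi ((1 + ω) x - ω x²))`. -/
noncomputable def sigmaFn (ω : ℝ) (x : ℂ) : ℂ :=
  Complex.exp (Real.pi * Complex.I * ((1 + ω) * x - ω * x ^ 2))

/-- The set `ℤ_{≥0} + (1/ω) ℤ_{≥0}`. -/
def poleCone (ω : ℝ) : Set ℂ :=
  {p | ∃ m n : ℕ, p = (m : ℂ) + (n : ℂ) / ω}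

/-- A deformation of the imaginary axis, run through from `-i∞` to `i∞`: a piecewise `C¹` curve
that agrees with `t ↦ i t` outside a bounded interval. -/
structure IsVerticalContour (c : ℝ → ℂ) : Prop where
  continuous : Continuous c
  piecewise : ∃ S : Set ℝ, S.Finite ∧ (∀ t ∉ S, DifferentiableAt ℝ c t) ∧
    ContinuousOn (deriv c) Sᶜ ∧ ∃ M : ℝ, ∀ t, ‖deriv c t‖ ≤ M
  eq_axis : ∃ R : ℝ, ∀ t : ℝ, R ≤ |t| → c t = t * Complex.I

/-- `p` is on the left of `c`: it lies in the component of the complement of the curve that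
contains the far left part of the real axis. -/
def IsLeftOf (c : ℝ → ℂ) (p : ℂ) : Prop :=
  ∀ᶠ r : ℝ in Filter.atTop, JoinedIn (Set.range c)ᶜ p (-(r : ℂ))

/-- `p` is on the right of `c`: it lies in the component of the complement of the curve that
contains the far right part of the real axis. -/
def IsRightOf (c : ℝ → ℂ) (p : ℂ) : Prop :=
  ∀ᶠ r : ℝ in Filter.atTop, JoinedIn (Set.range c)ᶜ p (r : ℂ)

/-- `c` is a contour `C₀` for the parameters `(α, β, γ)`: the imaginary axis, deformed so that the
points of `-α + ℤ_{≤0} + (1/ω) ℤ_{≤0}` and `-β + ℤ_{≤0} + (1/ω) ℤ_{≤0}` are on its left, and those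
of `ℤ_{≥0} + (1/ω) ℤ_{≥0}` and `-γ + ℤ_{≥1} + (1/ω) ℤ_{≥1}` are on its right. -/
structure IsBarnesContour (ω : ℝ) (α β γ : ℂ) (c : ℝ → ℂ) : Prop where
  contour : IsVerticalContour c
  left_α : ∀ l ∈ poleCone ω, IsLeftOf c (-α - l)
  left_β : ∀ l ∈ poleCone ω, IsLeftOf c (-β - l)
  right_zero : ∀ l ∈ poleCone ω, IsRightOf c l
  right_γ : ∀ l ∈ poleCone ω, IsRightOf c (-γ + 1 + 1 / ω + l)

/-- `Φ(z) = q^{xz} ⟨z + 1 + 1/ω⟩ ⟨z + γ⟩ / (⟨z + α⟩ ⟨z + β⟩)`, where `q^{xz} = exp (2πiω x z)`. -/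
noncomputable def barnesPhi (ω : ℝ) (α β γ x z : ℂ) : ℂ :=
  Complex.exp (2 * Real.pi * Complex.I * ω * x * z) *
    (angleBr ω (z + 1 + 1 / ω) * angleBr ω (z + γ)) / (angleBr ω (z + α) * angleBr ω (z + β))

/-- The parametrised integrand `Φ(c(t)) c'(t)` of the contour integral of `Φ` along `c`. -/
noncomputable def barnesIntegrand (ω : ℝ) (c : ℝ → ℂ) (α β γ x : ℂ) (t : ℝ) : ℂ :=
  barnesPhi ω α β γ x (c t) * deriv c t

/-- `Ψ(α, β, γ; x) = ⟨α⟩⟨β⟩ / (⟨1⟩⟨γ⟩) ∫_c Φ(z) dz`, computed along the contour `c`. -/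
noncomputable def barnesPsi (ω : ℝ) (c : ℝ → ℂ) (α β γ x : ℂ) : ℂ :=
  angleBr ω α * angleBr ω β / (angleBr ω 1 * angleBr ω γ) *
    ∫ t : ℝ, barnesIntegrand ω c α β γ x t

/-! Write e(u) = exp(2πiu) and let Φ be the integrand of Ψ(α,β,γ;x). The functional equations of the
double sine function become, for meromorphic functions, ⟨u⟩ = ⟨u+1/ω⟩(1-e(u)) and ⟨u⟩⟨1+1/ω-u⟩ =
σ(u). Substituting z ↦ -α-z in the integrand of the first Ψ on the right-hand side turns it into a
constant times Φ(z)(1-e(z+β))/(1-e(z+γ)) (`barnesPhi_reflect_eq_mul`); the second behaves likewise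
with α and β exchanged. At the level of integrands the theorem is therefore the identity A(1-e(z+β))
+ B(1-e(z+α)) = 1-e(z+γ) with A, B independent of z (`one_sub_exp_partial_fraction`). The prefactors
agree because ⟨u⟩⟨1-u⟩ = σ(u+1/ω)(1-e(u)), used at u = γ-α and u = β-α (`connection_coefficient`).

The relation has to be integrated along three unrelated contours. After reflection, all poles lie in
a left family, -α-Λ and -β-Λ, or in a right family, Λ and 1-γ+Λ. These families are disjoint, and
each contour has the poles of its own integrand on the matching side. Then
`sum_contourIntegral_eq_zero` applies: on a large disc each integrand is an exact derivative plus a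
sum of terms a/(z-p), and the integral of 1/(z-p) over a piece of contour is a difference of
logarithms that depends on the contour only through its end points and the side of p
(`cauchy_integral_of_isOnSide`). The linear relation kills the combined residues, hence the
logarithms, and what is left sits at the ends and decays.

Convergence and decay come from `exists_norm_barnesPhi_le`: ⟨u⟩ and its inverse are bounded as Im u
→ +∞ by Phragmén–Lindelöf, and ⟨u⟩ is comparable to σ(u) as Im u → -∞ by reflection. The functional
equation itself rests on the integral representation of -log(2 sin(πx/b))
(`exp_integral_logSineKernel`). -/

section

open MeasureTheory Set Filter Topology

/-! ### Convergence, holomorphy and symmetries of the integral for log S₂. -/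

theorem Complex.norm_sinh_sub_self_le (v : ℂ) : ‖Complex.sinh v - v‖ ≤ ‖v‖ ^ 3 * Real.exp ‖v‖ := by
  have h1 := Complex.norm_exp_sub_sum_le_norm_mul_exp v 3
  have h2 := Complex.norm_exp_sub_sum_le_norm_mul_exp (-v) 3
  simp only [Finset.sum_range_succ, Finset.sum_range_zero, norm_neg] at h1 h2
  have e : Complex.sinh v - v = ((Complex.exp v - (0 + v ^ 0 / (Nat.factorial 0 : ℕ) +
      v ^ 1 / (Nat.factorial 1 : ℕ) + v ^ 2 / (Nat.factorial 2 : ℕ))) -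
      (Complex.exp (-v) - (0 + (-v) ^ 0 / (Nat.factorial 0 : ℕ) +
      (-v) ^ 1 / (Nat.factorial 1 : ℕ) + (-v) ^ 2 / (Nat.factorial 2 : ℕ)))) / 2 := by
    rw [Complex.sinh]
    simp [Nat.factorial]
    ring
  rw [e, norm_div, Complex.norm_ofNat]
  have := norm_sub_le (Complex.exp v - (0 + v ^ 0 / (Nat.factorial 0 : ℕ) +
      v ^ 1 / (Nat.factorial 1 : ℕ) + v ^ 2 / (Nat.factorial 2 : ℕ)))
      (Complex.exp (-v) - (0 + (-v) ^ 0 / (Nat.factorial 0 : ℕ) +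
      (-v) ^ 1 / (Nat.factorial 1 : ℕ) + (-v) ^ 2 / (Nat.factorial 2 : ℕ)))
  linarith

theorem Complex.norm_sinh_le (v : ℂ) : ‖Complex.sinh v‖ ≤ Real.exp |v.re| := by
  rw [Complex.sinh, norm_div, Complex.norm_ofNat]
  have := norm_sub_le (Complex.exp v) (Complex.exp (-v))
  rw [Complex.norm_exp, Complex.norm_exp] at this
  have h1 : Real.exp v.re ≤ Real.exp |v.re| := Real.exp_le_exp.2 (le_abs_self _)
  have h2 : Real.exp (-v).re ≤ Real.exp |v.re| := by
    rw [Complex.neg_re]; exact Real.exp_le_exp.2 (neg_le_abs _)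
  linarith

theorem Real.sinh_sub_self_le {p : ℝ} (hp : 0 ≤ p) : Real.sinh p - p ≤ p ^ 3 * Real.exp p := by
  have := Complex.norm_sinh_sub_self_le (p : ℂ)
  rw [← Complex.ofReal_sinh, ← Complex.ofReal_sub, Complex.norm_real, Complex.norm_real,
    Real.norm_eq_abs, Real.norm_eq_abs, abs_of_nonneg hp] at this
  exact (le_abs_self _).trans this

/-- The integrand of `logDoubleSineStrip`. -/
noncomputable def doubleSineKernel (a b : ℝ) (x : ℂ) (t : ℝ) : ℂ :=
  (Complex.sinh ((x - ((a : ℂ) + b) / 2) * t) /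
        (2 * Complex.sinh ((a : ℂ) * t / 2) * Complex.sinh ((b : ℂ) * t / 2)) -
      (2 * x - a - b) / ((a : ℂ) * b * t)) / t

/-- Since sinh is odd, the denominator of the kernel differs from its leading term abt²/2 only in
order t⁴; this is what makes the regularised kernel bounded near t = 0. -/
theorem Real.sinh_mul_sinh_sub_le {a b t : ℝ} (ha : 0 < a) (hb : 0 < b) (ht : 0 < t) (ht1 : t ≤ 1) :
    2 * Real.sinh (a * t / 2) * Real.sinh (b * t / 2) - a * b * t ^ 2 / 2 ≤
      2 * ((a ^ 3 * Real.exp a) * (b + b ^ 3 * Real.exp b) + a * (b ^ 3 * Real.exp b)) * t ^ 4 := by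
  have key : ∀ c : ℝ, 0 < c → Real.sinh (c * t / 2) - c * t / 2 ≤ c ^ 3 * Real.exp c * t ^ 3 := by
    intro c hc
    have h0 : c * t / 2 ≤ c := by nlinarith
    have h1 : 0 ≤ c * t / 2 := by positivity
    refine (Real.sinh_sub_self_le h1).trans ?_
    have h2 : (c * t / 2) ^ 3 ≤ (c * t) ^ 3 := by gcongr; linarith [mul_pos hc ht]
    calc (c * t / 2) ^ 3 * Real.exp (c * t / 2) ≤ (c * t) ^ 3 * Real.exp c := by gcongr
      _ = _ := by ring
  have ka := key a ha
  have kb := key b hb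
  have hp : a * t / 2 ≤ Real.sinh (a * t / 2) := Real.self_le_sinh_iff.2 (by positivity)
  have hq : b * t / 2 ≤ Real.sinh (b * t / 2) := Real.self_le_sinh_iff.2 (by positivity)
  have hq0 : 0 ≤ b * t / 2 := by positivity
  have hp0 : 0 ≤ a * t / 2 := by positivity
  set P := Real.sinh (a * t / 2)
  set Q := Real.sinh (b * t / 2)
  have ea : 0 ≤ a ^ 3 * Real.exp a := by positivity
  have eb : 0 ≤ b ^ 3 * Real.exp b := by positivity
  set α := a ^ 3 * Real.exp a
  set β := b ^ 3 * Real.exp b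
  have ht3 : t ^ 3 ≤ t := by nlinarith [sq_nonneg t, mul_pos ht ht]
  have hQ : Q ≤ (b + β) * t := by nlinarith [mul_le_mul_of_nonneg_left ht3 eb, mul_pos hb ht]
  have e1 : (P - a * t / 2) * Q ≤ (α * t ^ 3) * ((b + β) * t) := by
    apply mul_le_mul ka hQ (hq0.trans hq) (by positivity)
  have e2 : (a * t / 2) * (Q - b * t / 2) ≤ (a * t) * (β * t ^ 3) := by
    apply mul_le_mul (by linarith) kb (by linarith) (by positivity)
  nlinarith

-- One majorant for both ends of the integral: near 0 the subtracted term cancels the singularity,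
-- and at infinity the quotient of hyperbolic sines decays like exp(-δt), with δ the distance to the
-- edges of the strip. The dependence on x is explicit, which gives local uniformity as well as
-- growth in x.
set_option maxHeartbeats 800000 in
theorem exists_doubleSineKernel_bound {a b : ℝ} (ha : 0 < a) (hb : 0 < b) :
    ∃ K : ℝ, 0 ≤ K ∧ ∀ (δ : ℝ) (x : ℂ) (t : ℝ), |x.re - (a + b) / 2| ≤ (a + b) / 2 - δ → 0 < t →
      ‖doubleSineKernel a b x t‖ ≤ K * Real.exp (2 * ‖x - ((a : ℂ) + b) / 2‖) *
        (Real.exp (-δ * t) + (1 + t ^ 2)⁻¹) := by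
  set C := 2 * ((a ^ 3 * Real.exp a) * (b + b ^ 3 * Real.exp b) + a * (b ^ 3 * Real.exp b)) with hC
  have hC0 : 0 ≤ C := by positivity
  -- Chosen so that sinh(ct/2) ≥ κ(c) exp(ct/2) for t ≥ 1.
  set κ : ℝ → ℝ := fun c => (1 - Real.exp (-c)) / 2 with hκ
  have hκ0 : ∀ c, 0 < c → 0 < κ c := by
    intro c hc
    have : Real.exp (-c) < 1 := by rw [Real.exp_lt_one_iff]; linarith
    simp only [hκ]; linarith
  have hka := hκ0 a ha
  have hkb := hκ0 b hb
  set K1 := 2 * (12 / (a * b) + 4 * C / (a * b) ^ 2) with hK1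
  set K2 := 1 / (2 * κ a * κ b) + 4 / (a * b) with hK2
  have hK1n : 0 ≤ K1 := by positivity
  have hK2n : 0 ≤ K2 := by positivity
  refine ⟨K1 + K2, by positivity, ?_⟩
  intro δ x t hx ht
  set w := x - ((a : ℂ) + b) / 2 with hw
  have hwre : w.re = x.re - (a + b) / 2 := by simp [hw]
  have hn : (0 : ℝ) ≤ ‖w‖ := norm_nonneg _
  have hnz : (t : ℂ) ≠ 0 := by exact_mod_cast ht.ne'
  have haz : (a : ℂ) ≠ 0 := by exact_mod_cast ha.ne'
  have hbz : (b : ℂ) ≠ 0 := by exact_mod_cast hb.ne'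
  set A := 2 * Real.sinh (a * t / 2) * Real.sinh (b * t / 2) with hA
  have hp : a * t / 2 ≤ Real.sinh (a * t / 2) := Real.self_le_sinh_iff.2 (by positivity)
  have hq : b * t / 2 ≤ Real.sinh (b * t / 2) := Real.self_le_sinh_iff.2 (by positivity)
  have hp0 : 0 < a * t / 2 := by positivity
  have hq0 : 0 < b * t / 2 := by positivity
  have hAl : a * b * t ^ 2 / 2 ≤ A := by
    have := mul_le_mul hp hq hq0.le (hp0.le.trans hp)
    rw [hA]; nlinarith
  have hA0 : 0 < A := lt_of_lt_of_le (by positivity) hAl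
  have hAz : (A : ℂ) ≠ 0 := by exact_mod_cast hA0.ne'
  have hker : doubleSineKernel a b x t = (Complex.sinh (w * t) / A - 2 * w / (a * b * t)) / t := by
    rw [doubleSineKernel, hA, hw]
    push_cast
    congr 2
    ring
  have hexp1 : ‖w‖ ≤ Real.exp (2 * ‖w‖) := by
    have := Real.add_one_le_exp (2 * ‖w‖); linarith
  have hE : 0 < Real.exp (-δ * t) := Real.exp_pos _
  have hI : 0 < (1 + t ^ 2)⁻¹ := by positivity
  have hE2 : 0 < Real.exp (2 * ‖w‖) := Real.exp_pos _
  rw [hker, norm_div, Complex.norm_real, Real.norm_eq_abs, abs_of_pos ht, div_le_iff₀ ht]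
  rcases le_total t 1 with ht1 | ht1
  · have hAu : A - a * b * t ^ 2 / 2 ≤ C * t ^ 4 := Real.sinh_mul_sinh_sub_le ha hb ht ht1
    -- The subtracted term 2w/(abt) is wt divided by abt²/2, so the error splits into the one in the
    -- numerator and the one in the denominator.
    have e : Complex.sinh (w * t) / A - 2 * w / (a * b * t) =
        (Complex.sinh (w * t) - w * t) / A - w * t * ((A - a * b * t ^ 2 / 2 : ℝ) : ℂ) /
          (A * ((a * b * t ^ 2 / 2 : ℝ) : ℂ)) := by
      push_cast
      field_simp
      ring
    rw [e]
    refine (norm_sub_le _ _).trans ?_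
    have n1 : ‖(Complex.sinh (w * t) - w * t) / (A : ℂ)‖ ≤
        12 / (a * b) * Real.exp (2 * ‖w‖) * t := by
      rw [norm_div, Complex.norm_real, Real.norm_eq_abs, abs_of_pos hA0, div_le_iff₀ hA0]
      refine (Complex.norm_sinh_sub_self_le _).trans ?_
      rw [norm_mul, Complex.norm_real, Real.norm_eq_abs, abs_of_pos ht]
      have h3 : ‖w‖ ^ 3 ≤ 6 * Real.exp ‖w‖ := by
        have := Real.pow_div_factorial_le_exp ‖w‖ hn 3
        norm_num [Nat.factorial] at this
        linarith
      have h4 : Real.exp (‖w‖ * t) ≤ Real.exp ‖w‖ := Real.exp_le_exp.2 (by nlinarith)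
      have h5 : Real.exp (2 * ‖w‖) = Real.exp ‖w‖ * Real.exp ‖w‖ := by rw [← Real.exp_add]; ring_nf
      calc (‖w‖ * t) ^ 3 * Real.exp (‖w‖ * t) = ‖w‖ ^ 3 * t ^ 3 * Real.exp (‖w‖ * t) := by ring
        _ ≤ (6 * Real.exp ‖w‖) * t ^ 3 * Real.exp ‖w‖ := by gcongr
        _ = 12 / (a * b) * Real.exp (2 * ‖w‖) * t * (a * b * t ^ 2 / 2) := by
          rw [h5]; field_simp; ring
        _ ≤ _ := by gcongr
    have n2 : ‖w * t * ((A - a * b * t ^ 2 / 2 : ℝ) : ℂ) / (A * ((a * b * t ^ 2 / 2 : ℝ) : ℂ))‖ ≤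
        4 * C / (a * b) ^ 2 * Real.exp (2 * ‖w‖) * t := by
      rw [norm_div, norm_mul, norm_mul, norm_mul, Complex.norm_real, Complex.norm_real,
        Complex.norm_real, Complex.norm_real, Real.norm_eq_abs, Real.norm_eq_abs, Real.norm_eq_abs,
        Real.norm_eq_abs, abs_of_pos ht, abs_of_pos hA0, abs_of_nonneg (sub_nonneg.2 hAl),
        abs_of_pos (show 0 < a * b * t ^ 2 / 2 by positivity), div_le_iff₀ (by positivity)]
      calc ‖w‖ * t * (A - a * b * t ^ 2 / 2) ≤ Real.exp (2 * ‖w‖) * t * (C * t ^ 4) := by gcongr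
        _ = 4 * C / (a * b) ^ 2 * Real.exp (2 * ‖w‖) * t *
            ((a * b * t ^ 2 / 2) * (a * b * t ^ 2 / 2)) := by field_simp; ring
        _ ≤ _ := by gcongr
    refine (add_le_add n1 n2).trans ?_
    have h2 : 1 ≤ 2 * (1 + t ^ 2)⁻¹ := by
      have ht2 : t ^ 2 ≤ 1 := pow_le_one₀ ht.le ht1
      rw [← div_eq_mul_inv, le_div_iff₀ (by positivity)]; linarith
    have : 12 / (a * b) * Real.exp (2 * ‖w‖) * t + 4 * C / (a * b) ^ 2 * Real.exp (2 * ‖w‖) * t =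
      K1 / 2 * Real.exp (2 * ‖w‖) * 1 * t := by rw [hK1]; ring
    rw [this]
    calc K1 / 2 * Real.exp (2 * ‖w‖) * 1 * t ≤
          K1 / 2 * Real.exp (2 * ‖w‖) * (2 * (1 + t ^ 2)⁻¹) * t := by gcongr
      _ = K1 * Real.exp (2 * ‖w‖) * (0 + (1 + t ^ 2)⁻¹) * t := by ring
      _ ≤ (K1 + K2) * Real.exp (2 * ‖w‖) * (Real.exp (-δ * t) + (1 + t ^ 2)⁻¹) * t := by
        gcongr; linarith
  · have hsl : ∀ c, 0 < c → κ c * Real.exp (c * t / 2) ≤ Real.sinh (c * t / 2) := by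
      intro c hc
      rw [Real.sinh_eq]
      have : Real.exp (-(c * t / 2)) ≤ Real.exp (-c) * Real.exp (c * t / 2) := by
        rw [← Real.exp_add]; apply Real.exp_le_exp.2; nlinarith
      simp only [hκ]
      linarith
    have hAl2 : 2 * κ a * κ b * Real.exp ((a + b) / 2 * t) ≤ A := by
      have e : Real.exp ((a + b) / 2 * t) = Real.exp (a * t / 2) * Real.exp (b * t / 2) := by
        rw [← Real.exp_add]; ring_nf
      calc 2 * κ a * κ b * Real.exp ((a + b) / 2 * t) =
            2 * (κ a * Real.exp (a * t / 2) * (κ b * Real.exp (b * t / 2))) := by rw [e]; ring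
        _ ≤ 2 * (Real.sinh (a * t / 2) * Real.sinh (b * t / 2)) :=
          mul_le_mul_of_nonneg_left (mul_le_mul (hsl a ha) (hsl b hb)
            (mul_pos hkb (Real.exp_pos _)).le (hp0.le.trans hp)) two_pos.le
        _ = A := by rw [hA]; ring
    refine (norm_sub_le _ _).trans ?_
    have n1 : ‖Complex.sinh (w * t) / (A : ℂ)‖ ≤ 1 / (2 * κ a * κ b) * Real.exp (-δ * t) := by
      rw [norm_div, Complex.norm_real, Real.norm_eq_abs, abs_of_pos hA0, div_le_iff₀ hA0]
      refine (Complex.norm_sinh_le _).trans ?_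
      have e1 : |(w * (t : ℂ)).re| ≤ ((a + b) / 2 - δ) * t := by
        rw [Complex.mul_re, Complex.ofReal_re, Complex.ofReal_im, mul_zero, sub_zero, abs_mul,
          abs_of_pos ht, hwre]
        gcongr
      calc Real.exp |(w * (t : ℂ)).re| ≤ Real.exp (((a + b) / 2 - δ) * t) := Real.exp_le_exp.2 e1
        _ = 1 / (2 * κ a * κ b) * Real.exp (-δ * t) *
            (2 * κ a * κ b * Real.exp ((a + b) / 2 * t)) := by
          have : Real.exp (((a + b) / 2 - δ) * t) =
            Real.exp (-δ * t) * Real.exp ((a + b) / 2 * t) := by rw [← Real.exp_add]; ring_nf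
          rw [this]; field_simp
        _ ≤ _ := by gcongr
    have n2 : ‖2 * w / ((a : ℂ) * b * t)‖ ≤
        4 / (a * b) * Real.exp (2 * ‖w‖) * (1 + t ^ 2)⁻¹ * t := by
      rw [norm_div, norm_mul, norm_mul, norm_mul, Complex.norm_real, Complex.norm_real,
        Complex.norm_real, Real.norm_eq_abs, Real.norm_eq_abs, Real.norm_eq_abs, abs_of_pos ht,
        abs_of_pos ha, abs_of_pos hb, Complex.norm_ofNat, div_le_iff₀ (by positivity)]
      have h2 : 1 ≤ 2 * (1 + t ^ 2)⁻¹ * t ^ 2 := by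
        have ht2 : 1 ≤ t ^ 2 := one_le_pow₀ ht1
        rw [mul_assoc, inv_mul_eq_div, ← mul_div_assoc, le_div_iff₀ (by positivity)]; linarith
      calc 2 * ‖w‖ ≤ 2 * Real.exp (2 * ‖w‖) * 1 := by linarith
        _ ≤ 2 * Real.exp (2 * ‖w‖) * (2 * (1 + t ^ 2)⁻¹ * t ^ 2) := by gcongr
        _ = _ := by field_simp; ring
    refine (add_le_add n1 n2).trans ?_
    have hE1 : 1 ≤ Real.exp (2 * ‖w‖) := Real.one_le_exp (by positivity)
    set X := 1 / (2 * κ a * κ b) with hX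
    set Y := 4 / (a * b) with hY
    have hX0 : 0 ≤ X := by positivity
    have hY0 : 0 ≤ Y := by positivity
    set E := Real.exp (2 * ‖w‖)
    set D := Real.exp (-δ * t)
    set J := (1 + t ^ 2)⁻¹
    calc X * D + Y * E * J * t ≤ X * E * D * t + Y * E * J * t := by
          have : X * D * (1 * 1) ≤ X * D * (E * t) := by gcongr
          linarith
      _ ≤ (X + Y) * E * (D + J) * t := by
        have : 0 ≤ X * E * J * t + Y * E * D * t := by positivity
        linarith
      _ ≤ (K1 + K2) * E * (D + J) * t := by
        rw [← hK2]; gcongr; linarith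

/-- Cauchy's estimate on discs of radius r/4 bounds the derivative of the integrand, so a majorant
of the integrand alone justifies differentiating under the integral. -/
theorem hasDerivAt_integral_of_norm_le {μ : Measure ℝ} {F F' : ℂ → ℝ → ℂ} {bound : ℝ → ℝ} {z₀ : ℂ}
    {r : ℝ} (hr : 0 < r) (hF : ∀ z ∈ Metric.ball z₀ r, AEStronglyMeasurable (F z) μ)
    (hF' : AEStronglyMeasurable (F' z₀) μ)
    (hd : ∀ᵐ t ∂μ, ∀ z ∈ Metric.ball z₀ r, HasDerivAt (fun z => F z t) (F' z t) z)
    (hb : ∀ᵐ t ∂μ, ∀ z ∈ Metric.ball z₀ r, ‖F z t‖ ≤ bound t) (hbi : Integrable bound μ) :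
    Integrable (F' z₀) μ ∧ HasDerivAt (fun z => ∫ t, F z t ∂μ) (∫ t, F' z₀ t ∂μ) z₀ := by
  have hr2 : 0 < r / 2 := by positivity
  refine (hasDerivAt_integral_of_dominated_loc_of_deriv_le (s := Metric.ball z₀ (r / 2))
    (bound := fun t => bound t / (r / 4)) (Metric.ball_mem_nhds _ hr2) ?_ ?_ hF' ?_
    (hbi.div_const _) ?_)
  · filter_upwards [Metric.ball_mem_nhds z₀ hr] with z hz using hF z hz
  · refine hbi.mono' (hF z₀ (Metric.mem_ball_self hr)) ?_
    filter_upwards [hb] with t ht using ht z₀ (Metric.mem_ball_self hr)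
  · filter_upwards [hd, hb] with t hdt hbt z hz
    have hsub : Metric.closedBall z (r / 4) ⊆ Metric.ball z₀ r := by
      intro u hu
      rw [Metric.mem_closedBall] at hu
      rw [Metric.mem_ball] at hz ⊢
      linarith [dist_triangle u z z₀]
    have hzz : z ∈ Metric.ball z₀ r := hsub (Metric.mem_closedBall_self (by positivity))
    rw [← (hdt z hzz).deriv]
    refine Complex.norm_deriv_le_of_forall_mem_sphere_norm_le (by positivity) ?_ ?_
    · refine DifferentiableOn.diffContOnCl (s := Metric.ball z (r / 4)) fun u hu => ?_
      exact (hdt u (hsub (Metric.closure_ball_subset_closedBall hu))).differentiableAt.differentiableWithinAt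
    · intro u hu
      exact hbt u (hsub (Metric.sphere_subset_closedBall hu))
  · filter_upwards [hd] with t hdt z hz
    exact hdt z (Metric.ball_subset_ball (by linarith) hz)

theorem measurable_doubleSineKernel (a b : ℝ) (x : ℂ) : Measurable (doubleSineKernel a b x) := by
  unfold doubleSineKernel
  fun_prop

theorem integrableOn_exp_add_inv {δ : ℝ} (hδ : 0 < δ) :
    IntegrableOn (fun t : ℝ => Real.exp (-δ * t) + (1 + t ^ 2)⁻¹) (Ioi 0) :=
  (exp_neg_integrableOn_Ioi 0 hδ).add integrable_inv_one_add_sq.integrableOn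

theorem integrableOn_doubleSineKernel {a b : ℝ} (ha : 0 < a) (hb : 0 < b) {x : ℂ} (hx : 0 < x.re)
    (hx' : x.re < a + b) : IntegrableOn (doubleSineKernel a b x) (Ioi 0) := by
  obtain ⟨K, -, h⟩ := exists_doubleSineKernel_bound ha hb
  have hδ : 0 < (a + b) / 2 - |x.re - (a + b) / 2| := by
    have : |x.re - (a + b) / 2| < (a + b) / 2 := by rw [abs_lt]; constructor <;> linarith
    linarith
  refine Integrable.mono' ((integrableOn_exp_add_inv hδ).const_mul
    (K * Real.exp (2 * ‖x - ((a : ℂ) + b) / 2‖)))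
    (measurable_doubleSineKernel a b x).aestronglyMeasurable ?_
  filter_upwards [ae_restrict_mem measurableSet_Ioi] with t ht
  exact h _ x t (by linarith) ht

theorem logDoubleSineStrip_eq (a b : ℝ) (x : ℂ) :
    logDoubleSineStrip a b x = ∫ t in Ioi 0, doubleSineKernel a b x t := rfl

/-- An exponential bound for log S₂ means at most doubly exponential growth of S₂ in the strip,
which Phragmén–Lindelöf tolerates. -/
theorem exists_norm_logDoubleSineStrip_le {a b δ : ℝ} (ha : 0 < a) (hb : 0 < b) (hδ : 0 < δ) :
    ∃ C, ∀ x : ℂ, |x.re - (a + b) / 2| ≤ (a + b) / 2 - δ →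
      ‖logDoubleSineStrip a b x‖ ≤ C * Real.exp (2 * ‖x - ((a : ℂ) + b) / 2‖) := by
  obtain ⟨K, -, h⟩ := exists_doubleSineKernel_bound ha hb
  refine ⟨K * ∫ t in Ioi 0, (Real.exp (-δ * t) + (1 + t ^ 2)⁻¹), fun x hx => ?_⟩
  rw [logDoubleSineStrip_eq]
  refine (norm_integral_le_of_norm_le ((integrableOn_exp_add_inv hδ).const_mul
    (K * Real.exp (2 * ‖x - ((a : ℂ) + b) / 2‖))) ?_).trans_eq ?_
  · filter_upwards [ae_restrict_mem measurableSet_Ioi] with t ht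
    exact h _ x t hx ht
  · rw [integral_const_mul]; ring

theorem doubleSineKernel_bound_on_ball {a b : ℝ} (ha : 0 < a) (hb : 0 < b) {x : ℂ} (hx : 0 < x.re)
    (hx' : x.re < a + b) : ∃ r > 0, ∃ bound : ℝ → ℝ, IntegrableOn bound (Ioi 0) ∧
      ∀ z ∈ Metric.ball x r, (0 < z.re ∧ z.re < a + b) ∧
        ∀ t, 0 < t → ‖doubleSineKernel a b z t‖ ≤ bound t := by
  obtain ⟨K, hK, h⟩ := exists_doubleSineKernel_bound ha hb
  set δ := ((a + b) / 2 - |x.re - (a + b) / 2|) / 2 with hδd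
  have hδ : 0 < δ := by
    have : |x.re - (a + b) / 2| < (a + b) / 2 := by rw [abs_lt]; constructor <;> linarith
    linarith
  refine ⟨δ, hδ, fun t => K * Real.exp (2 * (‖x - ((a : ℂ) + b) / 2‖ + δ)) *
    (Real.exp (-δ * t) + (1 + t ^ 2)⁻¹), (integrableOn_exp_add_inv hδ).const_mul _,
    fun z hz => ?_⟩
  have hzx : ‖z - x‖ < δ := by simpa [dist_eq_norm] using hz
  have hre : |z.re - x.re| < δ := by
    refine lt_of_le_of_lt ?_ hzx
    simpa using Complex.abs_re_le_norm (z - x)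
  have hz1 : |z.re - (a + b) / 2| ≤ (a + b) / 2 - δ := by
    have := abs_sub_le z.re x.re ((a + b) / 2)
    linarith
  have hz2 := abs_le.1 hz1
  refine ⟨⟨by linarith, by linarith⟩, fun t ht => (h δ z t hz1 ht).trans ?_⟩
  have : ‖z - ((a : ℂ) + b) / 2‖ ≤ ‖x - ((a : ℂ) + b) / 2‖ + δ := by
    have e : z - ((a : ℂ) + b) / 2 = (x - ((a : ℂ) + b) / 2) + (z - x) := by ring
    rw [e]
    exact (norm_add_le _ _).trans (by linarith)
  exact mul_le_mul_of_nonneg_right (mul_le_mul_of_nonneg_left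
    (Real.exp_le_exp.2 (by linarith)) hK) (by positivity)

theorem hasDerivAt_doubleSineKernel (a b : ℝ) (z : ℂ) (t : ℝ) :
    HasDerivAt (fun z => doubleSineKernel a b z t)
      ((Complex.cosh ((z - ((a : ℂ) + b) / 2) * t) * t /
        (2 * Complex.sinh ((a : ℂ) * t / 2) * Complex.sinh ((b : ℂ) * t / 2)) -
      2 / ((a : ℂ) * b * t)) / t) z := by
  unfold doubleSineKernel
  have h1 : HasDerivAt (fun z : ℂ => (z - ((a : ℂ) + b) / 2) * t) (1 * t) z :=
    ((hasDerivAt_id z).sub_const _).mul_const _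
  have h2 : HasDerivAt (fun z : ℂ => 2 * z - a - b) (2 * 1) z :=
    (((hasDerivAt_id z).const_mul 2).sub_const _).sub_const _
  have := ((h1.csinh.div_const (2 * Complex.sinh ((a : ℂ) * t / 2) *
    Complex.sinh ((b : ℂ) * t / 2))).sub (h2.div_const ((a : ℂ) * b * t))).div_const (t : ℂ)
  exact this.congr_deriv (by ring)

theorem differentiableAt_logDoubleSineStrip {a b : ℝ} (ha : 0 < a) (hb : 0 < b) {x : ℂ}
    (hx : 0 < x.re) (hx' : x.re < a + b) : DifferentiableAt ℂ (logDoubleSineStrip a b) x := by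
  obtain ⟨r, hr, bound, hbi, h⟩ := doubleSineKernel_bound_on_ball ha hb hx hx'
  refine (hasDerivAt_integral_of_norm_le (F := doubleSineKernel a b) (z₀ := x) (r := r)
    (F' := fun z t => ((Complex.cosh ((z - ((a : ℂ) + b) / 2) * t) * t /
        (2 * Complex.sinh ((a : ℂ) * t / 2) * Complex.sinh ((b : ℂ) * t / 2)) -
      2 / ((a : ℂ) * b * t)) / t)) hr
    (fun z _ => (measurable_doubleSineKernel a b z).aestronglyMeasurable) ?_
    (Eventually.of_forall fun t z _ => hasDerivAt_doubleSineKernel a b z t) ?_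
    hbi).2.differentiableAt
  · apply Measurable.aestronglyMeasurable
    fun_prop
  · filter_upwards [ae_restrict_mem measurableSet_Ioi] with t ht z hz
    exact (h z hz).2 t ht

theorem logDoubleSineStrip_comm (a b : ℝ) (x : ℂ) :
    logDoubleSineStrip a b x = logDoubleSineStrip b a x := by
  rw [logDoubleSineStrip_eq, logDoubleSineStrip_eq]
  congr 1
  ext t
  rw [doubleSineKernel, doubleSineKernel, add_comm (a : ℂ) b, sub_right_comm, mul_comm (a : ℂ) b,
    mul_right_comm 2]

theorem logDoubleSineStrip_reflect (a b : ℝ) (x : ℂ) :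
    logDoubleSineStrip a b (a + b - x) = -logDoubleSineStrip a b x := by
  rw [logDoubleSineStrip_eq, logDoubleSineStrip_eq, ← integral_neg]
  congr 1
  ext t
  rw [doubleSineKernel, doubleSineKernel]
  have : ((a : ℂ) + b - x - (a + b) / 2) * t = -((x - (a + b) / 2) * t) := by ring
  rw [this, Complex.sinh_neg]
  ring

theorem logDoubleSineStrip_conj (a b : ℝ) (x : ℂ) :
    logDoubleSineStrip a b (starRingEnd ℂ x) = starRingEnd ℂ (logDoubleSineStrip a b x) := by
  rw [logDoubleSineStrip_eq, logDoubleSineStrip_eq, ← integral_conj]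
  congr 1
  ext t
  rw [doubleSineKernel, doubleSineKernel]
  simp only [map_div₀, map_sub, map_mul, map_add, ← Complex.sinh_conj, Complex.conj_ofReal,
    map_ofNat]

/-! ### The first functional equation: the integral for -log(2 sin(πx/b)). -/

/-- The kernel of the integral representation of `-log (2 sin (π x / b))`. -/
noncomputable def logSineKernel (b : ℝ) (x : ℂ) (t : ℝ) : ℂ :=
  (Complex.cosh ((x - (b : ℂ) / 2) * t) / Complex.sinh ((b : ℂ) * t / 2) - 2 / (b * t)) / t

theorem sinh_ofReal_mul_ne_zero {b t : ℝ} (hb : 0 < b) (ht : 0 < t) :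
    Complex.sinh ((b : ℂ) * t / 2) ≠ 0 := by
  have : 0 < Real.sinh (b * t / 2) := Real.sinh_pos_iff.2 (by positivity)
  have h2 : ((Real.sinh (b * t / 2) : ℝ) : ℂ) ≠ 0 := by exact_mod_cast this.ne'
  push_cast at h2
  exact h2

/-- The identity sinh(u+v) - sinh(u-v) = 2 cosh u sinh v with v = at/2 cancels the factor
sinh(at/2), so the difference no longer involves a. -/
theorem doubleSineKernel_add_sub {a b : ℝ} (ha : 0 < a) (hb : 0 < b) (x : ℂ) {t : ℝ} (ht : 0 < t) :
    doubleSineKernel a b (x + a) t - doubleSineKernel a b x t = logSineKernel b x t := by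
  have h1 := sinh_ofReal_mul_ne_zero ha ht
  have h2 := sinh_ofReal_mul_ne_zero hb ht
  have ha' : (a : ℂ) ≠ 0 := by exact_mod_cast ha.ne'
  have hb' : (b : ℂ) ≠ 0 := by exact_mod_cast hb.ne'
  have ht' : (t : ℂ) ≠ 0 := by exact_mod_cast ht.ne'
  have e1 : (x + a - ((a : ℂ) + b) / 2) * t = (x - (b : ℂ) / 2) * t + (a : ℂ) * t / 2 := by ring
  have e2 : (x - ((a : ℂ) + b) / 2) * t = (x - (b : ℂ) / 2) * t - (a : ℂ) * t / 2 := by ring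
  rw [doubleSineKernel, doubleSineKernel, logSineKernel, e1, e2, Complex.sinh_add,
    Complex.sinh_sub]
  generalize Complex.sinh ((a : ℂ) * t / 2) = A at *
  generalize Complex.sinh ((b : ℂ) * t / 2) = B at *
  generalize Complex.cosh ((x - (b : ℂ) / 2) * t) = C at *
  field_simp
  ring

/-- As a is free in `doubleSineKernel_add_sub`, it may be taken equal to b. -/
theorem integrableOn_logSineKernel {b : ℝ} (hb : 0 < b) {x : ℂ} (hx : 0 < x.re) (hx' : x.re < b) :
    IntegrableOn (logSineKernel b x) (Ioi 0) := by
  refine IntegrableOn.congr_fun (((integrableOn_doubleSineKernel hb hb (x := x + b) (by simp; linarith)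
    (by simp; linarith)).sub (integrableOn_doubleSineKernel hb hb hx (by linarith))))
    (fun t ht => doubleSineKernel_add_sub hb hb x ht) measurableSet_Ioi

theorem logDoubleSineStrip_add {a b : ℝ} (ha : 0 < a) (hb : 0 < b) {x : ℂ} (hx : 0 < x.re)
    (hx' : x.re < b) : logDoubleSineStrip a b (x + a) - logDoubleSineStrip a b x =
      ∫ t in Ioi 0, logSineKernel b x t := by
  rw [logDoubleSineStrip_eq, logDoubleSineStrip_eq, ← integral_sub
    (integrableOn_doubleSineKernel ha hb (by simp; linarith) (by simp; linarith))
    (integrableOn_doubleSineKernel ha hb hx (by linarith))]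
  exact setIntegral_congr_fun measurableSet_Ioi fun t ht => doubleSineKernel_add_sub ha hb x ht

/-- Adding cosh(u-s) and cosh(u+s) and dividing by sinh(2s) leaves cosh u / sinh s, the same kernel
at t/2, and dt/t is scale invariant. This mirrors sin 2y = 2 sin y cos y and will fix a constant of
integration. -/
theorem integral_logSineKernel_duplication {b : ℝ} (hb : 0 < b) {x : ℂ} (hx : 0 < x.re)
    (hx' : x.re < b) : (∫ t in Ioi 0, logSineKernel b (x / 2) t) +
      ∫ t in Ioi 0, logSineKernel b (x / 2 + b / 2) t = ∫ t in Ioi 0, logSineKernel b x t := by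
  have hre : (x / 2).re = x.re / 2 := by simp
  have hre' : (x / 2 + (b : ℂ) / 2).re = x.re / 2 + b / 2 := by simp
  rw [← integral_add (integrableOn_logSineKernel hb (by rw [hre]; linarith) (by rw [hre]; linarith))
    (integrableOn_logSineKernel hb (by rw [hre']; linarith) (by rw [hre']; linarith))]
  have key : ∀ t ∈ Ioi (0 : ℝ), logSineKernel b (x / 2) t + logSineKernel b (x / 2 + b / 2) t =
      (1 / 2 : ℝ) • logSineKernel b x (1 / 2 * t) := by
    intro t ht
    have ht : 0 < t := ht
    have h2 := sinh_ofReal_mul_ne_zero hb (show 0 < 1 / 2 * t by positivity)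
    have h1 := sinh_ofReal_mul_ne_zero hb ht
    have hb' : (b : ℂ) ≠ 0 := by exact_mod_cast hb.ne'
    have ht' : (t : ℂ) ≠ 0 := by exact_mod_cast ht.ne'
    set s := (b : ℂ) * ((1 / 2 * t : ℝ) : ℂ) / 2 with hs
    set u := (x - (b : ℂ) / 2) * ((1 / 2 * t : ℝ) : ℂ) with hu
    have e1 : (x / 2 - (b : ℂ) / 2) * t = u - s := by rw [hu, hs]; push_cast; ring
    have e2 : (x / 2 + b / 2 - (b : ℂ) / 2) * t = u + s := by rw [hu, hs]; push_cast; ring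
    have e3 : (b : ℂ) * t / 2 = 2 * s := by rw [hs]; push_cast; ring
    rw [e3, Complex.sinh_two_mul] at h1
    have hc : Complex.cosh s ≠ 0 := fun h => h1 (by rw [h]; ring)
    rw [logSineKernel, logSineKernel, logSineKernel, ← hs, ← hu, e1, e2, e3, Complex.cosh_add,
      Complex.cosh_sub, Complex.sinh_two_mul, Complex.real_smul]
    push_cast
    field_simp
    ring
  rw [setIntegral_congr_fun measurableSet_Ioi key, integral_smul,
    integral_comp_mul_left_Ioi (fun t => logSineKernel b x t) 0 (by norm_num : (0 : ℝ) < 1 / 2)]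
  simp

theorem hasDerivAt_logSineKernel {b : ℝ} (x : ℂ) {t : ℝ} (ht : t ≠ 0) :
    HasDerivAt (fun x => logSineKernel b x t)
      (Complex.sinh ((x - (b : ℂ) / 2) * t) / Complex.sinh ((b : ℂ) * t / 2)) x := by
  have ht' : (t : ℂ) ≠ 0 := by exact_mod_cast ht
  have h1 : HasDerivAt (fun z : ℂ => (z - (b : ℂ) / 2) * t) (1 * t) x :=
    ((hasDerivAt_id x).sub_const _).mul_const _
  have := ((h1.ccosh.div_const (Complex.sinh ((b : ℂ) * t / 2))).sub_const
    (2 / ((b : ℂ) * t))).div_const (t : ℂ)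
  unfold logSineKernel
  exact this.congr_deriv (by field_simp)

theorem hasDerivAt_integral_logSineKernel {b : ℝ} (hb : 0 < b) {x : ℂ} (hx : 0 < x.re)
    (hx' : x.re < b) :
    IntegrableOn (fun t : ℝ => Complex.sinh ((x - (b : ℂ) / 2) * t) /
      Complex.sinh ((b : ℂ) * t / 2)) (Ioi 0) ∧
    HasDerivAt (fun x => ∫ t in Ioi 0, logSineKernel b x t)
      (∫ t : ℝ in Ioi 0, Complex.sinh ((x - (b : ℂ) / 2) * t) / Complex.sinh ((b : ℂ) * t / 2)) x := by
  obtain ⟨r, hr, B, hB, h⟩ := doubleSineKernel_bound_on_ball hb hb (x := x) hx (by linarith)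
  obtain ⟨r', hr', B', hB', h'⟩ := doubleSineKernel_bound_on_ball hb hb (x := x + b)
    (by simp; linarith) (by simp; linarith)
  refine hasDerivAt_integral_of_norm_le (F := logSineKernel b) (bound := fun t => B' t + B t)
    (F' := fun x t => Complex.sinh ((x - (b : ℂ) / 2) * t) / Complex.sinh ((b : ℂ) * t / 2))
    (lt_min hr hr') (fun z _ => ?_) ?_ ?_ ?_ (hB'.add hB)
  · apply Measurable.aestronglyMeasurable
    unfold logSineKernel
    fun_prop
  · apply Measurable.aestronglyMeasurable
    fun_prop
  · filter_upwards [ae_restrict_mem measurableSet_Ioi] with t ht z hz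
    exact hasDerivAt_logSineKernel z (ne_of_gt ht)
  · filter_upwards [ae_restrict_mem measurableSet_Ioi] with t ht z hz
    rw [← doubleSineKernel_add_sub hb hb z ht]
    refine (norm_sub_le _ _).trans (add_le_add ?_ ?_)
    · exact (h' _ (by simpa using (lt_of_lt_of_le hz (min_le_right _ _)))).2 t ht
    · exact (h _ (Metric.ball_subset_ball (min_le_left _ _) hz)).2 t ht

/-- Rearranges the sums produced by the geometric series into partial sums of the partial fraction
series of the cotangent, up to a term tending to 0. -/
theorem sum_range_cot_telescope (z : ℂ) (N : ℕ) :
    ∑ n ∈ Finset.range N, (1 / ((n : ℂ) + 1 - z) - 1 / (n + z)) =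
      -(1 / z) - (∑ n ∈ Finset.range N, (1 / (z - (n + 1)) + 1 / (z + (n + 1)))) + 1 / (z + N) := by
  induction N with
  | zero => simp
  | succ N ih =>
    rw [Finset.sum_range_succ, Finset.sum_range_succ, ih]
    have e : 1 / ((N : ℂ) + 1 - z) = -(1 / (z - (N + 1))) := by
      rw [← neg_sub z, one_div, one_div, inv_neg]
    rw [e]
    push_cast
    rw [add_comm (N : ℂ) z]
    ring

/-- Expand 1/sinh in a geometric series and integrate termwise. The N-th partial sum is f(t)(1 -
exp(-bNt)), hence dominated by 2|f|, and the integrated series is the partial fraction expansion of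
the cotangent. -/
theorem integral_sinh_div_sinh {b : ℝ} (hb : 0 < b) {x : ℂ} (hx : 0 < x.re) (hx' : x.re < b) :
    ∫ t : ℝ in Ioi 0, Complex.sinh ((x - (b : ℂ) / 2) * t) / Complex.sinh ((b : ℂ) * t / 2) =
      -(Real.pi / b * Complex.cot (Real.pi * (x / b))) := by
  have hb' : (b : ℂ) ≠ 0 := by exact_mod_cast hb.ne'
  set f : ℝ → ℂ := fun t => Complex.sinh ((x - (b : ℂ) / 2) * t) / Complex.sinh ((b : ℂ) * t / 2)
    with hf
  have hfi : IntegrableOn f (Ioi 0) := (hasDerivAt_integral_logSineKernel hb hx hx').1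
  set S : ℕ → ℝ → ℂ := fun N t => ∑ n ∈ Finset.range N,
    (Complex.exp (-(b * ((n : ℂ) + 1) - x) * t) - Complex.exp (-(b * (n : ℂ) + x) * t)) with hS
  have hSf : ∀ N : ℕ, ∀ t : ℝ, 0 < t → S N t = f t * (1 - Complex.exp (-(b * (N : ℂ)) * t)) := by
    intro N t ht
    have h1 := sinh_ofReal_mul_ne_zero hb ht
    induction N with
    | zero => simp [hS]
    | succ N ih =>
      have : S (N + 1) t = S N t + (Complex.exp (-(b * ((N : ℂ) + 1) - x) * t) -
        Complex.exp (-(b * (N : ℂ) + x) * t)) := by simp only [hS]; rw [Finset.sum_range_succ]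
      rw [this, ih]
      have e : Complex.exp (-(b * ((N : ℂ) + 1) - x) * t) - Complex.exp (-(b * (N : ℂ) + x) * t) =
          f t * (Complex.exp (-(b * (N : ℂ)) * t) - Complex.exp (-(b * (N + 1 : ℂ)) * t)) := by
        simp only [hf]
        rw [div_mul_eq_mul_div, eq_div_iff h1, Complex.sinh, Complex.sinh]
        have : ∀ p q r s : ℂ, (p - q) * ((r - s) / 2) = (p * r - p * s - q * r + q * s) / 2 := by
          intros; ring
        rw [this, mul_comm ((Complex.exp ((x - (b : ℂ) / 2) * t) -
          Complex.exp (-((x - (b : ℂ) / 2) * t))) / 2), this]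
        simp only [← Complex.exp_add]
        ring_nf
      rw [e]
      push_cast
      ring
  have hre1 : ∀ n : ℕ, (-(b * ((n : ℂ) + 1) - x)).re < 0 := by
    intro n
    simp
    nlinarith [mul_nonneg hb.le (Nat.cast_nonneg (α := ℝ) n)]
  have hre2 : ∀ n : ℕ, (-(b * (n : ℂ) + x)).re < 0 := by
    intro n
    simp
    nlinarith [mul_nonneg hb.le (Nat.cast_nonneg (α := ℝ) n)]
  have hSint : ∀ N : ℕ, ∫ t in Ioi 0, S N t = (1 / b) * ∑ n ∈ Finset.range N,
      (1 / ((n : ℂ) + 1 - x / b) - 1 / (n + x / b)) := by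
    intro N
    simp only [hS]
    rw [integral_finsetSum, Finset.mul_sum]
    · refine Finset.sum_congr rfl fun n _ => ?_
      rw [integral_sub (integrableOn_exp_mul_complex_Ioi (hre1 n) 0)
        (integrableOn_exp_mul_complex_Ioi (hre2 n) 0), integral_exp_mul_complex_Ioi (hre1 n),
        integral_exp_mul_complex_Ioi (hre2 n)]
      have e1 : (b : ℂ) * (n + 1) - x = b * ((n : ℂ) + 1 - x / b) := by field_simp
      have e2 : (b : ℂ) * n + x = b * ((n : ℂ) + x / b) := by field_simp
      rw [e1, e2]
      simp only [Complex.ofReal_zero, mul_zero, Complex.exp_zero, neg_div_neg_eq]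
      rw [one_div_mul_eq_div, sub_div, div_div, div_div, mul_comm (b : ℂ), mul_comm (b : ℂ)]
    · intro n _
      exact (integrableOn_exp_mul_complex_Ioi (hre1 n) 0).sub
        (integrableOn_exp_mul_complex_Ioi (hre2 n) 0)
  have hlim1 : Tendsto (fun N => ∫ t in Ioi 0, S N t) atTop (𝓝 (∫ t in Ioi 0, f t)) := by
    refine tendsto_integral_of_dominated_convergence (fun t => 2 * ‖f t‖) (fun N => ?_)
      (hfi.norm.const_mul 2) (fun N => ?_) ?_
    · apply Measurable.aestronglyMeasurable
      simp only [hS]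
      fun_prop
    · filter_upwards [ae_restrict_mem measurableSet_Ioi] with t ht
      have ht : 0 < t := ht
      rw [hSf N t ht, norm_mul, mul_comm]
      gcongr
      refine (norm_sub_le _ _).trans ?_
      rw [Complex.norm_exp, norm_one]
      have : Real.exp (-(b * (N : ℂ)) * t).re ≤ 1 := by
        rw [Real.exp_le_one_iff]
        simp
        positivity
      linarith
    · filter_upwards [ae_restrict_mem measurableSet_Ioi] with t ht
      have ht : 0 < t := ht
      have e : ∀ N : ℕ, S N t = f t * (1 - ((Real.exp (-(b * t)) : ℝ) : ℂ) ^ N) := by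
        intro N
        rw [hSf N t ht, Complex.ofReal_exp, ← Complex.exp_nat_mul]
        push_cast
        ring_nf
      simp only [e]
      have : Tendsto (fun N : ℕ => ((Real.exp (-(b * t)) : ℝ) : ℂ) ^ N) atTop (𝓝 0) := by
        apply tendsto_pow_atTop_nhds_zero_of_norm_lt_one
        rw [Complex.norm_real, Real.norm_eq_abs, abs_of_pos (Real.exp_pos _),
          Real.exp_lt_one_iff]
        have := mul_pos hb ht
        linarith
      simpa using (tendsto_const_nhds (x := f t)).mul ((tendsto_const_nhds (x := (1 : ℂ))).sub this)
  have hz : x / b ∈ Complex.integerComplement := by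
    rintro ⟨n, hn⟩
    have : x.re / b = n := by
      have := congrArg Complex.re hn
      simpa [Complex.div_ofReal_re] using this.symm
    have h1 : (0 : ℝ) < n := by rw [← this]; positivity
    have h2 : (n : ℝ) < 1 := by rw [← this, div_lt_one hb]; exact hx'
    have h3 : 0 < n := by exact_mod_cast h1
    have h4 : n < 1 := by exact_mod_cast h2
    omega
  have hcot := (summable_cotTerm hz).hasSum.tendsto_sum_nat
  have hrep := cot_series_rep' hz
  rw [← hrep] at hcot
  have hlast : Tendsto (fun N : ℕ => 1 / (x / b + (N : ℂ))) atTop (𝓝 0) := by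
    simp only [one_div]
    refine tendsto_inv₀_cobounded.comp ?_
    rw [← tendsto_norm_atTop_iff_cobounded]
    have : Tendsto (fun N : ℕ => (N : ℝ) - ‖x / b‖) atTop atTop :=
      tendsto_atTop_add_const_right _ _ tendsto_natCast_atTop_atTop
    refine tendsto_atTop_mono (fun N => ?_) this
    have := norm_sub_norm_le (N : ℂ) (-(x / b))
    rw [sub_neg_eq_add, norm_neg, Complex.norm_natCast, add_comm (N : ℂ)] at this
    exact this
  have hlim2 := (((tendsto_const_nhds (x := -(1 / (x / b)))).sub hcot).add hlast).const_mul
    (1 / (b : ℂ))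
  refine tendsto_nhds_unique hlim1 ((hlim2.congr fun N => ?_).trans_eq ?_)
  · rw [hSint N, sum_range_cot_telescope _ N]
  · ring_nf

theorem sin_pi_div_ne_zero {b : ℝ} (hb : 0 < b) {x : ℂ} (hx : 0 < x.re) (hx' : x.re < b) :
    Complex.sin (Real.pi * x / b) ≠ 0 := by
  intro h
  obtain ⟨k, hk⟩ := Complex.sin_eq_zero_iff.1 h
  have hb' : (b : ℂ) ≠ 0 := by exact_mod_cast hb.ne'
  have hpi : (Real.pi : ℂ) ≠ 0 := by exact_mod_cast Real.pi_ne_zero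
  have : x = ((k * b : ℝ) : ℂ) := by
    push_cast
    field_simp at hk
    rw [hk, mul_comm]
  rw [this, Complex.ofReal_re] at hx hx'
  have h1 : (0 : ℝ) < k := pos_of_mul_pos_left hx hb.le
  have h2 : (k : ℝ) < 1 := by
    by_contra h
    nlinarith
  have h3 : 0 < k := by exact_mod_cast h1
  have h4 : k < 1 := by exact_mod_cast h2
  omega

/-- The left-hand side E has zero derivative on the strip by the cotangent integral, so it is
constant; duplication gives E² = E, and E does not vanish. -/
theorem exp_integral_logSineKernel {b : ℝ} (hb : 0 < b) {x : ℂ} (hx : 0 < x.re) (hx' : x.re < b) :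
    Complex.exp (∫ t in Ioi 0, logSineKernel b x t) * (2 * Complex.sin (Real.pi * x / b)) = 1 := by
  have hb' : (b : ℂ) ≠ 0 := by exact_mod_cast hb.ne'
  set U : Set ℂ := {z | 0 < z.re ∧ z.re < b} with hU
  set E : ℂ → ℂ := fun x => Complex.exp (∫ t in Ioi 0, logSineKernel b x t) *
    (2 * Complex.sin (Real.pi * x / b)) with hE
  have hUo : IsOpen U :=
    (isOpen_lt continuous_const Complex.continuous_re).inter
      (isOpen_lt Complex.continuous_re continuous_const)
  have hUc : Convex ℝ U :=
    (convex_halfSpace_re_gt 0).inter (convex_halfSpace_re_lt b)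
  have hd : ∀ z ∈ U, HasDerivAt E 0 z := by
    intro z hz
    have h1 := (hasDerivAt_integral_logSineKernel hb hz.1 hz.2).2
    rw [integral_sinh_div_sinh hb hz.1 hz.2] at h1
    have h2 : HasDerivAt (fun z : ℂ => Real.pi * z / b) (Real.pi * 1 / b) z :=
      ((hasDerivAt_id z).const_mul _).div_const _
    refine (h1.cexp.mul (h2.csin.const_mul 2)).congr_deriv ?_
    have := sin_pi_div_ne_zero hb hz.1 hz.2
    rw [Complex.cot_eq_cos_div_sin, ← mul_div_assoc (Real.pi : ℂ) z]
    field_simp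
    ring
  have hconst : ∀ z ∈ U, ∀ w ∈ U, E z = E w := by
    intro z hz w hw
    exact hUo.is_const_of_deriv_eq_zero hUc.isPreconnected
      (fun u hu => (hd u hu).differentiableAt.differentiableWithinAt)
      (fun u hu => (hd u hu).deriv) hz hw
  have hre : (x / 2).re = x.re / 2 := by simp
  have hre' : (x / 2 + (b : ℂ) / 2).re = x.re / 2 + b / 2 := by simp
  have m0 : x ∈ U := ⟨hx, hx'⟩
  have m1 : x / 2 ∈ U := ⟨by rw [hre]; linarith, by rw [hre]; linarith⟩
  have m2 : x / 2 + b / 2 ∈ U := ⟨by rw [hre']; linarith, by rw [hre']; linarith⟩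
  have hdup : E (x / 2) * E (x / 2 + b / 2) = E x := by
    simp only [hE]
    rw [← integral_logSineKernel_duplication hb hx hx', Complex.exp_add]
    have e1 : (Real.pi : ℂ) * (x / 2 + b / 2) / b = Real.pi * (x / 2) / b + Real.pi / 2 := by
      field_simp
    have e2 : (Real.pi : ℂ) * x / b = 2 * (Real.pi * (x / 2) / b) := by ring
    rw [e1, Complex.sin_add_pi_div_two, e2, Complex.sin_two_mul]
    ring
  rw [hconst _ m1 _ m0, hconst _ m2 _ m0] at hdup
  have hne : E x ≠ 0 := mul_ne_zero (Complex.exp_ne_zero _)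
    (mul_ne_zero two_ne_zero (sin_pi_div_ne_zero hb hx hx'))
  exact mul_left_cancel₀ hne (by rw [hdup, mul_one])

theorem exp_logDoubleSineStrip_add {a b : ℝ} (ha : 0 < a) (hb : 0 < b) {x : ℂ} (hx : 0 < x.re)
    (hx' : x.re < b) : Complex.exp (logDoubleSineStrip a b x) =
      Complex.exp (logDoubleSineStrip a b (x + a)) * (2 * Complex.sin (Real.pi * x / b)) := by
  have h := exp_integral_logSineKernel hb hx hx'
  rw [← logDoubleSineStrip_add ha hb hx hx', Complex.exp_sub, div_mul_eq_mul_div,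
    div_eq_one_iff_eq (Complex.exp_ne_zero _)] at h
  exact h.symm

/-! ### The double sine function on the plane: functional equations, zeros, poles. -/

section DoubleSine

variable {a b : ℝ}

theorem doubleSine_of_re_le (ha : 0 < a) (b : ℝ) {x : ℂ} (hx : 0 < x.re) (hx' : x.re ≤ a) :
    doubleSine a b x = Complex.exp (logDoubleSineStrip a b x) := by
  have hn : ⌈x.re / a⌉ = 1 := by
    rw [Int.ceil_eq_iff]
    constructor
    · simpa using div_pos hx ha
    · simpa using (div_le_one ha).2 hx'
  simp [doubleSine, hn]

/-- At zeros of the sine both sides are 0, because poles carry the value 0 and division by zero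
gives 0; no points need to be excluded. -/
theorem doubleSine_add_left_of_pos (ha : 0 < a) (b : ℝ) {x : ℂ} (hx : 0 < x.re) :
    doubleSine a b (x + a) = doubleSine a b x / (2 * Complex.sin (Real.pi * x / b)) := by
  have hc : ⌈(x + a).re / a⌉ = ⌈x.re / a⌉ + 1 := by
    rw [Complex.add_re, Complex.ofReal_re, add_div, div_self ha.ne', Int.ceil_add_one]
  have hpos : 0 < ⌈x.re / a⌉ := Int.ceil_pos.2 (div_pos hx ha)
  obtain ⟨m, hm⟩ : ∃ m : ℕ, ⌈x.re / a⌉ = m + 1 := ⟨(⌈x.re / a⌉ - 1).toNat, by omega⟩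
  have e1 : (-((m : ℤ) + 1 + 1 - 1)).toNat = 0 := by omega
  have e2 : ((m : ℤ) + 1 + 1 - 1).toNat = m + 1 := by omega
  have e3 : (-((m : ℤ) + 1 - 1)).toNat = 0 := by omega
  have e4 : ((m : ℤ) + 1 - 1).toNat = m := by omega
  simp only [doubleSine, hc, hm, e1, e2, e3, e4, Finset.prod_range_zero, mul_one]
  have ey : x + a - (((m : ℤ) + 1 + 1 - 1 : ℤ) : ℂ) * a = x - (((m : ℤ) + 1 - 1 : ℤ) : ℂ) * a := by
    push_cast; ring
  have ex : x - (((m : ℤ) + 1 - 1 : ℤ) : ℂ) * a + m * a = x := by push_cast; ring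
  rw [ey, Finset.prod_range_succ, ex, div_div]

theorem doubleSine_of_re_nonpos (ha : 0 < a) (b : ℝ) {x : ℂ} (hx : x.re ≤ 0) :
    doubleSine a b x = doubleSine a b (x + a) * (2 * Complex.sin (Real.pi * x / b)) := by
  have hc : ⌈(x + a).re / a⌉ = ⌈x.re / a⌉ + 1 := by
    rw [Complex.add_re, Complex.ofReal_re, add_div, div_self ha.ne', Int.ceil_add_one]
  have hpos : ⌈x.re / a⌉ ≤ 0 := Int.ceil_le.2 (by simpa using div_nonpos_of_nonpos_of_nonneg hx ha.le)
  obtain ⟨m, hm⟩ : ∃ m : ℕ, ⌈x.re / a⌉ = -(m : ℤ) := ⟨(-⌈x.re / a⌉).toNat, by omega⟩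
  have e1 : (-(-(m : ℤ) + 1 - 1)).toNat = m := by omega
  have e2 : (-(m : ℤ) + 1 - 1).toNat = 0 := by omega
  have e3 : (-(-(m : ℤ) - 1)).toNat = m + 1 := by omega
  have e4 : (-(m : ℤ) - 1).toNat = 0 := by omega
  simp only [doubleSine, hc, hm, e1, e2, e3, e4, Finset.prod_range_zero, div_one]
  have ey : x + a - ((-(m : ℤ) + 1 - 1 : ℤ) : ℂ) * a = x - ((-(m : ℤ) - 1 : ℤ) : ℂ) * a := by
    push_cast; ring
  have ex : x - ((-(m : ℤ) - 1 : ℤ) : ℂ) * a - ((m : ℂ) + 1) * a = x := by push_cast; ring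
  rw [ey, Finset.prod_range_succ, ex, mul_assoc]

/-- The multiplicative form needs Re x < b: at x = b, 2b, … the point x+a is a pole, recorded as 0.
-/
theorem doubleSine_of_re_lt (ha : 0 < a) (hb : 0 < b) {x : ℂ} (hx : x.re < b) :
    doubleSine a b x = doubleSine a b (x + a) * (2 * Complex.sin (Real.pi * x / b)) := by
  rcases le_or_gt x.re 0 with h | h
  · exact doubleSine_of_re_nonpos ha b h
  · rw [doubleSine_add_left_of_pos ha b h, div_mul_cancel₀]
    exact mul_ne_zero two_ne_zero (sin_pi_div_ne_zero hb h hx)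

/-- The definition uses the integral only for Re x ≤ a. Translating by a and comparing with the
functional equation of the integral covers the rest of its strip. -/
theorem doubleSine_eq_exp (ha : 0 < a) (hb : 0 < b) {x : ℂ} (hx : 0 < x.re) (hx' : x.re < a + b) :
    doubleSine a b x = Complex.exp (logDoubleSineStrip a b x) := by
  have key : ∀ n : ℕ, ∀ x : ℂ, 0 < x.re → x.re < a + b → x.re ≤ (n + 1) * a →
      doubleSine a b x = Complex.exp (logDoubleSineStrip a b x) := by
    intro n
    induction n with
    | zero => intro x h0 _ h2; exact doubleSine_of_re_le ha b h0 (by simpa using h2)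
    | succ n ih =>
      intro x h0 h1 h2
      rcases le_or_gt x.re a with h | h
      · exact doubleSine_of_re_le ha b h0 h
      · have hre : (x - a).re = x.re - a := by simp
        have e : x = (x - a) + a := by ring
        have hp : 0 < (x - a).re := by rw [hre]; linarith
        have hl : (x - a).re < b := by rw [hre]; linarith
        rw [e, doubleSine_add_left_of_pos ha b hp, ih (x - a) hp (by linarith)
          (by rw [hre]; push_cast at h2; linarith), exp_logDoubleSineStrip_add ha hb hp hl,
          mul_div_cancel_right₀]
        exact mul_ne_zero two_ne_zero (sin_pi_div_ne_zero hb hp hl)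
  obtain ⟨n, hn⟩ := exists_nat_ge (x.re / a)
  refine key n x hx hx' ?_
  rw [div_le_iff₀ ha] at hn
  linarith

/-- In the basic strip the kernel is odd under x ↦ a+b-x; translation by a carries this to all x. It
holds without exceptions because reflection exchanges zeros with poles and both have the value 0. -/
theorem doubleSine_reflect (ha : 0 < a) (hb : 0 < b) (x : ℂ) :
    doubleSine a b (a + b - x) = (doubleSine a b x)⁻¹ := by
  have hb' : (b : ℂ) ≠ 0 := by exact_mod_cast hb.ne'
  have key : ∀ n : ℕ, ∀ x : ℂ, n * a < x.re → x.re < n * a + (a + b) →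
      doubleSine a b (a + b - x) = (doubleSine a b x)⁻¹ := by
    intro n
    induction n with
    | zero =>
      intro x h0 h1
      simp only [Nat.cast_zero, zero_mul, zero_add] at h0 h1
      rw [doubleSine_eq_exp ha hb h0 h1, doubleSine_eq_exp ha hb (by simp; linarith)
        (by simp; linarith), logDoubleSineStrip_reflect, Complex.exp_neg]
    | succ n ih =>
      intro x h0 h1
      have hre : (x - a).re = x.re - a := by simp
      push_cast at h0 h1
      have hn : 0 ≤ (n : ℝ) * a := by positivity
      have e : x = (x - a) + a := by ring
      have h := ih (x - a) (by rw [hre]; linarith) (by rw [hre]; linarith)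
      rw [e, doubleSine_add_left_of_pos ha b (by rw [hre]; linarith), inv_div, div_eq_mul_inv, ← h,
        doubleSine_of_re_lt ha hb (by simp; linarith)]
      have e1 : (a : ℂ) + b - (x - a + a) + a = a + b - (x - a) := by ring
      have e2 : (Real.pi : ℂ) * (a + b - (x - a + a)) / b = Real.pi - Real.pi * (x - a) / b := by
        field_simp; ring
      rw [e1, e2, Complex.sin_pi_sub]
      ring
  -- The open strips na < Re x < na+a+b overlap, since they are wider than their spacing a, and so
  -- cover Re x > 0.
  have pos : ∀ x : ℂ, 0 < x.re → doubleSine a b (a + b - x) = (doubleSine a b x)⁻¹ := by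
    intro x hx
    rcases lt_or_ge x.re a with h | h
    · exact key 0 x (by simpa using hx) (by simp; linarith)
    · have h1 := Nat.floor_le (div_nonneg hx.le ha.le)
      have h2 := Nat.lt_floor_add_one (x.re / a)
      have h3 : 1 ≤ ⌊x.re / a⌋₊ := Nat.le_floor (by simpa using (one_le_div ha).2 h)
      obtain ⟨m, hm⟩ : ∃ m : ℕ, ⌊x.re / a⌋₊ = m + 1 := ⟨⌊x.re / a⌋₊ - 1, by omega⟩
      rw [hm] at h1 h2
      rw [le_div_iff₀ ha] at h1
      rw [div_lt_iff₀ ha] at h2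
      push_cast at h1 h2
      rcases lt_or_ge x.re (m * a + (a + b)) with h4 | h4
      · exact key m x (by linarith) h4
      · exact key (m + 1) x (by push_cast; linarith) (by push_cast; linarith)
  rcases lt_or_ge 0 x.re with h | h
  · exact pos x h
  · have := pos (a + b - x) (by simp; linarith)
    rw [sub_sub_cancel] at this
    rw [this, inv_inv]

theorem differentiableAt_doubleSine_of_re_lt (ha : 0 < a) (hb : 0 < b) {x : ℂ} (hx : x.re < a + b) :
    DifferentiableAt ℂ (doubleSine a b) x := by
  have strip : ∀ x : ℂ, 0 < x.re → x.re < a + b → DifferentiableAt ℂ (doubleSine a b) x := by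
    intro x h0 h1
    have : doubleSine a b =ᶠ[𝓝 x] fun x => Complex.exp (logDoubleSineStrip a b x) := by
      filter_upwards [(isOpen_lt continuous_const Complex.continuous_re).mem_nhds h0,
        (isOpen_lt Complex.continuous_re continuous_const).mem_nhds h1] with z hz hz'
      exact doubleSine_eq_exp ha hb hz hz'
    exact (this.differentiableAt_iff).2 (differentiableAt_logDoubleSineStrip ha hb h0 h1).cexp
  have key : ∀ n : ℕ, ∀ x : ℂ, -(n * a) < x.re → x.re < a + b →
      DifferentiableAt ℂ (doubleSine a b) x := by
    intro n
    induction n with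
    | zero => intro x h0 h1; exact strip x (by simpa using h0) h1
    | succ n ih =>
      intro x h0 h1
      rcases lt_or_ge 0 x.re with h | h
      · exact strip x h h1
      · have : doubleSine a b =ᶠ[𝓝 x] fun x =>
            doubleSine a b (x + a) * (2 * Complex.sin (Real.pi * x / b)) := by
          filter_upwards [(isOpen_lt Complex.continuous_re continuous_const).mem_nhds
            (show x.re < b by linarith)] with z hz
          exact doubleSine_of_re_lt ha hb hz
        refine (this.differentiableAt_iff).2 (DifferentiableAt.mul ?_ (by fun_prop))
        have h2 := ih (x + a) (by push_cast at h0; simp; linarith) (by simp; linarith)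
        exact h2.comp x (f := fun x => x + (a : ℂ)) (by fun_prop)
  obtain ⟨n, hn⟩ := exists_nat_gt (-x.re / a)
  rw [div_lt_iff₀ ha] at hn
  exact key n x (by linarith) hx

/-- The exponential has no zeros, so each zero comes from a sine factor met while translating to the
right into the basic strip. -/
theorem doubleSine_eq_zero_of_re_lt (ha : 0 < a) (hb : 0 < b) {x : ℂ} (hx : x.re < a + b)
    (h : doubleSine a b x = 0) : ∃ m n : ℕ, x = -((m : ℂ) * a + n * b) := by
  have hb' : (b : ℂ) ≠ 0 := by exact_mod_cast hb.ne'
  have hpi : (Real.pi : ℂ) ≠ 0 := by exact_mod_cast Real.pi_ne_zero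
  have key : ∀ n : ℕ, ∀ x : ℂ, -(n * a) < x.re → x.re < a + b → doubleSine a b x = 0 →
      ∃ m n : ℕ, x = -((m : ℂ) * a + n * b) := by
    intro n
    induction n with
    | zero =>
      intro x h0 h1 h
      rw [doubleSine_eq_exp ha hb (by simpa using h0) h1] at h
      exact absurd h (Complex.exp_ne_zero _)
    | succ n ih =>
      intro x h0 h1 h
      rcases lt_or_ge 0 x.re with h2 | h2
      · rw [doubleSine_eq_exp ha hb h2 h1] at h
        exact absurd h (Complex.exp_ne_zero _)
      · rw [doubleSine_of_re_nonpos ha b h2] at h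
        rcases mul_eq_zero.1 h with h | h
        · push_cast at h0
          obtain ⟨m, k, hmk⟩ := ih (x + a) (by simp; linarith) (by simp; linarith) h
          refine ⟨m + 1, k, ?_⟩
          rw [eq_sub_of_add_eq hmk]
          push_cast
          ring
        · have h3 : Complex.sin (Real.pi * x / b) = 0 := by simpa using h
          obtain ⟨k, hk⟩ := Complex.sin_eq_zero_iff.1 h3
          have hxk : x = k * b := by
            field_simp at hk
            rw [hk, mul_comm]
          have hk0 : k ≤ 0 := by
            rw [hxk] at h2
            simp only [Complex.mul_re, Complex.intCast_re, Complex.ofReal_re, Complex.intCast_im,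
              Complex.ofReal_im, mul_zero, sub_zero] at h2
            by_contra hk
            have : (0 : ℝ) < k := by exact_mod_cast not_le.1 hk
            nlinarith
          refine ⟨0, (-k).toNat, ?_⟩
          have h5 : (((-k).toNat : ℤ) : ℂ) = ((-k : ℤ) : ℂ) := by rw [Int.toNat_of_nonneg (by omega)]
          rw [Int.cast_natCast] at h5
          rw [h5, hxk]
          push_cast
          ring
  obtain ⟨n, hn⟩ := exists_nat_gt (-x.re / a)
  rw [div_lt_iff₀ ha] at hn
  exact key n x (by linarith) hx h

theorem doubleSine_eq_inv_reflect (ha : 0 < a) (hb : 0 < b) :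
    doubleSine a b = fun x => (doubleSine a b (a + b - x))⁻¹ := by
  ext x
  rw [doubleSine_reflect ha hb, inv_inv]

theorem differentiableAt_doubleSine (ha : 0 < a) (hb : 0 < b) {x : ℂ}
    (hx : ∀ m n : ℕ, x ≠ a + b + ((m : ℂ) * a + n * b)) : DifferentiableAt ℂ (doubleSine a b) x := by
  rcases lt_or_ge x.re (a + b) with h | h
  · exact differentiableAt_doubleSine_of_re_lt ha hb h
  · rw [doubleSine_eq_inv_reflect ha hb]
    have h1 : ((a : ℂ) + b - x).re < a + b := by simp; linarith
    refine DifferentiableAt.inv ((differentiableAt_doubleSine_of_re_lt ha hb h1).comp x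
      (by fun_prop)) ?_
    intro h0
    obtain ⟨m, n, hmn⟩ := doubleSine_eq_zero_of_re_lt ha hb h1 h0
    exact hx m n (by linear_combination -hmn)

/-- The second family consists of the poles, where the recorded value is 0. -/
theorem doubleSine_eq_zero (ha : 0 < a) (hb : 0 < b) {x : ℂ} (h : doubleSine a b x = 0) :
    ∃ m n : ℕ, x = -((m : ℂ) * a + n * b) ∨ x = a + b + ((m : ℂ) * a + n * b) := by
  rcases lt_or_ge x.re (a + b) with h1 | h1
  · obtain ⟨m, n, e⟩ := doubleSine_eq_zero_of_re_lt ha hb h1 h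
    exact ⟨m, n, Or.inl e⟩
  · have h2 : doubleSine a b (a + b - x) = 0 := by rw [doubleSine_reflect ha hb, h, inv_zero]
    obtain ⟨m, n, e⟩ := doubleSine_eq_zero_of_re_lt ha hb (by simp; linarith) h2
    exact ⟨m, n, Or.inr (by linear_combination -e)⟩

theorem meromorphicAt_doubleSine (ha : 0 < a) (hb : 0 < b) (x : ℂ) :
    MeromorphicAt (doubleSine a b) x := by
  have lt : ∀ x : ℂ, x.re < a + b → AnalyticAt ℂ (doubleSine a b) x := by
    intro x hx
    rw [Complex.analyticAt_iff_eventually_differentiableAt]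
    filter_upwards [(isOpen_lt Complex.continuous_re continuous_const).mem_nhds hx] with z hz
    exact differentiableAt_doubleSine_of_re_lt ha hb hz
  rcases lt_or_ge x.re (a + b) with h | h
  · exact (lt x h).meromorphicAt
  · rw [doubleSine_eq_inv_reflect ha hb]
    refine MeromorphicAt.fun_inv (AnalyticAt.meromorphicAt ?_)
    exact AnalyticAt.fun_comp (lt _ (by simp; linarith)) (by fun_prop)

/-- The definition treats a and b differently, but the integral is symmetric in them. The equation
thus holds near a/2 and extends by the identity theorem to a half-plane where both sides are
holomorphic. -/
theorem doubleSine_of_re_lt' (ha : 0 < a) (hb : 0 < b) {x : ℂ} (hx : x.re < a) :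
    doubleSine a b x = doubleSine a b (x + b) * (2 * Complex.sin (Real.pi * x / a)) := by
  have ho : IsOpen {z : ℂ | z.re < a} := isOpen_lt Complex.continuous_re continuous_const
  have h1 : AnalyticOnNhd ℂ (doubleSine a b) {z : ℂ | z.re < a} := by
    refine DifferentiableOn.analyticOnNhd (fun z hz => ?_) ho
    exact (differentiableAt_doubleSine_of_re_lt ha hb
      (lt_trans hz (by linarith))).differentiableWithinAt
  have h2 : AnalyticOnNhd ℂ (fun x => doubleSine a b (x + b) * (2 * Complex.sin (Real.pi * x / a)))
      {z : ℂ | z.re < a} := by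
    refine DifferentiableOn.analyticOnNhd (fun z hz => ?_) ho
    have hz : z.re < a := hz
    refine (DifferentiableAt.mul ?_ (by fun_prop)).differentiableWithinAt
    exact (differentiableAt_doubleSine_of_re_lt ha hb (by simpa using hz)).comp z (by fun_prop)
  have h0 : ((a / 2 : ℝ) : ℂ) ∈ {z : ℂ | z.re < a} := by
    show ((a / 2 : ℝ) : ℂ).re < a
    rw [Complex.ofReal_re]; linarith
  refine h1.eqOn_of_preconnected_of_eventuallyEq h2 (convex_halfSpace_re_lt a).isPreconnected h0 ?_ hx
  filter_upwards [ho.mem_nhds h0, (isOpen_lt continuous_const Complex.continuous_re).mem_nhds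
    (show (0 : ℝ) < ((a / 2 : ℝ) : ℂ).re by rw [Complex.ofReal_re]; positivity)] with z hz hz'
  have hz : z.re < a := hz
  rw [doubleSine_eq_exp ha hb hz' (by linarith), doubleSine_eq_exp ha hb (by simp; linarith)
    (by simp; linarith), logDoubleSineStrip_comm a b z, logDoubleSineStrip_comm a b (z + b)]
  exact exp_logDoubleSineStrip_add hb ha hz' hz

theorem doubleSine_add_right_of_pos (ha : 0 < a) (hb : 0 < b) {x : ℂ} (hx : 0 < x.re) :
    doubleSine a b (x + b) = doubleSine a b x / (2 * Complex.sin (Real.pi * x / a)) := by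
  have ha' : (a : ℂ) ≠ 0 := by exact_mod_cast ha.ne'
  have e : (a : ℂ) + b - (x + b) = a - x := by ring
  have e1 : (a : ℂ) - x + b = a + b - x := by ring
  have e2 : (Real.pi : ℂ) * (a - x) / a = Real.pi - Real.pi * x / a := by field_simp
  rw [← inv_inj, ← doubleSine_reflect ha hb, inv_div, e, doubleSine_of_re_lt' ha hb (by simpa using hx),
    e1, doubleSine_reflect ha hb, e2, Complex.sin_pi_sub]
  ring

theorem doubleSine_conj (ha : 0 < a) (hb : 0 < b) {x : ℂ} (hx : 0 < x.re) (hx' : x.re < a + b) :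
    doubleSine a b (starRingEnd ℂ x) = starRingEnd ℂ (doubleSine a b x) := by
  rw [doubleSine_eq_exp ha hb (by simpa using hx) (by simpa using hx'),
    doubleSine_eq_exp ha hb hx hx', logDoubleSineStrip_conj, Complex.exp_conj]

end DoubleSine

/-! ### The functions ⟨x⟩ and σ(x). -/

section AngleBracket

variable {ω : ℝ}

/-- The Gaussian exponent is proportional to x(1+1/ω-x), hence invariant under the reflection; its
square is σ. -/
theorem angleBr_reflect (hω : 0 < ω) (x : ℂ) :
    angleBr ω (1 + 1 / ω - x) = sigmaFn ω x * (angleBr ω x)⁻¹ := by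
  have hω' : (ω : ℂ) ≠ 0 := by exact_mod_cast hω.ne'
  have h := doubleSine_reflect one_pos (one_div_pos.2 hω) x
  push_cast at h
  rw [angleBr, angleBr, sigmaFn, h, mul_inv, ← Complex.exp_neg, ← mul_assoc, ← Complex.exp_add]
  congr 2
  field_simp
  ring

/-- The phase on the right is exactly the one by which the Gaussian factor changes under translation
by 1 or 1/ω, so for ⟨x⟩ the sines turn into factors 1 - e(u). -/
theorem one_sub_exp_eq_sin (u : ℂ) : 1 - Complex.exp (2 * Real.pi * Complex.I * u) =
    2 * Complex.sin (Real.pi * u) * (Complex.exp (-(Real.pi * Complex.I / 2)) *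
      Complex.exp (Real.pi * Complex.I * u)) := by
  have h1 : Complex.exp (-(Real.pi * Complex.I / 2)) = -Complex.I := by
    rw [Complex.exp_neg, mul_div_right_comm, Complex.exp_pi_div_two_mul_I, Complex.inv_I]
  have h2 : Complex.exp (-(Real.pi * u) * Complex.I) * Complex.exp (Real.pi * Complex.I * u) = 1 := by
    rw [← Complex.exp_add, Complex.exp_eq_one_iff]; exact ⟨0, by push_cast; ring⟩
  have h3 : Complex.exp (Real.pi * u * Complex.I) * Complex.exp (Real.pi * Complex.I * u) =
      Complex.exp (2 * Real.pi * Complex.I * u) := by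
    rw [← Complex.exp_add]; ring_nf
  rw [Complex.sin, h1]
  linear_combination h3 - h2 + (Complex.exp (-(Real.pi * u) * Complex.I) * Complex.exp (Real.pi * Complex.I * u)
    - Complex.exp (Real.pi * u * Complex.I) * Complex.exp (Real.pi * Complex.I * u)) * (Complex.I_mul_I)

theorem gauss_add_one (ω : ℝ) (x : ℂ) :
    Complex.exp (Real.pi * Complex.I / 2 * ((1 + ω) * x - ω * x ^ 2)) =
    Complex.exp (Real.pi * Complex.I / 2 * ((1 + ω) * (x + 1) - ω * (x + 1) ^ 2)) *
      (Complex.exp (-(Real.pi * Complex.I / 2)) * Complex.exp (Real.pi * Complex.I * (ω * x))) := by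
  rw [← Complex.exp_add, ← Complex.exp_add]
  congr 1
  ring

theorem gauss_add_inv (hω : 0 < ω) (x : ℂ) :
    Complex.exp (Real.pi * Complex.I / 2 * ((1 + ω) * x - ω * x ^ 2)) =
    Complex.exp (Real.pi * Complex.I / 2 * ((1 + ω) * (x + 1 / ω) - ω * (x + 1 / ω) ^ 2)) *
      (Complex.exp (-(Real.pi * Complex.I / 2)) * Complex.exp (Real.pi * Complex.I * x)) := by
  have hω' : (ω : ℂ) ≠ 0 := by exact_mod_cast hω.ne'
  rw [← Complex.exp_add, ← Complex.exp_add]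
  congr 1
  field_simp
  ring

theorem pi_mul_div_one_div (ω : ℝ) (x : ℂ) :
    (Real.pi : ℂ) * x / ((1 / ω : ℝ) : ℂ) = Real.pi * (ω * x) := by
  push_cast
  rw [div_div_eq_mul_div, div_one]
  ring

theorem pi_mul_div_one (x : ℂ) :
    (Real.pi : ℂ) * x / ((1 : ℝ) : ℂ) = Real.pi * x := by
  simp

theorem angleBr_of_re_lt (hω : 0 < ω) {x : ℂ} (hx : x.re < 1 / ω) :
    angleBr ω x = angleBr ω (x + 1) * (1 - Complex.exp (2 * Real.pi * Complex.I * (ω * x))) := by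
  rw [angleBr, angleBr, doubleSine_of_re_lt one_pos (one_div_pos.2 hω) hx, gauss_add_one,
    one_sub_exp_eq_sin, pi_mul_div_one_div, Complex.ofReal_one]
  ring

theorem angleBr_add_one {x : ℂ} (hx : 0 < x.re) :
    angleBr ω (x + 1) = angleBr ω x / (1 - Complex.exp (2 * Real.pi * Complex.I * (ω * x))) := by
  have h := doubleSine_add_left_of_pos one_pos (1 / ω) hx
  rw [Complex.ofReal_one, pi_mul_div_one_div] at h
  rw [angleBr, angleBr, h, gauss_add_one ω x, one_sub_exp_eq_sin]
  have h1 := Complex.exp_ne_zero (-(Real.pi * Complex.I / 2))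
  have h2 := Complex.exp_ne_zero (Real.pi * Complex.I * (ω * x))
  rw [mul_right_comm, mul_div_mul_right _ _ (mul_ne_zero h1 h2)]
  ring

theorem angleBr_of_re_lt_one (hω : 0 < ω) {x : ℂ} (hx : x.re < 1) :
    angleBr ω x = angleBr ω (x + 1 / ω) * (1 - Complex.exp (2 * Real.pi * Complex.I * x)) := by
  rw [angleBr, angleBr, doubleSine_of_re_lt' one_pos (one_div_pos.2 hω) hx, gauss_add_inv hω,
    one_sub_exp_eq_sin, pi_mul_div_one]
  push_cast
  ring

theorem angleBr_add_inv (hω : 0 < ω) {x : ℂ} (hx : 0 < x.re) :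
    angleBr ω (x + 1 / ω) = angleBr ω x / (1 - Complex.exp (2 * Real.pi * Complex.I * x)) := by
  have h := doubleSine_add_right_of_pos one_pos (one_div_pos.2 hω) hx
  rw [pi_mul_div_one] at h
  push_cast at h
  rw [angleBr, angleBr, h, gauss_add_inv hω x, one_sub_exp_eq_sin]
  have h1 := Complex.exp_ne_zero (-(Real.pi * Complex.I / 2))
  have h2 := Complex.exp_ne_zero (Real.pi * Complex.I * x)
  rw [mul_right_comm, mul_div_mul_right _ _ (mul_ne_zero h1 h2)]
  ring

theorem angleBr_add_inv_mul (hω : 0 < ω) {x : ℂ}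
    (hx : 1 - Complex.exp (2 * Real.pi * Complex.I * x) ≠ 0) :
    angleBr ω x = angleBr ω (x + 1 / ω) * (1 - Complex.exp (2 * Real.pi * Complex.I * x)) := by
  rcases lt_or_ge x.re 1 with h | h
  · exact angleBr_of_re_lt_one hω h
  · rw [angleBr_add_inv hω (by linarith), div_mul_cancel₀ _ hx]

theorem differentiableAt_angleBr (hω : 0 < ω) {x : ℂ} (hx : x - 1 - 1 / ω ∉ poleCone ω) :
    DifferentiableAt ℂ (angleBr ω) x := by
  unfold angleBr
  refine DifferentiableAt.mul (by fun_prop) ?_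
  refine differentiableAt_doubleSine one_pos (one_div_pos.2 hω) fun m n h => hx ⟨m, n, ?_⟩
  rw [h]
  push_cast
  ring

theorem sigmaFn_ne_zero (ω : ℝ) (x : ℂ) : sigmaFn ω x ≠ 0 := Complex.exp_ne_zero _

theorem inv_angleBr (hω : 0 < ω) (x : ℂ) :
    (angleBr ω x)⁻¹ = angleBr ω (1 + 1 / ω - x) / sigmaFn ω x := by
  rw [angleBr_reflect hω, mul_div_cancel_left₀ _ (sigmaFn_ne_zero ω x)]

theorem differentiableAt_inv_angleBr (hω : 0 < ω) {x : ℂ} (hx : -x ∉ poleCone ω) :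
    DifferentiableAt ℂ (fun x => (angleBr ω x)⁻¹) x := by
  simp only [inv_angleBr hω]
  refine DifferentiableAt.div ?_ (by unfold sigmaFn; fun_prop) (sigmaFn_ne_zero ω x)
  refine (differentiableAt_angleBr hω ?_).comp x (f := fun x => 1 + 1 / (ω : ℂ) - x) (by fun_prop)
  rwa [show 1 + 1 / (ω : ℂ) - x - 1 - 1 / ω = -x by ring]

theorem meromorphicAt_angleBr (hω : 0 < ω) (x : ℂ) : MeromorphicAt (angleBr ω) x := by
  unfold angleBr
  refine MeromorphicAt.fun_mul (AnalyticAt.meromorphicAt (by fun_prop)) ?_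
  exact meromorphicAt_doubleSine one_pos (one_div_pos.2 hω) x

theorem angleBr_ne_zero (hω : 0 < ω) {x : ℂ} (h1 : -x ∉ poleCone ω)
    (h2 : x - 1 - 1 / ω ∉ poleCone ω) : angleBr ω x ≠ 0 := by
  refine mul_ne_zero (Complex.exp_ne_zero _) fun h => ?_
  obtain ⟨m, n, e | e⟩ := doubleSine_eq_zero one_pos (one_div_pos.2 hω) h
  · exact h1 ⟨m, n, by rw [e]; push_cast; ring⟩
  · exact h2 ⟨m, n, by rw [e]; push_cast; ring⟩

theorem natCast_mem_poleCone (ω : ℝ) (n : ℕ) : (n : ℂ) ∈ poleCone ω := ⟨n, 0, by simp⟩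

theorem add_inv_mem_poleCone {z : ℂ} (hz : z ∈ poleCone ω) : z + 1 / ω ∈ poleCone ω := by
  obtain ⟨m, n, rfl⟩ := hz
  exact ⟨m, n + 1, by push_cast; ring⟩

theorem add_one_mem_poleCone {z : ℂ} (hz : z ∈ poleCone ω) : z + 1 ∈ poleCone ω := by
  obtain ⟨m, n, rfl⟩ := hz
  exact ⟨m + 1, n, by push_cast; ring⟩

/-- Reflection at u+1/ω combined with one translation by 1/ω. The hypotheses keep u+1/ω away from
zeros and poles. -/
theorem angleBr_mul_angleBr_one_sub (hω : 0 < ω) {u : ℂ} (h1 : -u - 1 / ω ∉ poleCone ω)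
    (h2 : u - 1 ∉ poleCone ω) : angleBr ω u * angleBr ω (1 - u) =
      sigmaFn ω (u + 1 / ω) * (1 - Complex.exp (2 * Real.pi * Complex.I * u)) := by
  have hne : angleBr ω (u + 1 / ω) ≠ 0 :=
    angleBr_ne_zero hω (by rwa [neg_add']) (by rwa [add_sub_right_comm, add_sub_cancel_right])
  have e : 1 - u = 1 + 1 / (ω : ℂ) - (u + 1 / ω) := by ring
  have key : angleBr ω u = angleBr ω (u + 1 / ω) *
      (1 - Complex.exp (2 * Real.pi * Complex.I * u)) := by
    rcases lt_or_ge u.re 1 with h | h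
    · exact angleBr_of_re_lt_one hω h
    · rw [angleBr_add_inv hω (by linarith), div_mul_cancel₀]
      intro h0
      rw [angleBr_add_inv hω (by linarith), h0, div_zero] at hne
      exact hne rfl
  rw [e, angleBr_reflect hω, key]
  field_simp

end AngleBracket

/-! ### Bounds for ⟨x⟩ far from the real axis. -/

section AngleBracketBounds

variable {ω : ℝ}

theorem norm_gauss (hω : 0 < ω) (x : ℂ) :
    ‖Complex.exp (Real.pi * Complex.I / 2 * ((1 + ω) * x - ω * x ^ 2))‖ =
      Real.exp (Real.pi * ω * (x.re - (1 + 1 / ω) / 2) * x.im) := by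
  rw [Complex.norm_exp]
  congr 1
  have e : (Real.pi : ℂ) * Complex.I / 2 * ((1 + ω) * x - ω * x ^ 2) =
    ((Real.pi / 2 : ℝ) : ℂ) * (Complex.I * (((1 + ω : ℝ) : ℂ) * x - (ω : ℂ) * (x * x))) := by
    push_cast; ring
  rw [e, Complex.re_ofReal_mul, Complex.I_mul_re, Complex.sub_im, Complex.im_ofReal_mul,
    Complex.im_ofReal_mul, Complex.mul_im]
  field_simp
  ring

theorem norm_sigmaFn (hω : 0 < ω) (x : ℂ) :
    ‖sigmaFn ω x‖ = Real.exp (2 * Real.pi * ω * (x.re - (1 + 1 / ω) / 2) * x.im) := by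
  have e : sigmaFn ω x = Complex.exp (Real.pi * Complex.I / 2 * ((1 + ω) * x - ω * x ^ 2)) *
      Complex.exp (Real.pi * Complex.I / 2 * ((1 + ω) * x - ω * x ^ 2)) := by
    rw [sigmaFn, ← Complex.exp_add]; ring_nf
  rw [e, norm_mul, norm_gauss hω, ← Real.exp_add]
  ring_nf

/-- Reflection in the central line of the strip keeps Im x and inverts the modulus, since S₂ is real
on the real axis. -/
theorem norm_angleBr_reflect_conj (hω : 0 < ω) {x : ℂ} (hx : 0 < x.re) (hx' : x.re < 1 + 1 / ω) :
    ‖angleBr ω (1 + 1 / ω - starRingEnd ℂ x)‖ = ‖angleBr ω x‖⁻¹ := by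
  have h := doubleSine_reflect one_pos (one_div_pos.2 hω) (starRingEnd ℂ x)
  rw [doubleSine_conj one_pos (one_div_pos.2 hω) hx hx'] at h
  push_cast at h
  rw [angleBr, angleBr, norm_mul, norm_mul, norm_gauss hω, norm_gauss hω, h, norm_inv,
    Complex.norm_conj, mul_inv, ← Real.exp_neg]
  congr 2
  have e : ((1 : ℂ) + 1 / ω).re = 1 + 1 / ω := by simp
  have e' : ((1 : ℂ) + 1 / ω).im = 0 := by simp
  rw [Complex.sub_re, Complex.sub_im, e, e', Complex.conj_re, Complex.conj_im]
  ring

/-- On this line x+1 is the mirror image of x, so translation by 1 reads |⟨x⟩| = |⟨x⟩|⁻¹ |1 -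
e(ωx)|, and e(ωx) is negative real there. -/
theorem norm_angleBr_left_edge (hω : 0 < ω) {x : ℂ} (hx : x.re = 1 / ω / 2) :
    ‖angleBr ω x‖ ^ 2 = 1 + Real.exp (-(2 * Real.pi * ω * x.im)) := by
  have hb : 0 < 1 / ω := one_div_pos.2 hω
  have hω' : (ω : ℂ) ≠ 0 := by exact_mod_cast hω.ne'
  have h1 := norm_angleBr_reflect_conj hω (x := x) (by rw [hx]; positivity) (by rw [hx]; linarith)
  have hxe : x = ((1 / ω / 2 : ℝ) : ℂ) + (x.im : ℂ) * Complex.I := by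
    apply Complex.ext <;> simp [hx]
  have e : 1 + 1 / (ω : ℂ) - starRingEnd ℂ x = x + 1 := by
    apply Complex.ext
    · simp [hx]; ring
    · simp
  have h2 := angleBr_of_re_lt hω (x := x) (by rw [hx]; linarith)
  rw [e] at h1
  have hq : Complex.exp (2 * Real.pi * Complex.I * (ω * x)) =
      -((Real.exp (-(2 * Real.pi * ω * x.im)) : ℝ) : ℂ) := by
    have : 2 * Real.pi * Complex.I * (ω * x) = Real.pi * Complex.I +
        ((-(2 * Real.pi * ω * x.im) : ℝ) : ℂ) := by
      conv_lhs => rw [hxe]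
      push_cast
      have hI := Complex.I_mul_I
      field_simp
      linear_combination (2 * (ω : ℂ) * x.im) * hI
    rw [this, Complex.exp_add, Complex.exp_pi_mul_I, Complex.ofReal_exp]
    ring
  rw [hq, sub_neg_eq_add] at h2
  have h3 : ‖angleBr ω x‖ = ‖angleBr ω x‖⁻¹ * (1 + Real.exp (-(2 * Real.pi * ω * x.im))) := by
    conv_lhs => rw [h2, norm_mul, h1]
    congr 1
    rw [show (1 : ℂ) + ((Real.exp (-(2 * Real.pi * ω * x.im)) : ℝ) : ℂ) =
      ((1 + Real.exp (-(2 * Real.pi * ω * x.im)) : ℝ) : ℂ) by push_cast; ring, Complex.norm_real,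
      Real.norm_eq_abs, abs_of_pos (by positivity)]
  have hne : ‖angleBr ω x‖ ≠ 0 := by
    intro h0
    rw [doubleSine_eq_exp one_pos hb (by rw [hx]; positivity) (by rw [hx]; linarith) |> fun h =>
      (show angleBr ω x = _ * _ from congrArg (Complex.exp (Real.pi * Complex.I / 2 *
        ((1 + ω) * x - ω * x ^ 2)) * ·) h), norm_eq_zero] at h0
    exact mul_ne_zero (Complex.exp_ne_zero _) (Complex.exp_ne_zero _) h0
  rw [pow_two]
  nth_rewrite 2 [h3]
  field_simp

/-- Lower bounds for the auxiliary factor that compensates growth downwards; they hold because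
cos(Re v) ≥ 0. -/
theorem one_le_norm_one_add_exp {v : ℂ} (hv : |v.re| ≤ 1) :
    1 ≤ ‖1 + Complex.exp (Complex.I * v)‖ ∧
      Real.exp (-v.im) ≤ ‖1 + Complex.exp (Complex.I * v)‖ := by
  have hv' := abs_le.1 hv
  have hpi := Real.pi_gt_three
  have hc : 0 ≤ Real.cos v.re := Real.cos_nonneg_of_neg_pi_div_two_le_of_le (by linarith) (by linarith)
  have hre : (Complex.exp (Complex.I * v)).re = Real.exp (-v.im) * Real.cos v.re := by
    rw [Complex.exp_re, Complex.I_mul_re, Complex.I_mul_im]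
  have him : (Complex.exp (Complex.I * v)).im = Real.exp (-v.im) * Real.sin v.re := by
    rw [Complex.exp_im, Complex.I_mul_re, Complex.I_mul_im]
  have hp : 0 ≤ Real.exp (-v.im) * Real.cos v.re := by positivity
  constructor
  · refine le_trans ?_ (Complex.re_le_norm _)
    rw [Complex.add_re, Complex.one_re, hre]
    linarith
  · refine abs_le_of_sq_le_sq' ?_ (norm_nonneg _) |>.2
    rw [Complex.sq_norm, Complex.normSq_apply, Complex.add_re, Complex.add_im, Complex.one_re,
      Complex.one_im, hre, him]
    nlinarith [Real.sin_sq_add_cos_sq v.re]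

theorem norm_one_add_exp_le {v : ℂ} (hv : 0 ≤ v.im) : ‖1 + Complex.exp (Complex.I * v)‖ ≤ 2 := by
  refine (norm_add_le _ _).trans ?_
  rw [norm_one, Complex.norm_exp, Complex.I_mul_re]
  have : Real.exp (-v.im) ≤ 1 := Real.exp_le_one_iff.2 (by linarith)
  linarith

theorem angleBr_growth (hω : 0 < ω) : ∃ B : ℝ, ∀ x : ℂ, |x.re - (1 + 1 / ω) / 2| ≤ 1 / 2 →
    ‖angleBr ω x‖ ≤ Real.exp (B * Real.exp (2 * |x.im|)) := by
  have hb : 0 < 1 / ω := one_div_pos.2 hω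
  obtain ⟨C, hC⟩ := exists_norm_logDoubleSineStrip_le one_pos hb (half_pos hb)
  refine ⟨Real.pi * ω + |C| * Real.exp 1, fun x hx => ?_⟩
  have hx' := abs_le.1 hx
  have hx2 : |x.re - (1 + 1 / ω) / 2| ≤ (1 + 1 / ω) / 2 - 1 / ω / 2 := by linarith
  have h := hC x hx2
  rw [angleBr, norm_mul, norm_gauss hω, doubleSine_eq_exp one_pos hb (by linarith) (by linarith)]
  have h2 : ‖Complex.exp (logDoubleSineStrip 1 (1 / ω) x)‖ ≤
      Real.exp ‖logDoubleSineStrip 1 (1 / ω) x‖ := by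
    rw [Complex.norm_exp]; exact Real.exp_le_exp.2 (Complex.re_le_norm _)
  refine (mul_le_mul_of_nonneg_left h2 (Real.exp_pos _).le).trans ?_
  rw [← Real.exp_add]
  apply Real.exp_le_exp.2
  have hy : |x.im| ≤ Real.exp (2 * |x.im|) := by
    have := Real.add_one_le_exp (2 * |x.im|)
    have := abs_nonneg x.im
    linarith
  have h3 : Real.pi * ω * (x.re - (1 + 1 / ω) / 2) * x.im ≤
      Real.pi * ω * Real.exp (2 * |x.im|) := by
    have : (x.re - (1 + 1 / ω) / 2) * x.im ≤ 1 * |x.im| := by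
      refine (le_abs_self _).trans ?_
      rw [abs_mul]
      gcongr
      linarith
    calc Real.pi * ω * (x.re - (1 + 1 / ω) / 2) * x.im =
          Real.pi * ω * ((x.re - (1 + 1 / ω) / 2) * x.im) := by ring
      _ ≤ Real.pi * ω * (1 * |x.im|) := by gcongr
      _ ≤ _ := by rw [one_mul]; gcongr
  have h4 : ‖x - (((1 : ℝ) : ℂ) + ((1 / ω : ℝ) : ℂ)) / 2‖ ≤ 1 / 2 + |x.im| := by
    refine (Complex.norm_le_abs_re_add_abs_im _).trans ?_
    have e : (x - (((1 : ℝ) : ℂ) + ((1 / ω : ℝ) : ℂ)) / 2).re = x.re - (1 + 1 / ω) / 2 := by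
      rw [← Complex.ofReal_add, Complex.sub_re, Complex.div_ofNat_re, Complex.ofReal_re]
    have e' : (x - (((1 : ℝ) : ℂ) + ((1 / ω : ℝ) : ℂ)) / 2).im = x.im := by
      rw [← Complex.ofReal_add, Complex.sub_im, Complex.div_ofNat_im, Complex.ofReal_im]
      simp
    rw [e, e']
    linarith
  have h5 : ‖logDoubleSineStrip 1 (1 / ω) x‖ ≤ |C| * Real.exp 1 * Real.exp (2 * |x.im|) := by
    refine h.trans ?_
    rw [mul_assoc, ← Real.exp_add]
    have : Real.exp (2 * ‖x - (((1 : ℝ) : ℂ) + ((1 / ω : ℝ) : ℂ)) / 2‖) ≤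
      Real.exp (1 + 2 * |x.im|) := Real.exp_le_exp.2 (by linarith)
    exact mul_le_mul (le_abs_self C) this (Real.exp_pos _).le (abs_nonneg _)
  linarith

/-- Phragmén–Lindelöf in the strip of width 1 around the central line, whose edges x, x+1 are mirror
images with known modulus. The left edge grows like exp(-πω Im x) downwards; dividing by a power of
g removes this, and g is bounded in the upper half. -/
theorem norm_angleBr_le_of_im_nonneg (hω : 0 < ω) : ∃ C : ℝ, 0 < C ∧ ∀ x : ℂ,
    |x.re - (1 + 1 / ω) / 2| ≤ 1 / 2 → 0 ≤ x.im → ‖angleBr ω x‖ ≤ C := by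
  have hb : 0 < 1 / ω := one_div_pos.2 hω
  -- As |g| ≥ exp(-Im x), this power of g dominates the growth on the left edge.
  obtain ⟨N, hN⟩ := exists_nat_ge (Real.pi * ω)
  set c : ℝ := (1 + 1 / ω) / 2 with hc
  set g : ℂ → ℂ := fun x => 1 + Complex.exp (Complex.I * (x - c)) with hg
  have hgl : ∀ x : ℂ, |x.re - c| ≤ 1 / 2 → 1 ≤ ‖g x‖ ∧ Real.exp (-x.im) ≤ ‖g x‖ := by
    intro x hx
    have := one_le_norm_one_add_exp (v := x - c) (by simp; linarith)
    simpa using this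
  set f : ℂ → ℂ := fun x => angleBr ω x * (g x ^ N)⁻¹ with hf
  have hdiff : ∀ x : ℂ, |x.re - c| ≤ 1 / 2 → DifferentiableAt ℂ f x := by
    intro x hx
    have hx' := abs_le.1 hx
    refine DifferentiableAt.mul (differentiableAt_angleBr hω ?_) (DifferentiableAt.inv ?_ ?_)
    · rintro ⟨m, n, h⟩
      have h := congrArg Complex.re h
      simp only [Complex.sub_re, Complex.add_re, Complex.natCast_re,
        ← Complex.ofReal_one, ← Complex.ofReal_div, Complex.ofReal_re,
        Complex.div_ofReal_re] at h
      have h1 : (0 : ℝ) ≤ (m : ℝ) + n / ω := by positivity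
      linarith
    · simp only [hg]; fun_prop
    · have := (hgl x hx).1
      exact pow_ne_zero _ (norm_pos_iff.1 (by linarith))
  have hle : ∀ x : ℂ, |x.re - c| ≤ 1 / 2 → ‖f x‖ ≤ ‖angleBr ω x‖ := by
    intro x hx
    rw [hf, norm_mul, norm_inv, norm_pow]
    exact mul_le_of_le_one_right (norm_nonneg _) (inv_le_one_of_one_le₀ (one_le_pow₀ (hgl x hx).1))
  have habs : ∀ x : ℂ, c - 1 / 2 ≤ x.re → x.re ≤ c + 1 / 2 → |x.re - c| ≤ 1 / 2 :=
    fun x h1 h2 => abs_le.2 ⟨by linarith, by linarith⟩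
  have hPL : ∀ x : ℂ, |x.re - c| ≤ 1 / 2 → ‖f x‖ ≤ 2 := by
    intro x hx
    have hx' := abs_le.1 hx
    refine PhragmenLindelof.vertical_strip (a := c - 1 / 2) (b := c + 1 / 2) (f := f) ?_ ?_ ?_ ?_
      (by linarith) (by linarith)
    · refine DifferentiableOn.diffContOnCl fun z hz => ?_
      rw [Complex.closure_preimage_re, closure_Ioo (by linarith)] at hz
      exact (hdiff z (habs z hz.1 hz.2)).differentiableWithinAt
    · obtain ⟨B, hB⟩ := angleBr_growth hω
      -- For a strip of width 1 the admissible rate in the inner exponential is anything below π;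
      -- here it is 2.
      refine ⟨2, ?_, B, ?_⟩
      · have := Real.pi_gt_three
        rw [show c + 1 / 2 - (c - 1 / 2) = 1 by ring, div_one]
        linarith
      · refine Asymptotics.IsBigO.of_bound 1 ?_
        have : ∀ᶠ z in 𝓟 (Complex.re ⁻¹' Ioo (c - 1 / 2) (c + 1 / 2)),
            ‖f z‖ ≤ 1 * ‖Real.exp (B * Real.exp (2 * |z.im|))‖ := by
          rw [eventually_principal]
          intro z hz
          have hz2 := habs z hz.1.le hz.2.le
          rw [one_mul, Real.norm_eq_abs, abs_of_pos (Real.exp_pos _)]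
          exact (hle z hz2).trans (hB z hz2)
        exact this.filter_mono inf_le_right
    · intro z hz
      have hz2 : |z.re - c| ≤ 1 / 2 := habs z hz.ge (by linarith)
      have h1 := norm_angleBr_left_edge hω (x := z) (by rw [hz, hc]; ring)
      rcases le_total 0 z.im with hi | hi
      · refine (hle z hz2).trans ?_
        have : Real.exp (-(2 * Real.pi * ω * z.im)) ≤ 1 := by
          rw [Real.exp_le_one_iff, neg_nonpos]
          have := Real.pi_pos
          positivity
        nlinarith [norm_nonneg (angleBr ω z)]
      · have h2 : ‖angleBr ω z‖ ≤ 2 * Real.exp (-(Real.pi * ω * z.im)) := by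
          have e : Real.exp (-(2 * Real.pi * ω * z.im)) = Real.exp (-(Real.pi * ω * z.im)) ^ 2 := by
            rw [← Real.exp_nat_mul]; push_cast; ring_nf
          have h3 : 1 ≤ Real.exp (-(Real.pi * ω * z.im)) := by
            apply Real.one_le_exp
            have := mul_nonneg (mul_nonneg Real.pi_pos.le hω.le) (neg_nonneg.2 hi)
            linarith
          rw [e] at h1
          refine abs_le_of_sq_le_sq' ?_ (by positivity) |>.2
          nlinarith
        have h4 : Real.exp (-(Real.pi * ω * z.im)) ≤ ‖g z ^ N‖ := by
          rw [norm_pow]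
          calc Real.exp (-(Real.pi * ω * z.im)) ≤ Real.exp (N * -z.im) := by
                apply Real.exp_le_exp.2
                nlinarith
            _ = Real.exp (-z.im) ^ N := by rw [← Real.exp_nat_mul]
            _ ≤ _ := by gcongr; exact (hgl z hz2).2
        rw [hf, norm_mul, norm_inv, ← div_eq_mul_inv, div_le_iff₀ (lt_of_lt_of_le (Real.exp_pos _) h4)]
        linarith
    · intro z hz
      have hz2 : |z.re - c| ≤ 1 / 2 := habs z (by linarith) hz.le
      refine (hle z hz2).trans ?_
      have e0 : ((1 : ℂ) + 1 / ω).re = 1 + 1 / ω := by simp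
      set u := 1 + 1 / (ω : ℂ) - starRingEnd ℂ z with hu
      have hure : u.re = 1 / ω / 2 := by
        rw [hu, Complex.sub_re, e0, Complex.conj_re, hz, hc]; ring
      have h1 := norm_angleBr_left_edge hω hure
      have h2 := norm_angleBr_reflect_conj hω (x := u) (by rw [hure]; positivity)
        (by rw [hure]; linarith)
      have e2 : 1 + 1 / (ω : ℂ) - starRingEnd ℂ u = z := by
        rw [hu]
        simp
      rw [e2] at h2
      rw [h2]
      refine (inv_le_one_of_one_le₀ ?_).trans one_le_two
      have := Real.exp_pos (-(2 * Real.pi * ω * u.im))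
      by_contra hlt
      nlinarith [norm_nonneg (angleBr ω u)]
  refine ⟨2 * 2 ^ N, by positivity, fun x hx hi => ?_⟩
  have h := hPL x hx
  have hpos : 0 < ‖g x ^ N‖ := by
    rw [norm_pow]; exact pow_pos (lt_of_lt_of_le one_pos (hgl x hx).1) _
  rw [hf, norm_mul, norm_inv, ← div_eq_mul_inv, div_le_iff₀ hpos] at h
  refine h.trans ?_
  rw [norm_pow]
  gcongr
  exact norm_one_add_exp_le (by simpa using hi)

end AngleBracketBounds

section AngleBracketBounds

variable {ω : ℝ}

theorem norm_exp_two_pi_I_mul (u : ℂ) :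
    ‖Complex.exp (2 * Real.pi * Complex.I * u)‖ = Real.exp (-(2 * Real.pi * u.im)) := by
  rw [Complex.norm_exp]
  congr 1
  have e : 2 * Real.pi * Complex.I * u = ((2 * Real.pi : ℝ) : ℂ) * (Complex.I * u) := by
    push_cast; ring
  rw [e, Complex.re_ofReal_mul, Complex.I_mul_re]
  ring

/-- Translations by 1 widen the strip; for Im x ≥ 1 each factor 1 - e(ωx) is bounded above and away
from 0. Mirror reflection turns the upper bound into a lower one. -/
theorem exists_norm_angleBr_bounds (hω : 0 < ω) (M : ℝ) : ∃ C : ℝ, 0 < C ∧ ∀ x : ℂ,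
    |x.re| ≤ M → 1 ≤ x.im → ‖angleBr ω x‖ ≤ C ∧ ‖angleBr ω x‖⁻¹ ≤ C := by
  have hb : 0 < 1 / ω := one_div_pos.2 hω
  set c : ℝ := (1 + 1 / ω) / 2 with hc
  set ρ : ℝ := Real.exp (-(2 * Real.pi * ω)) with hρ
  have hρ1 : ρ < 1 := by
    rw [hρ, Real.exp_lt_one_iff, neg_lt_zero]
    have := Real.pi_pos
    positivity
  set D : ℝ := max 2 (1 - ρ)⁻¹ with hD
  have hD0 : 0 < D := lt_of_lt_of_le two_pos (le_max_left _ _)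
  have hfac : ∀ u : ℂ, 1 ≤ u.im → ‖1 - Complex.exp (2 * Real.pi * Complex.I * (ω * u))‖ ≤ D ∧
      ‖1 - Complex.exp (2 * Real.pi * Complex.I * (ω * u))‖⁻¹ ≤ D := by
    intro u hu
    have h1 : ‖Complex.exp (2 * Real.pi * Complex.I * (ω * u))‖ ≤ ρ := by
      rw [norm_exp_two_pi_I_mul, hρ, Complex.im_ofReal_mul]
      apply Real.exp_le_exp.2
      have : 2 * Real.pi * ω * 1 ≤ 2 * Real.pi * ω * u.im := by
        have := Real.pi_pos
        gcongr
      linarith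
    have h2 := norm_sub_le (1 : ℂ) (Complex.exp (2 * Real.pi * Complex.I * (ω * u)))
    have h3 := norm_sub_norm_le (1 : ℂ) (Complex.exp (2 * Real.pi * Complex.I * (ω * u)))
    rw [norm_one] at h2 h3
    constructor
    · exact le_trans (by linarith) (le_max_left _ _)
    · refine le_trans ?_ (le_max_right _ _)
      exact inv_anti₀ (by linarith) (by linarith)
  have key : ∀ k : ℕ, ∃ C : ℝ, 0 < C ∧ ∀ x : ℂ, |x.re - c| ≤ 1 / 2 + k → 1 ≤ x.im →
      ‖angleBr ω x‖ ≤ C ∧ ‖angleBr ω x‖⁻¹ ≤ C := by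
    intro k
    induction k with
    | zero =>
      obtain ⟨C, hC, h⟩ := norm_angleBr_le_of_im_nonneg hω
      refine ⟨C, hC, fun x hx hi => ?_⟩
      simp only [Nat.cast_zero, add_zero] at hx
      have hx' := abs_le.1 hx
      refine ⟨h x hx (by linarith), ?_⟩
      rw [← norm_angleBr_reflect_conj hω (by linarith) (by linarith)]
      have e : ((1 : ℂ) + 1 / ω).re = 1 + 1 / ω := by simp
      have e' : ((1 : ℂ) + 1 / ω).im = 0 := by simp
      refine h _ ?_ ?_
      · rw [Complex.sub_re, e, Complex.conj_re, ← abs_neg]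
        have : -(1 + 1 / ω - x.re - (1 + 1 / ω) / 2) = x.re - c := by rw [hc]; ring
        rw [this]
        exact hx
      · rw [Complex.sub_im, e', Complex.conj_im]
        linarith
    | succ k ih =>
      obtain ⟨C, hC, h⟩ := ih
      refine ⟨C * D, by positivity, fun x hx hi => ?_⟩
      have hx' := abs_le.1 hx
      push_cast at hx'
      have hk : (0 : ℝ) ≤ k := by positivity
      rcases lt_or_ge c x.re with hr | hr
      · rcases le_or_gt x.re (c + 1 / 2) with hr2 | hr2
        · have h1 := h x (abs_le.2 ⟨by linarith, by linarith⟩) hi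
          have hD1 : 1 ≤ D := le_trans one_le_two (le_max_left _ _)
          have : C ≤ C * D := le_mul_of_one_le_right hC.le hD1
          exact ⟨h1.1.trans this, h1.2.trans this⟩
        · have e : x = (x - 1) + 1 := by ring
          have hre : (x - 1).re = x.re - 1 := by simp
          have him : (x - 1).im = x.im := by simp
          have h1 := h (x - 1) (abs_le.2 ⟨by rw [hre]; linarith, by rw [hre]; linarith⟩)
            (by rw [him]; exact hi)
          have h2 := hfac (x - 1) (by rw [him]; exact hi)
          rcases lt_or_ge 0 (x - 1).re with hp | hp
          · rw [e, angleBr_add_one hp, norm_div, inv_div, div_eq_mul_inv, div_eq_inv_mul]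
            exact ⟨mul_le_mul h1.1 h2.2 (by positivity) hC.le,
              mul_le_mul h1.2 h2.1 (by positivity) hC.le⟩
          · exfalso
            rw [hre] at hp
            linarith
      · rcases lt_or_ge x.re (c - 1 / 2) with hr2 | hr2
        · have hre : (x + 1).re = x.re + 1 := by simp
          have him : (x + 1).im = x.im := by simp
          have h1 := h (x + 1) (abs_le.2 ⟨by rw [hre]; linarith, by rw [hre]; linarith⟩)
            (by rw [him]; exact hi)
          have h2 := hfac x hi
          rw [angleBr_of_re_lt hω (by linarith), norm_mul, mul_inv]
          exact ⟨mul_le_mul h1.1 h2.1 (by positivity) hC.le,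
            mul_le_mul h1.2 h2.2 (by positivity) hC.le⟩
        · have h1 := h x (abs_le.2 ⟨by linarith, by linarith⟩) hi
          have hD1 : 1 ≤ D := le_trans one_le_two (le_max_left _ _)
          have : C ≤ C * D := le_mul_of_one_le_right hC.le hD1
          exact ⟨h1.1.trans this, h1.2.trans this⟩
  obtain ⟨k, hk⟩ := exists_nat_ge (M + c)
  obtain ⟨C, hC, h⟩ := key k
  refine ⟨C, hC, fun x hx hi => h x ?_ hi⟩
  have := abs_sub x.re c
  have hc0 : |c| = c := abs_of_pos (by positivity)
  linarith

/-- Reflection moves the lower half-plane to the upper one at the cost of σ, which is thus the size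
of ⟨x⟩ as Im x → -∞. -/
theorem exists_norm_angleBr_bounds_of_im_le (hω : 0 < ω) (M : ℝ) : ∃ C : ℝ, 0 < C ∧ ∀ x : ℂ,
    |x.re| ≤ M → x.im ≤ -1 → ‖angleBr ω x‖ ≤ ‖sigmaFn ω x‖ * C ∧
      ‖angleBr ω x‖⁻¹ ≤ ‖sigmaFn ω x‖⁻¹ * C := by
  obtain ⟨C, hC, h⟩ := exists_norm_angleBr_bounds hω (1 + 1 / ω + M)
  refine ⟨C, hC, fun x hx hi => ?_⟩
  have hb : 0 < 1 / ω := one_div_pos.2 hω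
  have e : ((1 : ℂ) + 1 / ω).re = 1 + 1 / ω := by simp
  have e' : ((1 : ℂ) + 1 / ω).im = 0 := by simp
  have h1 := h (1 + 1 / ω - x) (by
    rw [Complex.sub_re, e]
    have := abs_sub (1 + 1 / ω) x.re
    rw [abs_of_pos (show 0 < 1 + 1 / ω by positivity)] at this
    linarith) (by rw [Complex.sub_im, e']; linarith)
  have hs : ‖sigmaFn ω x‖ ≠ 0 := norm_ne_zero_iff.2 (sigmaFn_ne_zero ω x)
  rw [angleBr_reflect hω, norm_mul, norm_inv] at h1
  constructor
  · have h2 := h1.2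
    rw [mul_inv, inv_inv] at h2
    calc ‖angleBr ω x‖ = ‖sigmaFn ω x‖ * (‖sigmaFn ω x‖⁻¹ * ‖angleBr ω x‖) := by field_simp
      _ ≤ _ := by gcongr
  · calc ‖angleBr ω x‖⁻¹ = ‖sigmaFn ω x‖⁻¹ * (‖sigmaFn ω x‖ * ‖angleBr ω x‖⁻¹) := by field_simp
      _ ≤ _ := by gcongr; exact h1.1

/-! ### Exponential decay of the integrand. -/

theorem norm_barnesPhi (ω : ℝ) (α β γ x z : ℂ) : ‖barnesPhi ω α β γ x z‖ =
    Real.exp (-(2 * Real.pi * ω * (x.re * z.im + x.im * z.re))) * ‖angleBr ω (z + 1 + 1 / ω)‖ *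
      ‖angleBr ω (z + γ)‖ * ‖angleBr ω (z + α)‖⁻¹ * ‖angleBr ω (z + β)‖⁻¹ := by
  have e : 2 * Real.pi * Complex.I * ω * x * z = 2 * Real.pi * Complex.I * (ω * (x * z)) := by ring
  rw [barnesPhi, e, norm_div, norm_mul, norm_mul, norm_mul, norm_exp_two_pi_I_mul,
    Complex.im_ofReal_mul, Complex.mul_im, div_eq_mul_inv, mul_inv]
  ring_nf

/-- Upwards the four brackets are bounded and q^{xz} decays at rate 2πω Re x. Downwards the four
factors σ contribute κ, giving the rate 2πω(κ - Re x). The hypotheses on Re x say that both rates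
are positive. -/
theorem exists_norm_barnesPhi_le (hω : 0 < ω) {α β γ x : ℂ} (hx : 0 < x.re)
    (hx' : x.re < 1 + 1 / ω + γ.re - α.re - β.re) (M : ℝ) : ∃ C ε T : ℝ, 0 < C ∧ 0 < ε ∧ 0 < T ∧
      ∀ z : ℂ, |z.re| ≤ M → T ≤ |z.im| → ‖barnesPhi ω α β γ x z‖ ≤ C * Real.exp (-ε * |z.im|) := by
  have hb : 0 < 1 / ω := one_div_pos.2 hω
  have hpi := Real.pi_pos
  set κ : ℝ := 1 + 1 / ω + γ.re - α.re - β.re with hκ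
  set M' : ℝ := |M| + (1 + 1 / ω) + |α.re| + |β.re| + |γ.re| with hM'
  set T : ℝ := 1 + |α.im| + |β.im| + |γ.im| with hT
  have hT0 : 0 < T := by positivity
  obtain ⟨C₁, hC₁, h₁⟩ := exists_norm_angleBr_bounds hω M'
  obtain ⟨C₂, hC₂, h₂⟩ := exists_norm_angleBr_bounds_of_im_le hω M'
  -- Collects the bounded contributions to the exponent due to the imaginary parts of the parameters
  -- and to Re z.
  set E : ℝ := |M| * |x.im| + (1 + 1 / ω) * (|M| + (1 + 1 / ω)) + (|M| + |γ.re| + (1 + 1 / ω)) * |γ.im|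
    + (|M| + |α.re| + (1 + 1 / ω)) * |α.im| + (|M| + |β.re| + (1 + 1 / ω)) * |β.im| with hE
  have hE0 : 0 ≤ E := by positivity
  refine ⟨(C₁ ^ 4 + C₂ ^ 4) * Real.exp (2 * Real.pi * ω * E),
    2 * Real.pi * ω * min x.re (κ - x.re), T, by positivity,
    mul_pos (by positivity) (lt_min hx (by linarith)), hT0, fun z hz hi => ?_⟩
  have hM0 : M ≤ |M| := le_abs_self M
  have e0 : (z + 1 + 1 / (ω : ℂ)) = z + ((1 + 1 / ω : ℝ) : ℂ) := by push_cast; ring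
  have hre : ∀ u : ℂ, (z + u).re = z.re + u.re := fun u => Complex.add_re _ _
  have him : ∀ u : ℂ, (z + u).im = z.im + u.im := fun u => Complex.add_im _ _
  have hreb : ∀ u : ℂ, |M| + |u.re| ≤ M' → |(z + u).re| ≤ M' := by
    intro u hu
    rw [hre]
    exact (abs_add_le _ _).trans (by linarith)
  have habs0 : |((1 + 1 / ω : ℝ) : ℂ).re| = 1 + 1 / ω := by
    rw [Complex.ofReal_re, abs_of_pos (by positivity)]
  have nα := abs_nonneg α.re
  have nβ := abs_nonneg β.re
  have nγ := abs_nonneg γ.re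
  have nα' := abs_nonneg α.im
  have nβ' := abs_nonneg β.im
  have nγ' := abs_nonneg γ.im
  have r0 := hreb ((1 + 1 / ω : ℝ) : ℂ) (by rw [habs0, hM']; linarith)
  have rα := hreb α (by rw [hM']; linarith)
  have rβ := hreb β (by rw [hM']; linarith)
  have rγ := hreb γ (by rw [hM']; linarith)
  have hxz : -(x.im * z.re) ≤ |M| * |x.im| := by
    refine (neg_le_abs _).trans ?_
    rw [abs_mul, mul_comm]
    exact mul_le_mul_of_nonneg_right (hz.trans hM0) (abs_nonneg _)
  rw [norm_barnesPhi, e0]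
  rcases le_total 0 z.im with hp | hp
  · rw [abs_of_nonneg hp] at hi ⊢
    have i0 : 1 ≤ (z + ((1 + 1 / ω : ℝ) : ℂ)).im := by
      rw [him, Complex.ofReal_im]; linarith
    have iα : 1 ≤ (z + α).im := by rw [him]; linarith [neg_abs_le α.im]
    have iβ : 1 ≤ (z + β).im := by rw [him]; linarith [neg_abs_le β.im]
    have iγ : 1 ≤ (z + γ).im := by rw [him]; linarith [neg_abs_le γ.im]
    have hexp : -(2 * Real.pi * ω * (x.re * z.im + x.im * z.re)) ≤
        2 * Real.pi * ω * E + -(2 * Real.pi * ω * min x.re (κ - x.re)) * z.im := by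
      have h1 : min x.re (κ - x.re) * z.im ≤ x.re * z.im := by
        gcongr; exact min_le_left _ _
      have h2 : |M| * |x.im| ≤ E := by
        rw [hE]
        have : 0 ≤ (1 + 1 / ω) * (|M| + (1 + 1 / ω)) + (|M| + |γ.re| + (1 + 1 / ω)) * |γ.im|
          + (|M| + |α.re| + (1 + 1 / ω)) * |α.im| + (|M| + |β.re| + (1 + 1 / ω)) * |β.im| := by
          positivity
        linarith
      have h3 : -(x.re * z.im + x.im * z.re) ≤ E + -(min x.re (κ - x.re) * z.im) := by linarith
      calc _ = 2 * Real.pi * ω * -(x.re * z.im + x.im * z.re) := by ring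
        _ ≤ 2 * Real.pi * ω * (E + -(min x.re (κ - x.re) * z.im)) := by gcongr
        _ = _ := by ring
    calc _ ≤ Real.exp (2 * Real.pi * ω * E + -(2 * Real.pi * ω * min x.re (κ - x.re)) * z.im) *
          C₁ * C₁ * C₁ * C₁ := by
          gcongr
          · exact (h₁ _ r0 i0).1
          · exact (h₁ _ rγ iγ).1
          · exact (h₁ _ rα iα).2
          · exact (h₁ _ rβ iβ).2
      _ = C₁ ^ 4 * (Real.exp (2 * Real.pi * ω * E) *
          Real.exp (-(2 * Real.pi * ω * min x.re (κ - x.re)) * z.im)) := by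
        rw [Real.exp_add]; ring
      _ ≤ (C₁ ^ 4 + C₂ ^ 4) * (Real.exp (2 * Real.pi * ω * E) *
          Real.exp (-(2 * Real.pi * ω * min x.re (κ - x.re)) * z.im)) := by
        gcongr
        have : 0 ≤ C₂ ^ 4 := by positivity
        linarith
      _ = _ := by ring
  · rw [abs_of_nonpos hp] at hi ⊢
    have i0 : (z + ((1 + 1 / ω : ℝ) : ℂ)).im ≤ -1 := by
      rw [him, Complex.ofReal_im]; linarith
    have iα : (z + α).im ≤ -1 := by rw [him]; linarith [le_abs_self α.im]
    have iβ : (z + β).im ≤ -1 := by rw [him]; linarith [le_abs_self β.im]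
    have iγ : (z + γ).im ≤ -1 := by rw [him]; linarith [le_abs_self γ.im]
    set s : ℂ → ℝ := fun u => (u.re - (1 + 1 / ω) / 2) * u.im with hs
    have hsig : ∀ u, ‖sigmaFn ω u‖ = Real.exp (2 * Real.pi * ω * s u) := by
      intro u; rw [norm_sigmaFn hω, hs]; ring_nf
    have hsu : ∀ u : ℂ, |s (z + u) - (z.re + u.re - (1 + 1 / ω) / 2) * z.im| ≤
        (|M| + |u.re| + (1 + 1 / ω)) * |u.im| := by
      intro u
      have e : s (z + u) - (z.re + u.re - (1 + 1 / ω) / 2) * z.im =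
          (z.re + u.re - (1 + 1 / ω) / 2) * u.im := by rw [hs]; simp only [hre, him]; ring
      rw [e, abs_mul]
      gcongr
      have h1 := abs_sub (z.re + u.re) ((1 + 1 / ω) / 2)
      have h2 := abs_add_le z.re u.re
      rw [abs_of_pos (show 0 < (1 + 1 / ω) / 2 by positivity)] at h1
      linarith
    have sα := abs_le.1 (hsu α)
    have sβ := abs_le.1 (hsu β)
    have sγ := abs_le.1 (hsu γ)
    have s0 : s (z + ((1 + 1 / ω : ℝ) : ℂ)) = (z.re + (1 + 1 / ω) - (1 + 1 / ω) / 2) * z.im := by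
      rw [hs]; simp only [hre, him, Complex.ofReal_re, Complex.ofReal_im, add_zero]
    have hexp : -(2 * Real.pi * ω * (x.re * z.im + x.im * z.re)) +
        2 * Real.pi * ω * s (z + ((1 + 1 / ω : ℝ) : ℂ)) + 2 * Real.pi * ω * s (z + γ) +
        -(2 * Real.pi * ω * s (z + α)) + -(2 * Real.pi * ω * s (z + β)) ≤
        2 * Real.pi * ω * E + -(2 * Real.pi * ω * min x.re (κ - x.re)) * -z.im := by
      have h1 : min x.re (κ - x.re) * -z.im ≤ (κ - x.re) * -z.im := by
        gcongr
        · linarith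
        · exact min_le_right _ _
      have h2 : 0 ≤ (1 + 1 / ω) * (|M| + (1 + 1 / ω)) := by positivity
      have h3 : -(x.re * z.im + x.im * z.re) + s (z + ((1 + 1 / ω : ℝ) : ℂ)) + s (z + γ) -
          s (z + α) - s (z + β) ≤ E + -(min x.re (κ - x.re) * -z.im) := by
        have : (κ - x.re) * -z.im = -((z.re + (1 + 1 / ω) - (1 + 1 / ω) / 2) * z.im +
          (z.re + γ.re - (1 + 1 / ω) / 2) * z.im - (z.re + α.re - (1 + 1 / ω) / 2) * z.im -
          (z.re + β.re - (1 + 1 / ω) / 2) * z.im) + x.re * z.im := by rw [hκ]; ring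
        rw [s0]
        linarith [sα.1, sβ.1, sγ.2]
      calc _ = 2 * Real.pi * ω * (-(x.re * z.im + x.im * z.re) +
            s (z + ((1 + 1 / ω : ℝ) : ℂ)) + s (z + γ) - s (z + α) - s (z + β)) := by ring
        _ ≤ 2 * Real.pi * ω * (E + -(min x.re (κ - x.re) * -z.im)) := by gcongr
        _ = _ := by ring
    have b0 := (h₂ _ r0 i0).1
    have bγ := (h₂ _ rγ iγ).1
    have bα := (h₂ _ rα iα).2
    have bβ := (h₂ _ rβ iβ).2
    rw [hsig] at b0 bγ bα bβ
    rw [← Real.exp_neg] at bα bβ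
    calc _ ≤ Real.exp (-(2 * Real.pi * ω * (x.re * z.im + x.im * z.re))) *
          (Real.exp (2 * Real.pi * ω * s (z + ((1 + 1 / ω : ℝ) : ℂ))) * C₂) *
          (Real.exp (2 * Real.pi * ω * s (z + γ)) * C₂) *
          (Real.exp (-(2 * Real.pi * ω * s (z + α))) * C₂) *
          (Real.exp (-(2 * Real.pi * ω * s (z + β))) * C₂) := by gcongr
      _ = C₂ ^ 4 * Real.exp (-(2 * Real.pi * ω * (x.re * z.im + x.im * z.re)) +
        2 * Real.pi * ω * s (z + ((1 + 1 / ω : ℝ) : ℂ)) + 2 * Real.pi * ω * s (z + γ) +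
        -(2 * Real.pi * ω * s (z + α)) + -(2 * Real.pi * ω * s (z + β))) := by
        rw [Real.exp_add, Real.exp_add, Real.exp_add, Real.exp_add]; ring
      _ ≤ (C₁ ^ 4 + C₂ ^ 4) *
          Real.exp (2 * Real.pi * ω * E + -(2 * Real.pi * ω * min x.re (κ - x.re)) * -z.im) := by
        gcongr
        have : 0 ≤ C₁ ^ 4 := by positivity
        linarith
      _ = _ := by rw [Real.exp_add]; ring

end AngleBracketBounds

/-! ### Cauchy integrals along deformed vertical lines. -/

/-- A curve with almost everywhere defined bounded derivative that agrees with `t ↦ s + i t` for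
`|t| ≥ R`. -/
structure IsShiftedContour (s : ℂ) (R : ℝ) (c : ℝ → ℂ) : Prop where
  continuous : Continuous c
  differentiable : ∃ S : Set ℝ, S.Countable ∧ ∀ t ∉ S, DifferentiableAt ℝ c t
  bounded : ∃ M : ℝ, ∀ t, ‖deriv c t‖ ≤ M
  eq_axis : ∀ t : ℝ, R ≤ |t| → c t = s + t * Complex.I

/-- For `ε = 1` (`ε = -1`): the point `p` can be joined to points arbitrarily far to the left
(to the right) in the complement of the curve `c`. -/
def IsOnSide (ε : ℝ) (c : ℝ → ℂ) (p : ℂ) : Prop :=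
  ∀ B : ℝ, ∃ z : ℂ, ε * z.re < -B ∧ JoinedIn (range c)ᶜ p z

theorem IsOnSide.notMem_range {ε : ℝ} {c : ℝ → ℂ} {p : ℂ} (h : IsOnSide ε c p) : p ∉ range c := by
  obtain ⟨z, -, hz⟩ := h 0
  exact hz.source_mem

namespace IsShiftedContour

variable {s : ℂ} {R : ℝ} {c : ℝ → ℂ}

theorem intervalIntegrable (hc : IsShiftedContour s R c) {f : ℂ → ℂ} {a b : ℝ}
    (hf : ∀ t ∈ uIcc a b, ContinuousAt f (c t)) :
    IntervalIntegrable (fun t => f (c t) * deriv c t) volume a b := by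
  obtain ⟨M, hM⟩ := hc.bounded
  have hcont : ContinuousOn (fun t => f (c t)) (uIcc a b) := fun t ht =>
    ((hf t ht).comp hc.continuous.continuousAt).continuousWithinAt
  have h1 : IntervalIntegrable (fun t => deriv c t) volume a b := by
    refine IntervalIntegrable.mono_fun' (g := fun _ => M) intervalIntegrable_const
      (measurable_deriv c).aestronglyMeasurable ?_
    exact Eventually.of_forall hM
  exact h1.continuousOn_mul hcont

theorem integral_eq_sub (hc : IsShiftedContour s R c) {f H : ℂ → ℂ} {a b : ℝ}
    (hH : ∀ t ∈ uIcc a b, HasDerivAt H (f (c t)) (c t))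
    (hf : ∀ t ∈ uIcc a b, ContinuousAt f (c t)) :
    ∫ t in a..b, f (c t) * deriv c t = H (c b) - H (c a) := by
  obtain ⟨S, hS, hd⟩ := hc.differentiable
  refine integral_eq_of_hasDerivAt_off_countable (fun t => H (c t)) _ hS (fun t ht => ?_)
    (fun t ht => ?_) (hc.intervalIntegrable hf)
  · exact ((hH t ht).continuousAt.comp hc.continuous.continuousAt).continuousWithinAt
  · have ht' : t ∈ uIcc a b := Ioo_subset_Icc_self ht.1
    have := (hH t ht').scomp t (hd t ht.2).hasDerivAt
    rwa [smul_eq_mul, mul_comm] at this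

theorem exists_norm_le (hc : IsShiftedContour s R c) (T : ℝ) :
    ∃ B : ℝ, ∀ t ∈ Icc (-T) T, ‖c t‖ ≤ B :=
  isCompact_Icc.exists_bound_of_continuousOn hc.continuous.continuousOn

theorem exists_abs_re_le (hc : IsShiftedContour s R c) : ∃ B : ℝ, ∀ t, |(c t).re| ≤ B := by
  obtain ⟨B, hB⟩ := hc.exists_norm_le R
  refine ⟨max B |s.re|, fun t => ?_⟩
  rcases le_total R |t| with h | h
  · rw [hc.eq_axis t h]
    simp
  · exact (Complex.abs_re_le_norm _).trans ((hB t (abs_le.1 h)).trans (le_max_left _ _))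

end IsShiftedContour

theorem Complex.log_div_of_im_pos {w z : ℂ} (hw : 0 < w.im) (hz : 0 < z.im) :
    Complex.log (w / z) = Complex.log w - Complex.log z := by
  have hw0 : w ≠ 0 := fun h => by simp [h] at hw
  have hz0 : z ≠ 0 := fun h => by simp [h] at hz
  have a1 := Complex.arg_nonneg_iff.2 hw.le
  have a2 : Complex.arg w < Real.pi := Complex.arg_lt_pi_iff.2 (Or.inr hw.ne')
  have b1 := Complex.arg_nonneg_iff.2 hz.le
  have b2 : Complex.arg z < Real.pi := Complex.arg_lt_pi_iff.2 (Or.inr hz.ne')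
  rw [div_eq_mul_inv, Complex.log_mul hw0 (inv_ne_zero hz0), Complex.log_inv _ b2.ne, sub_eq_add_neg]
  rw [Complex.arg_inv, if_neg b2.ne]
  exact ⟨by linarith, by linarith⟩

theorem Complex.log_div_of_im_neg {w z : ℂ} (hw : w.im < 0) (hz : z.im < 0) :
    Complex.log (w / z) = Complex.log w - Complex.log z := by
  have hw0 : w ≠ 0 := fun h => by simp [h] at hw
  have hz0 : z ≠ 0 := fun h => by simp [h] at hz
  have a1 := Complex.arg_neg_iff.2 hw
  have a2 := Complex.neg_pi_lt_arg w
  have b1 := Complex.arg_neg_iff.2 hz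
  have b2 := Complex.neg_pi_lt_arg z
  have b3 : Complex.arg z ≠ Real.pi := by linarith [Real.pi_pos] |> fun h : Complex.arg z < Real.pi => h.ne
  rw [div_eq_mul_inv, Complex.log_mul hw0 (inv_ne_zero hz0), Complex.log_inv _ b3, sub_eq_add_neg]
  rw [Complex.arg_inv, if_neg b3]
  exact ⟨by linarith, by linarith⟩

theorem Complex.log_div_of_im_mul_pos {w z : ℂ} (h : 0 < w.im * z.im) :
    Complex.log (w / z) = Complex.log w - Complex.log z := by
  rcases mul_pos_iff.1 h with ⟨h1, h2⟩ | ⟨h1, h2⟩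
  · exact Complex.log_div_of_im_pos h1 h2
  · exact Complex.log_div_of_im_neg h1 h2

theorem hasDerivAt_log_mul_sub {ε : ℝ} (hε : ε ≠ 0) {p z : ℂ}
    (hz : (ε : ℂ) * (z - p) ∈ Complex.slitPlane) :
    HasDerivAt (fun z => Complex.log (ε * (z - p))) (z - p)⁻¹ z := by
  have hε' : (ε : ℂ) ≠ 0 := by exact_mod_cast hε
  have h := (((hasDerivAt_id z).sub_const p).const_mul (ε : ℂ)).clog hz
  refine h.congr_deriv ?_
  simp only [id]
  rw [mul_one, ← div_div, div_self hε', one_div]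

theorem mul_sub_mem_slitPlane_of_im_ne {ε : ℝ} (hε : ε ≠ 0) {p z : ℂ} (h : z.im ≠ p.im) :
    (ε : ℂ) * (z - p) ∈ Complex.slitPlane := by
  refine Complex.mem_slitPlane_iff.2 (Or.inr ?_)
  rw [Complex.im_ofReal_mul, Complex.sub_im]
  exact mul_ne_zero hε (sub_ne_zero.2 h)

theorem continuousAt_sub_inv {p z : ℂ} (h : z ≠ p) : ContinuousAt (fun z => (z - p)⁻¹) z :=
  ContinuousAt.inv₀ (by fun_prop) (sub_ne_zero.2 h)

namespace IsShiftedContour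

variable {s : ℂ} {R : ℝ} {c : ℝ → ℂ}

/-- The Cauchy integral over a compact piece of `c` is locally constant up to the logarithms of its
end points. -/
theorem eventually_cauchy_sub_eq (hc : IsShiftedContour s R c) {T : ℝ} (hT : 0 ≤ T) {p₀ : ℂ}
    (hp₀ : p₀ ∉ range c) : ∀ᶠ p in 𝓝 p₀,
      (∫ t in (-T)..T, (c t - p)⁻¹ * deriv c t) - (∫ t in (-T)..T, (c t - p₀)⁻¹ * deriv c t) =
        Complex.log ((c T - p) / (c T - p₀)) - Complex.log ((c (-T) - p) / (c (-T) - p₀)) := by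
  have hTT : -T ≤ T := by linarith
  have hne : ∀ t, c t ≠ p₀ := fun t h => hp₀ ⟨t, h⟩
  obtain ⟨δ, hδ, hδ'⟩ : ∃ δ > 0, ∀ t ∈ Icc (-T) T, δ ≤ ‖c t - p₀‖ := by
    have hcont : ContinuousOn (fun t => ‖c t - p₀‖) (Icc (-T) T) :=
      (hc.continuous.sub continuous_const).norm.continuousOn
    obtain ⟨t₀, -, h⟩ := isCompact_Icc.exists_isMinOn ⟨0, by constructor <;> linarith⟩ hcont
    exact ⟨‖c t₀ - p₀‖, norm_pos_iff.2 (sub_ne_zero.2 (hne t₀)), fun t ht => h ht⟩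
  filter_upwards [Metric.ball_mem_nhds p₀ hδ] with p hp
  rw [Metric.mem_ball, dist_eq_norm] at hp
  have hne' : ∀ t ∈ uIcc (-T) T, c t ≠ p := by
    intro t ht h
    rw [uIcc_of_le hTT] at ht
    have := hδ' t ht
    rw [h] at this
    linarith
  have hslit : ∀ t ∈ uIcc (-T) T, (c t - p) / (c t - p₀) ∈ Complex.slitPlane := by
    intro t ht
    rw [uIcc_of_le hTT] at ht
    have h0 : c t - p₀ ≠ 0 := sub_ne_zero.2 (hne t)
    have e : (c t - p) / (c t - p₀) = 1 + (p₀ - p) / (c t - p₀) := by field_simp; ring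
    rw [e]
    apply Complex.mem_slitPlane_of_norm_lt_one
    rw [norm_div, div_lt_one (norm_pos_iff.2 h0), norm_sub_rev]
    exact lt_of_lt_of_le hp (hδ' t ht)
  have i1 := hc.intervalIntegrable (f := fun z => (z - p)⁻¹) (a := -T) (b := T)
    fun t ht => continuousAt_sub_inv (hne' t ht)
  have i2 := hc.intervalIntegrable (f := fun z => (z - p₀)⁻¹) (a := -T) (b := T)
    fun t ht => continuousAt_sub_inv (hne t)
  rw [← intervalIntegral.integral_sub i1 i2]
  simp only [← sub_mul]
  refine hc.integral_eq_sub (f := fun z => (z - p)⁻¹ - (z - p₀)⁻¹)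
    (H := fun z => Complex.log ((z - p) / (z - p₀))) (fun t ht => ?_) (fun t ht => ?_)
  · have h0 : c t - p₀ ≠ 0 := sub_ne_zero.2 (hne t)
    have h1 : c t - p ≠ 0 := sub_ne_zero.2 (hne' t ht)
    have := ((((hasDerivAt_id (c t)).sub_const p).div ((hasDerivAt_id (c t)).sub_const p₀) h0)).clog
      (hslit t ht)
    refine this.congr_deriv ?_
    simp only [id, Pi.div_apply]
    field_simp
  · exact (continuousAt_sub_inv (hne' t ht)).sub (continuousAt_sub_inv (hne t))

theorem cauchy_integral_of_im_ne (hc : IsShiftedContour s R c) {ε : ℝ} (hε : ε ≠ 0) {p : ℂ}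
    {a b : ℝ} (h : ∀ t ∈ uIcc a b, (c t).im ≠ p.im) :
    ∫ t in a..b, (c t - p)⁻¹ * deriv c t =
      Complex.log (ε * (c b - p)) - Complex.log (ε * (c a - p)) := by
  refine hc.integral_eq_sub (f := fun z => (z - p)⁻¹)
    (H := fun z => Complex.log (ε * (z - p))) (fun t ht => ?_) (fun t ht => ?_)
  · exact hasDerivAt_log_mul_sub hε (mul_sub_mem_slitPlane_of_im_ne hε (h t ht))
  · exact continuousAt_sub_inv fun h' => h t ht (congrArg Complex.im h')

theorem im_eq (hc : IsShiftedContour s R c) {t : ℝ} (ht : R ≤ |t|) : (c t).im = s.im + t := by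
  rw [hc.eq_axis t ht]; simp

/-- This takes the place of winding numbers. The cut of log(ε(z-p)) runs from p towards the side
where p lies, as if the contour were a straight line. The defect of the formula is locally constant
in p along a path avoiding the curve, and vanishes for p far out on that side. -/
theorem cauchy_integral_of_isOnSide (hc : IsShiftedContour s R c) {ε : ℝ} (hε : ε ≠ 0) {p : ℂ}
    (hp : IsOnSide ε c p) {T : ℝ} (hT : 0 ≤ T) (hRT : R ≤ T) (h1 : p.im < s.im + T)
    (h2 : s.im - T < p.im) :
    ∫ t in (-T)..T, (c t - p)⁻¹ * deriv c t =
      Complex.log (ε * (c T - p)) - Complex.log (ε * (c (-T) - p)) := by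
  obtain ⟨B, hB⟩ := hc.exists_abs_re_le
  obtain ⟨z, hz, hj⟩ := hp (|ε| * B)
  set γ := hj.somePath with hγ
  have hγm : ∀ u, γ u ∉ range c := fun u => hj.somePath_mem u
  obtain ⟨K, hK⟩ : ∃ K, ∀ u ∈ (univ : Set unitInterval), ‖γ u‖ ≤ K :=
    isCompact_univ.exists_bound_of_continuousOn γ.continuous.continuousOn
  -- The enlarged end points lie above and below the whole path, so their logarithms vary
  -- continuously along it.
  set T' := max T (|s.im| + |K| + 1) with hT'
  have hTT' : T ≤ T' := le_max_left _ _
  have hT'2 : |s.im| + |K| + 1 ≤ T' := le_max_right _ _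
  have hT'0 : 0 ≤ T' := hT.trans hTT'
  have imT : ∀ t, R ≤ t → 0 ≤ t → (c t).im = s.im + t :=
    fun t ht h0 => hc.im_eq (by rwa [abs_of_nonneg h0])
  have imT' : ∀ t, R ≤ t → 0 ≤ t → (c (-t)).im = s.im - t := fun t ht h0 => by
    rw [hc.im_eq (by rwa [abs_neg, abs_of_nonneg h0])]; ring
  have hγim : ∀ u, |(γ u).im| ≤ |K| := fun u =>
    (Complex.abs_im_le_norm _).trans ((hK u trivial).trans (le_abs_self K))
  set D : ℂ → ℂ := fun w => (∫ t in (-T')..T', (c t - w)⁻¹ * deriv c t) -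
    (Complex.log (ε * (c T' - w)) - Complex.log (ε * (c (-T') - w))) with hD
  have hε' : (ε : ℂ) ≠ 0 := by exact_mod_cast hε
  have hlc : IsLocallyConstant fun u => D (γ u) := by
    rw [IsLocallyConstant.iff_eventually_eq]
    intro u
    have h := γ.continuous.continuousAt.eventually (hc.eventually_cauchy_sub_eq hT'0 (hγm u))
    filter_upwards [h] with v hv
    have e1 : ∀ w : ℂ, (c T' - w) / (c T' - γ u) = (ε * (c T' - w)) / (ε * (c T' - γ u)) :=
      fun w => (mul_div_mul_left _ _ hε').symm
    have e2 : ∀ w : ℂ, (c (-T') - w) / (c (-T') - γ u) =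
      (ε * (c (-T') - w)) / (ε * (c (-T') - γ u)) := fun w => (mul_div_mul_left _ _ hε').symm
    have iu := abs_le.1 (hγim u)
    have iv := abs_le.1 (hγim v)
    have is := neg_abs_le s.im
    have is' := le_abs_self s.im
    rw [e1, e2, Complex.log_div_of_im_mul_pos, Complex.log_div_of_im_mul_pos] at hv
    · simp only [hD]
      linear_combination hv
    · rw [Complex.im_ofReal_mul, Complex.im_ofReal_mul, mul_mul_mul_comm, Complex.sub_im,
        Complex.sub_im, imT' T' (hRT.trans hTT') hT'0]
      refine mul_pos (mul_self_pos.2 hε) (mul_pos_of_neg_of_neg ?_ ?_) <;> linarith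
    · rw [Complex.im_ofReal_mul, Complex.im_ofReal_mul, mul_mul_mul_comm, Complex.sub_im,
        Complex.sub_im, imT T' (hRT.trans hTT') hT'0]
      refine mul_pos (mul_self_pos.2 hε) (mul_pos ?_ ?_) <;> linarith
  have hDp : D p = D z := by
    have := hlc.apply_eq_of_preconnectedSpace 0 1
    simpa using this
  have hDz : D z = 0 := by
    simp only [hD]
    rw [sub_eq_zero]
    have hre : ∀ t, 0 < ((ε : ℂ) * (c t - z)).re := by
      intro t
      rw [Complex.re_ofReal_mul, Complex.sub_re, mul_sub]
      have : -(|ε| * B) ≤ ε * (c t).re := by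
        refine le_trans ?_ (neg_abs_le _)
        rw [abs_mul]
        exact neg_le_neg (mul_le_mul_of_nonneg_left (hB t) (abs_nonneg _))
      linarith
    refine hc.integral_eq_sub (f := fun w => (w - z)⁻¹)
      (H := fun w => Complex.log (ε * (w - z))) (fun t ht => ?_) (fun t ht => ?_)
    · exact hasDerivAt_log_mul_sub hε (Or.inl (hre t))
    · refine continuousAt_sub_inv fun h => ?_
      have := hre t
      rw [h] at this
      simp at this
  have hJ' : (∫ t in (-T')..T', (c t - p)⁻¹ * deriv c t) =
      Complex.log (ε * (c T' - p)) - Complex.log (ε * (c (-T') - p)) := by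
    rw [← sub_eq_zero]
    rw [hDz] at hDp
    exact hDp
  have hint : ∀ a b, IntervalIntegrable (fun t => (c t - p)⁻¹ * deriv c t) volume a b := by
    intro a b
    exact hc.intervalIntegrable (f := fun w => (w - p)⁻¹) fun t _ =>
      continuousAt_sub_inv fun h => hp.notMem_range ⟨t, h⟩
  -- Return from T' to T: on the removed pieces the curve is above or below p and the logarithm is
  -- an honest primitive.
  rw [← intervalIntegral.integral_add_adjacent_intervals (hint (-T') T) (hint T T'),
    ← intervalIntegral.integral_add_adjacent_intervals (hint (-T') (-T)) (hint (-T) T),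
    hc.cauchy_integral_of_im_ne hε (a := T) (b := T'),
    hc.cauchy_integral_of_im_ne hε (a := -T') (b := -T)] at hJ'
  · linear_combination hJ'
  · intro t ht
    rw [uIcc_of_le (by linarith)] at ht
    have ht1 : T ≤ -t := by linarith [ht.2]
    have := imT' (-t) (hRT.trans ht1) (hT.trans ht1)
    rw [neg_neg] at this
    rw [this]
    linarith
  · intro t ht
    rw [uIcc_of_le hTT'] at ht
    rw [imT t (hRT.trans ht.1) (hT.trans ht.1)]
    linarith [ht.1]

end IsShiftedContour

/-! ### Residues and primitives on a disc. -/

/-- Splits off the polar terms by lowering the pole order with `dslope`; every power of 1/(z-p)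
except the first has a single-valued primitive Q. -/
theorem exists_principalPart {p : ℂ} (n : ℕ) : ∀ {F g : ℂ → ℂ}, AnalyticAt ℂ g p →
    (∀ᶠ z in 𝓝[≠] p, F z = g z / (z - p) ^ n) →
    ∃ (a : ℂ) (Q q h : ℂ → ℂ), (∀ z ≠ p, HasDerivAt Q (q z) z) ∧ (∀ z ≠ p, DifferentiableAt ℂ q z) ∧
      AnalyticAt ℂ h p ∧ ∀ᶠ z in 𝓝[≠] p, F z = q z + a / (z - p) + h z := by
  induction n with
  | zero =>
    intro F g hg hF
    refine ⟨0, 0, 0, g, fun z _ => hasDerivAt_const z (0 : ℂ),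
      fun z _ => differentiableAt_const 0, hg, ?_⟩
    filter_upwards [hF] with z hz
    simp [hz]
  | succ n ih =>
    intro F g hg hF
    have hg' : AnalyticAt ℂ (dslope g p) p := by
      obtain ⟨s, hs, hd⟩ := Complex.analyticAt_iff_eventually_differentiableAt.1 hg |>.exists_mem
      have : DifferentiableOn ℂ (dslope g p) s := (Complex.differentiableOn_dslope hs).2
        fun z hz => (hd z hz).differentiableWithinAt
      exact this.analyticAt hs
    obtain ⟨a, Q, q, h, hQ, hq, hh, he⟩ := ih (F := fun z => dslope g p z / (z - p) ^ n) hg'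
      (Eventually.of_forall fun z => rfl)
    have hFe : ∀ᶠ z in 𝓝[≠] p, F z = g p / (z - p) ^ (n + 1) + dslope g p z / (z - p) ^ n := by
      filter_upwards [hF, self_mem_nhdsWithin] with z hz hzp
      have hzp' : z - p ≠ 0 := sub_ne_zero.2 hzp
      rw [hz, dslope_of_ne _ hzp, slope_def_field]
      field_simp
      ring
    -- In the last reduction the split term is g(p)/(z-p), which goes into the residue instead of
    -- the primitive.
    rcases n with _ | n
    · refine ⟨a + g p, Q, q, h, hQ, hq, hh, ?_⟩
      filter_upwards [he, hFe] with z h1 h2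
      rw [h2, h1]
      ring
    · refine ⟨a, fun z => Q z + g p * (-(1 / (n + 1 : ℂ)) * ((z - p) ^ (n + 1))⁻¹),
        fun z => q z + g p / (z - p) ^ (n + 1 + 1), h, fun z hz => ?_, fun z hz => ?_, hh, ?_⟩
      · have hzp : z - p ≠ 0 := sub_ne_zero.2 hz
        have hn : (n + 1 : ℂ) ≠ 0 := by exact_mod_cast Nat.succ_ne_zero n
        have h1 := ((((hasDerivAt_id z).sub_const p).pow (n + 1)).inv (pow_ne_zero _ hzp)).const_mul
          (-(1 / (n + 1 : ℂ))) |>.const_mul (g p)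
        refine ((hQ z hz).add h1).congr_deriv ?_
        simp only [id, Nat.add_sub_cancel, Pi.pow_apply]
        push_cast
        field_simp
        ring
      · exact (hq z hz).add (DifferentiableAt.div (by fun_prop) (by fun_prop)
          (pow_ne_zero _ (sub_ne_zero.2 hz)))
      · filter_upwards [he, hFe] with z h1 h2
        rw [h2, h1]
        ring

/-- Poles are removed one at a time: subtracting the principal part at p leaves a removable
singularity. With no poles left, a holomorphic function on a disc has a primitive. -/
theorem exists_primitive_add_residues {r : ℝ} (Z : Finset ℂ) : ∀ {F : ℂ → ℂ},
    DifferentiableOn ℂ F (Metric.ball 0 r \ Z) → (∀ p ∈ Z, MeromorphicAt F p) →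
    ∃ (H a : ℂ → ℂ), (∀ p ∉ Z, a p = 0) ∧ ∀ z ∈ Metric.ball (0 : ℂ) r \ Z,
      HasDerivAt H (F z - ∑ p ∈ Z, a p * (z - p)⁻¹) z := by
  classical
  induction Z using Finset.induction_on with
  | empty =>
    intro F hF _
    have hF' : DifferentiableOn ℂ F (Metric.ball 0 r) := by simpa using hF
    obtain ⟨H, hH⟩ := hF'.isExactOn_ball
    exact ⟨H, 0, fun _ _ => rfl, fun z hz => by simpa using hH z hz.1⟩
  | insert p Z hp ih =>
    intro F hF hm
    have hopen : ∀ W : Finset ℂ, IsOpen (Metric.ball (0 : ℂ) r \ W) :=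
      fun W => Metric.isOpen_ball.sdiff W.finite_toSet.isClosed
    have hFd : ∀ z ∈ Metric.ball (0 : ℂ) r \ (insert p Z : Finset ℂ), DifferentiableAt ℂ F z :=
      fun z hz => hF.differentiableAt ((hopen _).mem_nhds hz)
    obtain ⟨n, hn⟩ := hm p (Finset.mem_insert_self p Z)
    obtain ⟨a, Q, q, h, hQ, hq, hh, he⟩ := exists_principalPart n (F := F) hn (by
      filter_upwards [self_mem_nhdsWithin] with z hz
      have : z - p ≠ 0 := sub_ne_zero.2 hz
      rw [smul_eq_mul]
      field_simp)
    -- The value at p is set to that of the regular part, which makes G holomorphic there.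
    set G : ℂ → ℂ := Function.update (fun z => F z - (q z + a * (z - p)⁻¹)) p (h p) with hG
    have hGne : ∀ z ≠ p, G =ᶠ[𝓝 z] fun z => F z - (q z + a * (z - p)⁻¹) := by
      intro z hz
      filter_upwards [isOpen_ne.mem_nhds hz] with w hw
      rw [hG, Function.update_of_ne hw]
    have hGp : G =ᶠ[𝓝 p] h := by
      have : ∀ᶠ z in 𝓝[≠] p, G z = h z := by
        filter_upwards [he, self_mem_nhdsWithin] with z hz hzp
        rw [hG, Function.update_of_ne hzp, hz]
        ring
      rw [eventually_nhdsWithin_iff] at this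
      filter_upwards [this] with z hz
      by_cases hzp : z = p
      · rw [hzp, hG, Function.update_self]
      · exact hz hzp
    have hinv : ∀ z ≠ p, DifferentiableAt ℂ (fun z => a * (z - p)⁻¹) z := by
      intro z hz
      have := sub_ne_zero.2 hz
      fun_prop (disch := assumption)
    have hsub : ∀ z ≠ p, z ∈ Metric.ball (0 : ℂ) r \ Z →
        z ∈ Metric.ball (0 : ℂ) r \ (insert p Z : Finset ℂ) := by
      intro z hz hz'
      refine ⟨hz'.1, ?_⟩
      rw [Finset.coe_insert, mem_insert_iff]
      rintro (h | h)
      · exact hz h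
      · exact hz'.2 h
    obtain ⟨H, b, hb, hH⟩ := ih (F := G) (fun z hz => by
        refine DifferentiableAt.differentiableWithinAt ?_
        by_cases hzp : z = p
        · rw [hzp, hGp.differentiableAt_iff]
          exact hh.differentiableAt
        · rw [(hGne z hzp).differentiableAt_iff]
          exact (hFd z (hsub z hzp hz)).sub ((hq z hzp).add (hinv z hzp)))
      (fun w hw => by
        have hwp : w ≠ p := fun h => hp (h ▸ hw)
        refine MeromorphicAt.congr ?_ ((hGne w hwp).symm.filter_mono nhdsWithin_le_nhds)
        refine (hm w (Finset.mem_insert_of_mem hw)).fun_sub (AnalyticAt.meromorphicAt ?_)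
        rw [Complex.analyticAt_iff_eventually_differentiableAt]
        filter_upwards [isOpen_ne.mem_nhds hwp] with u hu
        exact (hq u hu).add (hinv u hu))
    refine ⟨fun z => H z + Q z, Function.update b p a, fun w hw => ?_, fun z hz => ?_⟩
    · rw [Finset.mem_insert, not_or] at hw
      rw [Function.update_of_ne hw.1]
      exact hb w hw.2
    · have hzp : z ≠ p := fun h => hz.2 (by rw [h]; simp)
      have hzZ : z ∉ (Z : Set ℂ) := fun h => hz.2 (by rw [Finset.coe_insert]; exact mem_insert_of_mem _ h)
      refine ((hH z ⟨hz.1, hzZ⟩).add (hQ z hzp)).congr_deriv ?_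
      have hs : ∑ w ∈ Z, Function.update b p a w * (z - w)⁻¹ = ∑ w ∈ Z, b w * (z - w)⁻¹ := by
        refine Finset.sum_congr rfl fun w hw => ?_
        have hwp : w ≠ p := fun h => hp (h ▸ hw)
        rw [Function.update_of_ne hwp]
      rw [Finset.sum_insert hp, Function.update_self, hG, Function.update_of_ne hzp, hs]
      ring

/-- Integrating over a small circle around w gives 2πi b(w), while the existence of a primitive
forces 0. -/
theorem residues_eq_zero {r : ℝ} {Z : Finset ℂ} {K b : ℂ → ℂ}
    (hK : ∀ z ∈ Metric.ball (0 : ℂ) r \ Z, HasDerivAt K (∑ p ∈ Z, b p * (z - p)⁻¹) z)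
    {w : ℂ} (hw : w ∈ Z) (hwr : w ∈ Metric.ball (0 : ℂ) r) : b w = 0 := by
  classical
  have hopen : IsOpen (Metric.ball (0 : ℂ) r \ (Z.erase w : Finset ℂ)) :=
    Metric.isOpen_ball.sdiff (Z.erase w).finite_toSet.isClosed
  obtain ⟨δ, hδ, hδs⟩ := Metric.isOpen_iff.1 hopen w ⟨hwr, by simp⟩
  have hδ2 : 0 < δ / 2 := by positivity
  have hcb : Metric.closedBall w (δ / 2) ⊆ Metric.ball (0 : ℂ) r \ (Z.erase w : Finset ℂ) :=
    (Metric.closedBall_subset_ball (by linarith)).trans hδs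
  have h1 : (∮ z in C(w, δ / 2), ∑ p ∈ Z, b p * (z - p)⁻¹) = 0 := by
    refine circleIntegral.integral_eq_zero_of_hasDerivWithinAt (f := K) hδ2.le fun z hz => ?_
    have hz1 := hcb (Metric.sphere_subset_closedBall hz)
    have hzw : z ≠ w := by
      rintro rfl
      rw [Metric.mem_sphere, dist_self] at hz
      linarith
    refine (hK z ⟨hz1.1, fun h => hz1.2 ?_⟩).hasDerivWithinAt
    rw [Finset.mem_coe] at h ⊢
    exact Finset.mem_erase.2 ⟨hzw, h⟩
  have hdiff : ∀ z ∈ Metric.closedBall w (δ / 2),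
      DifferentiableAt ℂ (fun z => ∑ p ∈ Z.erase w, b p * (z - p)⁻¹) z := by
    intro z hz
    refine DifferentiableAt.fun_sum fun p hp => ?_
    refine (DifferentiableAt.inv (by fun_prop) (sub_ne_zero.2 ?_)).const_mul _
    rintro rfl
    exact (hcb hz).2 hp
  have h2 : (∮ z in C(w, δ / 2), ∑ p ∈ Z.erase w, b p * (z - p)⁻¹) = 0 := by
    refine Complex.circleIntegral_eq_zero_of_differentiable_on_off_countable hδ2.le
      (countable_empty) (fun z hz => (hdiff z hz).continuousAt.continuousWithinAt)
      (fun z hz => hdiff z (Metric.ball_subset_closedBall hz.1))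
  have h3 : (∮ z in C(w, δ / 2), b w * (z - w)⁻¹) = b w * (2 * Real.pi * Complex.I) := by
    rw [circleIntegral.integral_const_mul, circleIntegral.integral_sub_center_inv _ hδ2.ne']
  have hi1 : CircleIntegrable (fun z => b w * (z - w)⁻¹) w (δ / 2) := by
    refine ContinuousOn.circleIntegrable hδ2.le fun z hz => ?_
    refine (continuousAt_const.mul (continuousAt_sub_inv ?_)).continuousWithinAt
    rintro rfl
    rw [Metric.mem_sphere, dist_self] at hz
    linarith
  have hi2 : CircleIntegrable (fun z => ∑ p ∈ Z.erase w, b p * (z - p)⁻¹) w (δ / 2) :=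
    ContinuousOn.circleIntegrable hδ2.le fun z hz =>
      (hdiff z (Metric.sphere_subset_closedBall hz)).continuousAt.continuousWithinAt
  have h4 : (fun z => ∑ p ∈ Z, b p * (z - p)⁻¹) =
      fun z => b w * (z - w)⁻¹ + ∑ p ∈ Z.erase w, b p * (z - p)⁻¹ := by
    ext z
    rw [Finset.add_sum_erase Z (fun p => b p * (z - p)⁻¹) hw]
  rw [h4, circleIntegral.integral_add hi1 hi2, h2, h3, add_zero] at h1
  exact (mul_eq_zero.1 h1).resolve_right Complex.two_pi_I_ne_zero

theorem norm_sub_le_of_hasDerivAt_segment {K k : ℂ → ℂ} {B : ℝ} {z w : ℂ}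
    (hK : ∀ u ∈ segment ℝ z w, HasDerivAt K (k u) u) (hB : ∀ u ∈ segment ℝ z w, ‖k u‖ ≤ B) :
    ‖K w - K z‖ ≤ B * ‖w - z‖ :=
  Convex.norm_image_sub_le_of_norm_hasDerivWithin_le
    (fun u hu => (hK u hu).hasDerivWithinAt) hB (convex_segment z w) (left_mem_segment ℝ z w)
    (right_mem_segment ℝ z w)

theorem segment_im_le {z w u : ℂ} (hu : u ∈ segment ℝ z w) {a : ℝ} (hz : z.im ≤ a) (hw : w.im ≤ a) :
    u.im ≤ a := (convex_halfSpace_im_le a).segment_subset hz hw hu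

theorem segment_le_im {z w u : ℂ} (hu : u ∈ segment ℝ z w) {a : ℝ} (hz : a ≤ z.im) (hw : a ≤ w.im) :
    a ≤ u.im := (convex_halfSpace_im_ge a).segment_subset hz hw hu

theorem segment_abs_re_le {z w u : ℂ} (hu : u ∈ segment ℝ z w) {a : ℝ} (hz : |z.re| ≤ a)
    (hw : |w.re| ≤ a) : |u.re| ≤ a :=
  abs_le.2 ⟨(convex_halfSpace_re_ge (-a)).segment_subset (abs_le.1 hz).1 (abs_le.1 hw).1 hu,
    (convex_halfSpace_re_le a).segment_subset (abs_le.1 hz).2 (abs_le.1 hw).2 hu⟩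

/-- A three-segment path joins the two points; its vertical part is placed at an abscissa that no
exceptional point has. -/
theorem eq_of_hasDerivAt_zero_vertical {r Y T : ℝ} {Z : Finset ℂ} {K : ℂ → ℂ}
    (hK : ∀ z ∈ Metric.ball (0 : ℂ) r \ Z, HasDerivAt K 0 z) (hZ : ∀ p ∈ Z, |p.im| ≤ Y)
    (hYT : Y < T) (hTr : T + 1 < r) (hT : 0 ≤ T) : K (T * Complex.I) = K (-(T * Complex.I)) := by
  classical
  obtain ⟨x, hx, hxZ⟩ := (Ioo_infinite (zero_lt_one (α := ℝ))).exists_notMem_finset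
    (Z.image Complex.re)
  have hball : ∀ u : ℂ, |u.re| ≤ 1 → |u.im| ≤ T → u ∈ Metric.ball (0 : ℂ) r := by
    intro u h1 h2
    rw [mem_ball_zero_iff]
    exact (Complex.norm_le_abs_re_add_abs_im u).trans_lt (by linarith)
  have seg : ∀ z w : ℂ, (∀ u ∈ segment ℝ z w, u ∈ Metric.ball (0 : ℂ) r \ Z) → K w = K z := by
    intro z w h
    have := norm_sub_le_of_hasDerivAt_segment (K := K) (k := fun _ => 0) (B := 0) (z := z) (w := w)
      (fun u hu => hK u (h u hu)) (fun u _ => by simp)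
    rw [zero_mul, norm_le_zero_iff, sub_eq_zero] at this
    exact this
  set z₁ : ℂ := T * Complex.I
  set z₂ : ℂ := x + T * Complex.I
  set z₃ : ℂ := x - T * Complex.I
  set z₄ : ℂ := -(T * Complex.I)
  have r1 : z₁.re = 0 := by simp [z₁]
  have r2 : z₂.re = x := by simp [z₂]
  have r3 : z₃.re = x := by simp [z₃]
  have r4 : z₄.re = 0 := by simp [z₄]
  have i1 : z₁.im = T := by simp [z₁]
  have i2 : z₂.im = T := by simp [z₂]
  have i3 : z₃.im = -T := by simp [z₃]
  have i4 : z₄.im = -T := by simp [z₄]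
  have ax : |x| ≤ 1 := abs_le.2 ⟨by linarith [hx.1], hx.2.le⟩
  have s12 : K z₂ = K z₁ := by
    refine seg _ _ fun u hu => ⟨hball u ?_ ?_, fun h => ?_⟩
    · exact segment_abs_re_le hu (by rw [r1]; simp) (by rw [r2]; exact ax)
    · exact abs_le.2 ⟨segment_le_im hu (by rw [i1]; linarith) (by rw [i2]; linarith),
        segment_im_le hu i1.le i2.le⟩
    · have := segment_le_im hu i1.ge i2.ge
      linarith [(abs_le.1 (hZ u h)).2]
  have s34 : K z₄ = K z₃ := by
    refine seg _ _ fun u hu => ⟨hball u ?_ ?_, fun h => ?_⟩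
    · exact segment_abs_re_le hu (by rw [r3]; exact ax) (by rw [r4]; simp)
    · exact abs_le.2 ⟨segment_le_im hu i3.ge i4.ge,
        segment_im_le hu (by rw [i3]; linarith) (by rw [i4]; linarith)⟩
    · have := segment_im_le hu i3.le i4.le
      linarith [(abs_le.1 (hZ u h)).1]
  have s23 : K z₃ = K z₂ := by
    refine seg _ _ fun u hu => ⟨hball u ?_ ?_, fun h => hxZ ?_⟩
    · exact segment_abs_re_le hu (by rw [r2]; exact ax) (by rw [r3]; exact ax)
    · exact abs_le.2 ⟨segment_le_im hu (by rw [i2]; linarith) i3.ge,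
        segment_im_le hu i2.le (by rw [i3]; linarith)⟩
    · have h1 : u.re ≤ x := (convex_halfSpace_re_le x).segment_subset r2.le r3.le hu
      have h2 : x ≤ u.re := (convex_halfSpace_re_ge x).segment_subset r2.ge r3.ge hu
      rw [Finset.mem_image]
      exact ⟨u, h, le_antisymm h1 h2⟩
  rw [s34, s23, s12]

theorem IsShiftedContour.integral_eq_sub_of_residues {s : ℂ} {R : ℝ} {c : ℝ → ℂ}
    (hc : IsShiftedContour s R c) {F H a : ℂ → ℂ} {ε : ℂ → ℝ} {Z : Finset ℂ} {r Y T : ℝ}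
    (hF : ∀ t, ContinuousAt F (c t))
    (hH : ∀ z ∈ Metric.ball (0 : ℂ) r \ Z, HasDerivAt H (F z - ∑ p ∈ Z, a p * (z - p)⁻¹) z)
    (hε : ∀ p, ε p ≠ 0) (hZ : ∀ p ∈ Z, IsOnSide (ε p) c p) (hY : ∀ p ∈ Z, |p.im| ≤ Y)
    (hT : 0 ≤ T) (hRT : R ≤ T) (hYT : Y + |s.im| < T)
    (hr : ∀ t ∈ Icc (-T) T, c t ∈ Metric.ball (0 : ℂ) r) :
    ∫ t in (-T)..T, F (c t) * deriv c t =
      (H (c T) + ∑ p ∈ Z, a p * Complex.log (ε p * (c T - p))) -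
        (H (c (-T)) + ∑ p ∈ Z, a p * Complex.log (ε p * (c (-T) - p))) := by
  have hne : ∀ p ∈ Z, ∀ t, c t ≠ p := fun p hp t h => (hZ p hp).notMem_range ⟨t, h⟩
  have hTT : -T ≤ T := by linarith
  have hcs : ∀ p ∈ Z, ∀ t, ContinuousAt (fun z => a p * (z - p)⁻¹) (c t) := fun p hp t =>
    continuousAt_const.mul (continuousAt_sub_inv (hne p hp t))
  have hcS : ∀ t, ContinuousAt (fun z => ∑ p ∈ Z, a p * (z - p)⁻¹) (c t) := fun t =>
    tendsto_finsetSum _ fun p hp => hcs p hp t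
  have h1 : ∫ t in (-T)..T, (F (c t) - ∑ p ∈ Z, a p * (c t - p)⁻¹) * deriv c t =
      H (c T) - H (c (-T)) := by
    refine hc.integral_eq_sub (f := fun z => F z - ∑ p ∈ Z, a p * (z - p)⁻¹) (fun t ht => ?_)
      (fun t _ => (hF t).sub (hcS t))
    rw [uIcc_of_le hTT] at ht
    exact hH _ ⟨hr t ht, fun h => hne _ h t rfl⟩
  have h2 : ∫ t in (-T)..T, (∑ p ∈ Z, a p * (c t - p)⁻¹) * deriv c t =
      ∑ p ∈ Z, a p * (Complex.log (ε p * (c T - p)) - Complex.log (ε p * (c (-T) - p))) := by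
    simp only [Finset.sum_mul]
    rw [intervalIntegral.integral_finsetSum]
    · refine Finset.sum_congr rfl fun p hp => ?_
      have hp1 := abs_le.1 (hY p hp)
      have hs1 := neg_abs_le s.im
      have hs2 := le_abs_self s.im
      rw [← hc.cauchy_integral_of_isOnSide (hε p) (hZ p hp) hT hRT (by linarith) (by linarith),
        ← intervalIntegral.integral_const_mul]
      simp only [mul_assoc]
    · exact fun p hp => hc.intervalIntegrable (f := fun z => a p * (z - p)⁻¹) fun t _ => hcs p hp t
  have h3 : ∫ t in (-T)..T, F (c t) * deriv c t =
      (∫ t in (-T)..T, (F (c t) - ∑ p ∈ Z, a p * (c t - p)⁻¹) * deriv c t) +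
      ∫ t in (-T)..T, (∑ p ∈ Z, a p * (c t - p)⁻¹) * deriv c t := by
    rw [← intervalIntegral.integral_add]
    · congr 1
      ext t
      ring
    · exact hc.intervalIntegrable (f := fun z => F z - ∑ p ∈ Z, a p * (z - p)⁻¹) fun t _ =>
        (hF t).sub (hcS t)
    · exact hc.intervalIntegrable (f := fun z => ∑ p ∈ Z, a p * (z - p)⁻¹) fun t _ => hcS t
  rw [h3, h1, h2]
  simp only [mul_sub, Finset.sum_sub_distrib]
  ring

/-! ### Transfer of linear relations to contour integrals. -/

/-- The sign ε(p) depends on the pole only, not on the contour. Hence the logarithms at p enter with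
the total coefficient b(p) = ∑ kᵢ aᵢ(p), which vanishes. What remains compares end points sᵢ ± iT
with ±iT and is controlled by the size of Fᵢ there. -/
theorem norm_sum_contourIntegral_le {ι : Type*} [Fintype ι] {F : ι → ℂ → ℂ} {c : ι → ℝ → ℂ}
    {s k : ι → ℂ} {R B : ι → ℝ} {P : ι → Set ℂ} {E : Set ℂ} {ε : ℂ → ℝ} {Y T : ℝ}
    (hc : ∀ i, IsShiftedContour (s i) (R i) (c i))
    (hdiff : ∀ i, ∀ z ∉ P i, DifferentiableAt ℂ (F i) z) (hmer : ∀ i z, MeromorphicAt (F i) z)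
    (hε : ∀ p, ε p ≠ 0) (hside : ∀ i, ∀ p ∈ P i, IsOnSide (ε p) (c i) p) (hPE : ∀ i, P i ⊆ E)
    (hE : ∀ r, (E ∩ Metric.ball 0 r).Finite) (hEY : ∀ p ∈ E, |p.im| ≤ Y)
    (hsum : ∀ z ∉ E, ∑ i, k i * F i z = 0) (hT : 0 ≤ T) (hRT : ∀ i, R i ≤ T)
    (hYT : Y < T) (hsT : ∀ i, Y + |(s i).im| < T)
    (hB : ∀ i z, |z.re| ≤ |(s i).re| → T - |(s i).im| ≤ |z.im| → ‖F i z‖ ≤ B i) :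
    ‖∑ i, k i * ∫ t in (-T)..T, F i (c i t) * deriv (c i) t‖ ≤
      ∑ i, ‖k i‖ * (2 * B i * ‖s i‖) := by
  classical
  choose C hC using fun i => (hc i).exists_norm_le T
  set r : ℝ := ∑ i, |C i| + ∑ i, ‖s i‖ + T + 2 with hr
  have hCr : ∀ i, |C i| + ‖s i‖ + T + 1 < r := by
    intro i
    have h1 : |C i| ≤ ∑ i, |C i| :=
      Finset.single_le_sum (f := fun i => |C i|) (fun j _ => abs_nonneg _) (Finset.mem_univ i)
    have h2 : ‖s i‖ ≤ ∑ i, ‖s i‖ :=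
      Finset.single_le_sum (f := fun i => ‖s i‖) (fun j _ => norm_nonneg _) (Finset.mem_univ i)
    rw [hr]
    linarith
  have hTr : T + 1 < r := by
    have h1 : 0 ≤ ∑ i, |C i| := Finset.sum_nonneg fun i _ => abs_nonneg _
    have h2 : 0 ≤ ∑ i, ‖s i‖ := Finset.sum_nonneg fun i _ => norm_nonneg _
    rw [hr]
    linarith
  set Z : Finset ℂ := (hE r).toFinset with hZ
  have hZmem : ∀ p, p ∈ Z ↔ p ∈ E ∧ p ∈ Metric.ball (0 : ℂ) r := fun p => by simp [hZ]
  set Zi : ι → Finset ℂ := fun i => Z.filter (· ∈ P i) with hZi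
  have hZimem : ∀ i p, p ∈ Zi i ↔ p ∈ P i ∧ p ∈ Metric.ball (0 : ℂ) r := by
    intro i p
    rw [hZi, Finset.mem_filter, hZmem]
    exact ⟨fun h => ⟨h.2, h.1.2⟩, fun h => ⟨⟨hPE i h.1, h.2⟩, h.1⟩⟩
  have hdec : ∀ i, ∃ (H a : ℂ → ℂ), (∀ p ∉ Zi i, a p = 0) ∧
      ∀ z ∈ Metric.ball (0 : ℂ) r \ (Zi i : Set ℂ),
        HasDerivAt H (F i z - ∑ p ∈ Zi i, a p * (z - p)⁻¹) z := by
    intro i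
    refine exists_primitive_add_residues (Zi i) (fun z hz => ?_) fun p _ => hmer i p
    refine (hdiff i z fun h => hz.2 ?_).differentiableWithinAt
    exact (hZimem i z).2 ⟨h, hz.1⟩
  choose H a ha hH using hdec
  have hZiZ : ∀ i, Zi i ⊆ Z := fun i => Finset.filter_subset _ _
  have hZsum : ∀ i (f : ℂ → ℂ), ∑ p ∈ Zi i, a i p * f p = ∑ p ∈ Z, a i p * f p := fun i f =>
    Finset.sum_subset (hZiZ i) fun p _ hp => by rw [ha i p hp, zero_mul]
  -- A primitive of Fᵢ beyond the horizontal band containing the poles; inside the band the cuts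
  -- interfere.
  set W : ι → ℂ → ℂ := fun i z => H i z + ∑ p ∈ Z, a i p * Complex.log (ε p * (z - p)) with hW
  have hint : ∀ i, ∫ t in (-T)..T, F i (c i t) * deriv (c i) t = W i (c i T) - W i (c i (-T)) := by
    intro i
    rw [(hc i).integral_eq_sub_of_residues (Z := Zi i) (a := a i) (r := r) (Y := Y)
      (fun t => (hdiff i _ fun h => (hside i _ h).notMem_range ⟨t, rfl⟩).continuousAt) (hH i) hε
      (fun p hp => hside i p ((hZimem i p).1 hp).1)
      (fun p hp => hEY p (hPE i ((hZimem i p).1 hp).1)) hT (hRT i) (hsT i) (fun t ht => ?_)]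
    · rw [hZsum i fun p => Complex.log (ε p * (c i T - p)),
        hZsum i fun p => Complex.log (ε p * (c i (-T) - p))]
    · rw [mem_ball_zero_iff]
      refine (hC i t ht).trans_lt ?_
      linarith [le_abs_self (C i), hCr i, norm_nonneg (s i)]
  set K : ℂ → ℂ := fun z => ∑ i, k i * H i z with hK
  set b : ℂ → ℂ := fun p => ∑ i, k i * a i p with hb
  have hKd : ∀ z ∈ Metric.ball (0 : ℂ) r \ (Z : Set ℂ),
      HasDerivAt K (∑ p ∈ Z, (-b p) * (z - p)⁻¹) z := by
    intro z hz
    have h1 : HasDerivAt K (∑ i, k i * (F i z - ∑ p ∈ Zi i, a i p * (z - p)⁻¹)) z := by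
      refine HasDerivAt.fun_sum fun i _ => ?_
      exact (hH i z ⟨hz.1, fun h => hz.2 (hZiZ i h)⟩).const_mul (k i)
    refine h1.congr_deriv ?_
    have hzE : z ∉ E := fun h => hz.2 ((hZmem z).2 ⟨h, hz.1⟩)
    simp only [mul_sub, Finset.sum_sub_distrib, hsum z hzE, hZsum]
    rw [zero_sub, ← Finset.sum_neg_distrib]
    simp only [Finset.mul_sum, hb, ← Finset.sum_neg_distrib, Finset.sum_mul]
    rw [Finset.sum_comm]
    refine Finset.sum_congr rfl fun p _ => Finset.sum_congr rfl fun i _ => ?_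
    ring
  -- As ∑ kᵢFᵢ = 0 off E, the function K is a primitive of -∑ b(p)/(z-p), so all b(p) vanish and K'
  -- = 0.
  have hb0 : ∀ p ∈ Z, b p = 0 := by
    intro p hp
    have := residues_eq_zero hKd hp ((hZmem p).1 hp).2
    exact neg_eq_zero.1 this
  have hKd0 : ∀ z ∈ Metric.ball (0 : ℂ) r \ (Z : Set ℂ), HasDerivAt K 0 z := by
    intro z hz
    refine (hKd z hz).congr_deriv ?_
    refine Finset.sum_eq_zero fun p hp => ?_
    rw [hb0 p hp, neg_zero, zero_mul]
  have hZY : ∀ p ∈ Z, |p.im| ≤ Y := fun p hp => hEY p ((hZmem p).1 hp).1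
  have hKT := eq_of_hasDerivAt_zero_vertical hKd0 hZY hYT hTr hT
  have hWK : ∀ z, ∑ i, k i * W i z = K z := by
    intro z
    simp only [hW, mul_add, Finset.sum_add_distrib, Finset.mul_sum]
    rw [Finset.sum_comm]
    have : ∑ p ∈ Z, ∑ i, k i * (a i p * Complex.log (ε p * (z - p))) = 0 := by
      refine Finset.sum_eq_zero fun p hp => ?_
      have h := hb0 p hp
      simp only [hb] at h
      simp only [← mul_assoc]
      rw [← Finset.sum_mul, h, zero_mul]
    rw [this, add_zero]
  have hWd : ∀ i z, z ∈ Metric.ball (0 : ℂ) r → Y < |z.im| → HasDerivAt (W i) (F i z) z := by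
    intro i z hz hzY
    have hne : ∀ p ∈ Z, z.im ≠ p.im := fun p hp h => by
      have := hZY p hp
      rw [← h] at this
      linarith
    have h1 := hH i z ⟨hz, fun h => hne z (hZiZ i h) rfl⟩
    have h2 : HasDerivAt (fun z => ∑ p ∈ Z, a i p * Complex.log (ε p * (z - p)))
        (∑ p ∈ Z, a i p * (z - p)⁻¹) z := by
      refine HasDerivAt.fun_sum fun p hp => ?_
      exact (hasDerivAt_log_mul_sub (hε p)
        (mul_sub_mem_slitPlane_of_im_ne (hε p) (hne p hp))).const_mul _
    refine (h1.add h2).congr_deriv ?_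
    rw [hZsum i fun p => (z - p)⁻¹]
    ring
  have hshift : ∀ i (τ : ℝ), |τ| = T → ‖W i (s i + τ * Complex.I) - W i (τ * Complex.I)‖ ≤
      B i * ‖s i‖ := by
    intro i τ hτ
    have hseg : ∀ u ∈ segment ℝ ((τ : ℂ) * Complex.I) (s i + τ * Complex.I),
        |u.re| ≤ |(s i).re| ∧ |u.im - τ| ≤ |(s i).im| := by
      intro u hu
      rw [segment_eq_image] at hu
      obtain ⟨θ, hθ, rfl⟩ := hu
      have hθ1 : |θ| ≤ 1 := abs_le.2 ⟨by linarith [hθ.1], hθ.2⟩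
      constructor
      · have : ((1 - θ) • ((τ : ℂ) * Complex.I) + θ • (s i + τ * Complex.I)).re = θ * (s i).re := by
          simp
        rw [this, abs_mul]
        exact mul_le_of_le_one_left (abs_nonneg _) hθ1
      · have : ((1 - θ) • ((τ : ℂ) * Complex.I) + θ • (s i + τ * Complex.I)).im - τ =
            θ * (s i).im := by
          simp
          ring
        rw [this, abs_mul]
        exact mul_le_of_le_one_left (abs_nonneg _) hθ1
    have him : ∀ u ∈ segment ℝ ((τ : ℂ) * Complex.I) (s i + τ * Complex.I),
        T - |(s i).im| ≤ |u.im| := by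
      intro u hu
      have h1 := (hseg u hu).2
      have h2 := abs_sub_abs_le_abs_sub τ u.im
      rw [abs_sub_comm τ] at h2
      linarith
    have := norm_sub_le_of_hasDerivAt_segment (K := W i) (k := F i) (B := B i)
      (z := (τ : ℂ) * Complex.I) (w := s i + τ * Complex.I) (fun u hu => hWd i u ?_ ?_)
      (fun u hu => hB i u (hseg u hu).1 (him u hu))
    · simpa using this
    · refine (convex_ball (0 : ℂ) r).segment_subset ?_ ?_ hu
      · rw [mem_ball_zero_iff]
        simp only [norm_mul, Complex.norm_real, Complex.norm_I, mul_one, Real.norm_eq_abs, hτ]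
        linarith
      · rw [mem_ball_zero_iff]
        refine (norm_add_le _ _).trans_lt ?_
        simp only [norm_mul, Complex.norm_real, Complex.norm_I, mul_one, Real.norm_eq_abs, hτ]
        linarith [hCr i, abs_nonneg (C i)]
    · linarith [him u hu, hsT i]
  have hneg : ((-T : ℝ) : ℂ) * Complex.I = -((T : ℂ) * Complex.I) := by push_cast; ring
  have hcT : ∀ i, c i T = s i + T * Complex.I := fun i =>
    (hc i).eq_axis T (by rw [abs_of_nonneg hT]; exact hRT i)
  have hcT' : ∀ i, c i (-T) = s i + ((-T : ℝ) : ℂ) * Complex.I := fun i =>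
    (hc i).eq_axis (-T) (by rw [abs_neg, abs_of_nonneg hT]; exact hRT i)
  -- Adding and subtracting Wᵢ(±iT) is free, because ∑ kᵢWᵢ = K takes the same value at iT and -iT.
  have key : ∑ i, k i * ∫ t in (-T)..T, F i (c i t) * deriv (c i) t =
      ∑ i, k i * ((W i (s i + T * Complex.I) - W i (T * Complex.I)) -
        (W i (s i + ((-T : ℝ) : ℂ) * Complex.I) - W i (((-T : ℝ) : ℂ) * Complex.I))) := by
    have h1 : ∀ i, k i * ((W i (s i + T * Complex.I) - W i (T * Complex.I)) -
        (W i (s i + ((-T : ℝ) : ℂ) * Complex.I) - W i (((-T : ℝ) : ℂ) * Complex.I))) =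
        k i * (W i (c i T) - W i (c i (-T))) - k i * W i (T * Complex.I) +
          k i * W i (((-T : ℝ) : ℂ) * Complex.I) := by
      intro i
      rw [hcT, hcT']
      ring
    simp only [h1, hint]
    rw [Finset.sum_add_distrib, Finset.sum_sub_distrib, hWK, hWK, hneg, hKT]
    ring
  rw [key]
  refine (norm_sum_le _ _).trans (Finset.sum_le_sum fun i _ => ?_)
  rw [norm_mul]
  refine mul_le_mul_of_nonneg_left ((norm_sub_le _ _).trans ?_) (norm_nonneg _)
  have h1 := hshift i T (abs_of_nonneg hT)
  have h2 := hshift i (-T) (by rw [abs_neg, abs_of_nonneg hT])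
  linarith

theorem integrable_exp_neg_mul_abs {ε : ℝ} (hε : 0 < ε) :
    Integrable fun t : ℝ => Real.exp (-ε * |t|) := by
  rw [← integrableOn_univ, ← Iic_union_Ioi (a := (0 : ℝ)), integrableOn_union]
  constructor
  · refine (integrableOn_exp_mul_Iic hε 0).congr_fun (fun t ht => ?_) measurableSet_Iic
    simp only [abs_of_nonpos (mem_Iic.1 ht), mul_neg, neg_mul, neg_neg]
  · refine (exp_neg_integrableOn_Ioi 0 hε).congr_fun (fun t ht => ?_) measurableSet_Ioi
    simp only [abs_of_pos (mem_Ioi.1 ht)]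

theorem IsShiftedContour.integrable {s : ℂ} {R : ℝ} {c : ℝ → ℂ} (hc : IsShiftedContour s R c)
    {F : ℂ → ℂ} (hF : ∀ t, ContinuousAt F (c t)) {C ε T₀ : ℝ} (hC : 0 ≤ C) (hε : 0 < ε)
    (hd : ∀ z : ℂ, |z.re| ≤ |s.re| → T₀ ≤ |z.im| → ‖F z‖ ≤ C * Real.exp (-ε * |z.im|)) :
    Integrable fun t => F (c t) * deriv c t := by
  obtain ⟨M, hM⟩ := hc.bounded
  have hcont : Continuous fun t => F (c t) :=
    continuous_iff_continuousAt.2 fun t => (hF t).comp hc.continuous.continuousAt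
  set T₁ := max R (T₀ + |s.im|) with hT₁
  obtain ⟨K, hK⟩ := isCompact_Icc.exists_bound_of_continuousOn (s := Icc (-T₁) T₁) hcont.continuousOn
  have hM0 : 0 ≤ M := (norm_nonneg _).trans (hM 0)
  have key : ∀ t, ‖F (c t)‖ ≤
      (|K| * Real.exp (ε * |T₁|) + C * Real.exp (ε * |s.im|)) * Real.exp (-ε * |t|) := by
    intro t
    rw [add_mul, mul_assoc, mul_assoc, ← Real.exp_add, ← Real.exp_add]
    rcases le_or_gt |t| T₁ with h | h
    · have h1 := (hK t (abs_le.1 h)).trans (le_abs_self K)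
      have h2 : 1 ≤ Real.exp (ε * |T₁| + -ε * |t|) := by
        apply Real.one_le_exp
        have := mul_le_mul_of_nonneg_left (h.trans (le_abs_self T₁)) hε.le
        linarith
      have h3 : 0 ≤ C * Real.exp (ε * |s.im| + -ε * |t|) := mul_nonneg hC (Real.exp_pos _).le
      have h4 := le_mul_of_one_le_right (abs_nonneg K) h2
      linarith
    · have hR : R ≤ |t| := (le_max_left _ _).trans h.le
      have hT : T₀ + |s.im| ≤ |t| := (le_max_right _ _).trans h.le
      have him : |t| - |s.im| ≤ |(c t).im| := by
        rw [hc.im_eq hR]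
        have := abs_sub_abs_le_abs_sub t (-s.im)
        rw [abs_neg, sub_neg_eq_add, add_comm t] at this
        exact this
      have h1 := hd (c t) (by rw [hc.eq_axis t hR]; simp) (by linarith)
      have h2 : C * Real.exp (-ε * |(c t).im|) ≤ C * Real.exp (ε * |s.im| + -ε * |t|) := by
        refine mul_le_mul_of_nonneg_left (Real.exp_le_exp.2 ?_) hC
        have := mul_le_mul_of_nonneg_left him hε.le
        linarith
      have h3 : 0 ≤ |K| * Real.exp (ε * |T₁| + -ε * |t|) := by positivity
      linarith
  refine Integrable.mono' ((integrable_exp_neg_mul_abs hε).const_mul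
    ((|K| * Real.exp (ε * |T₁|) + C * Real.exp (ε * |s.im|)) * M)) ?_ (Eventually.of_forall fun t => ?_)
  · exact (hcont.measurable.mul (measurable_deriv c)).aestronglyMeasurable
  · rw [norm_mul]
    calc ‖F (c t)‖ * ‖deriv c t‖ ≤
          (|K| * Real.exp (ε * |T₁|) + C * Real.exp (ε * |s.im|)) * Real.exp (-ε * |t|) * M :=
          mul_le_mul (key t) (hM t) (norm_nonneg _) ((norm_nonneg _).trans (key t))
      _ = _ := by ring

/-- Linear relations between meromorphic functions carry over to their integrals along contours that
separate the poles in a common way. -/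
theorem sum_contourIntegral_eq_zero {ι : Type*} [Fintype ι] {F : ι → ℂ → ℂ} {c : ι → ℝ → ℂ}
    {s k : ι → ℂ} {R : ι → ℝ} {P : ι → Set ℂ} {E : Set ℂ} {ε : ℂ → ℝ} {Y : ℝ}
    (hc : ∀ i, IsShiftedContour (s i) (R i) (c i))
    (hdiff : ∀ i, ∀ z ∉ P i, DifferentiableAt ℂ (F i) z) (hmer : ∀ i z, MeromorphicAt (F i) z)
    (hε : ∀ p, ε p ≠ 0) (hside : ∀ i, ∀ p ∈ P i, IsOnSide (ε p) (c i) p) (hPE : ∀ i, P i ⊆ E)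
    (hE : ∀ r, (E ∩ Metric.ball 0 r).Finite) (hEY : ∀ p ∈ E, |p.im| ≤ Y)
    (hsum : ∀ z ∉ E, ∑ i, k i * F i z = 0)
    (hdecay : ∀ i, ∃ C δ T₀ : ℝ, 0 ≤ C ∧ 0 < δ ∧ ∀ z : ℂ, |z.re| ≤ |(s i).re| → T₀ ≤ |z.im| →
      ‖F i z‖ ≤ C * Real.exp (-δ * |z.im|)) :
    (∀ i, Integrable fun t => F i (c i t) * deriv (c i) t) ∧
      ∑ i, k i * ∫ t, F i (c i t) * deriv (c i) t = 0 := by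
  choose C δ T₀ hC hδ hd using hdecay
  have hint : ∀ i, Integrable fun t => F i (c i t) * deriv (c i) t := fun i =>
    (hc i).integrable (fun t => (hdiff i _ fun h => (hside i _ h).notMem_range ⟨t, rfl⟩).continuousAt)
      (hC i) (hδ i) (hd i)
  refine ⟨hint, ?_⟩
  have hlim : Tendsto (fun T : ℝ => ∑ i, k i * ∫ t in (-T)..T, F i (c i t) * deriv (c i) t) atTop
      (𝓝 (∑ i, k i * ∫ t, F i (c i t) * deriv (c i) t)) :=
    tendsto_finsetSum _ fun i _ => (intervalIntegral_tendsto_integral (hint i)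
      tendsto_neg_atTop_atBot tendsto_id).const_mul (k i)
  -- The end corrections tend to 0 since the integrands decay exponentially near the horizontal
  -- connecting segments.
  have hbd : Tendsto (fun T : ℝ => ∑ i, ‖k i‖ * (2 * (C i * Real.exp (-δ i * (T - |(s i).im|))) *
      ‖s i‖)) atTop (𝓝 0) := by
    have : ∀ i, Tendsto (fun T : ℝ => ‖k i‖ * (2 * (C i * Real.exp (-δ i * (T - |(s i).im|))) *
      ‖s i‖)) atTop (𝓝 0) := by
      intro i
      have h1 : Tendsto (fun T : ℝ => -δ i * (T - |(s i).im|)) atTop atBot :=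
        (tendsto_atTop_add_const_right _ _ tendsto_id).const_mul_atTop_of_neg (neg_lt_zero.2 (hδ i))
      have h2 := ((((Real.tendsto_exp_atBot.comp h1).const_mul (C i)).const_mul 2).mul_const
        ‖s i‖).const_mul ‖k i‖
      simpa using h2
    simpa using tendsto_finsetSum Finset.univ fun i _ => this i
  have hev : ∀ᶠ T : ℝ in atTop, ‖∑ i, k i * ∫ t in (-T)..T, F i (c i t) * deriv (c i) t‖ ≤
      ∑ i, ‖k i‖ * (2 * (C i * Real.exp (-δ i * (T - |(s i).im|))) * ‖s i‖) := by
    filter_upwards [eventually_ge_atTop 0, eventually_gt_atTop Y,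
      eventually_all.2 fun i => eventually_ge_atTop (R i),
      eventually_all.2 fun i => eventually_gt_atTop (Y + |(s i).im|),
      eventually_all.2 fun i => eventually_ge_atTop (T₀ i + |(s i).im|)] with T h1 h2 h3 h4 h5
    refine norm_sum_contourIntegral_le hc hdiff hmer hε hside hPE hE hEY hsum h1 h3 h2 h4 ?_
    intro i z hz hi
    refine (hd i z hz (by linarith [h5 i])).trans ?_
    refine mul_le_mul_of_nonneg_left (Real.exp_le_exp.2 ?_) (hC i)
    have := mul_le_mul_of_nonneg_left hi (hδ i).le
    linarith
  have := squeeze_zero_norm' hev hbd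
  exact tendsto_nhds_unique hlim this

/-! ### Point reflection of contours. -/

section Contours

variable {c : ℝ → ℂ}

theorem IsVerticalContour.exists_isShiftedContour (hc : IsVerticalContour c) :
    ∃ R, IsShiftedContour 0 R c := by
  obtain ⟨S, hS, hd, -, M, hM⟩ := hc.piecewise
  obtain ⟨R, hR⟩ := hc.eq_axis
  exact ⟨R, hc.continuous, ⟨S, hS.countable, hd⟩, ⟨M, hM⟩, fun t ht => by rw [hR t ht, zero_add]⟩

theorem deriv_reflect_contour (u : ℂ) (c : ℝ → ℂ) (t : ℝ) :
    deriv (fun t => u - c (-t)) t = deriv c (-t) := by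
  rw [deriv_const_sub u (f := fun t => c (-t)), deriv_comp_neg, neg_neg]

theorem IsShiftedContour.reflect {R : ℝ} (hc : IsShiftedContour 0 R c) (u : ℂ) :
    IsShiftedContour u R fun t => u - c (-t) := by
  obtain ⟨S, hS, hd⟩ := hc.differentiable
  obtain ⟨M, hM⟩ := hc.bounded
  refine ⟨continuous_const.sub (hc.continuous.comp continuous_neg), ⟨(fun t => -t) '' S,
    hS.image _, fun t ht => ?_⟩, ⟨M, fun t => ?_⟩, fun t ht => ?_⟩
  · have h1 : DifferentiableAt ℝ c (-t) := hd _ fun h => ht ⟨-t, h, neg_neg t⟩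
    have h2 : DifferentiableAt ℝ (fun t : ℝ => c (-t)) t :=
      h1.comp t (f := fun t : ℝ => -t) (by fun_prop)
    exact h2.const_sub u
  · rw [deriv_reflect_contour]
    exact hM _
  · rw [hc.eq_axis (-t) (by rwa [abs_neg])]
    push_cast
    ring

theorem IsLeftOf.isOnSide {p : ℂ} (h : IsLeftOf c p) : IsOnSide 1 c p := by
  intro B
  obtain ⟨r, hr, hB⟩ := (h.and (eventually_gt_atTop B)).exists
  exact ⟨_, by simpa using hB, hr⟩

theorem IsRightOf.isOnSide {p : ℂ} (h : IsRightOf c p) : IsOnSide (-1) c p := by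
  intro B
  obtain ⟨r, hr, hB⟩ := (h.and (eventually_gt_atTop B)).exists
  exact ⟨_, by simpa using hB, hr⟩

/-- The map z ↦ u - z carries the joining path along and exchanges left and right; reversing the
parameter restores the upward orientation. -/
theorem IsOnSide.reflect {ε : ℝ} {u p : ℂ} (h : IsOnSide ε c (u - p)) :
    IsOnSide (-ε) (fun t => u - c (-t)) p := by
  intro B
  obtain ⟨z, hz, γ, hγ⟩ := h (B - ε * u.re)
  refine ⟨u - z, ?_, ((γ.map (f := fun w => u - w) (by fun_prop)).cast (by simp) rfl), fun v => ?_⟩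
  · rw [Complex.sub_re]
    linarith
  · rintro ⟨t, ht⟩
    refine hγ v ⟨-t, ?_⟩
    simpa using ht

end Contours

/-! ### Poles and reflection of the Barnes integrand. -/

section Barnes

variable {ω : ℝ}

/-- The set of possible poles of `barnesPhi`. -/
def barnesPoles (ω : ℝ) (α β γ : ℂ) : Set ℂ :=
  {z | z ∈ poleCone ω ∨ z + γ - 1 - 1 / ω ∈ poleCone ω ∨ -(z + α) ∈ poleCone ω ∨
    -(z + β) ∈ poleCone ω}

theorem differentiableAt_barnesPhi (hω : 0 < ω) {α β γ x z : ℂ} (hz : z ∉ barnesPoles ω α β γ) :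
    DifferentiableAt ℂ (barnesPhi ω α β γ x) z := by
  simp only [barnesPoles, mem_ofPred_eq, not_or] at hz
  obtain ⟨h0, hγ, hα, hβ⟩ := hz
  have e : barnesPhi ω α β γ x = fun z => Complex.exp (2 * Real.pi * Complex.I * ω * x * z) *
      (angleBr ω (z + 1 + 1 / ω) * angleBr ω (z + γ)) *
      ((angleBr ω (z + α))⁻¹ * (angleBr ω (z + β))⁻¹) := by
    ext z
    rw [barnesPhi, div_eq_mul_inv, mul_inv]
  rw [e]
  have d0 : DifferentiableAt ℂ (fun z => angleBr ω (z + 1 + 1 / ω)) z :=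
    (differentiableAt_angleBr hω (x := z + 1 + 1 / ω) (by
      rwa [show z + 1 + 1 / (ω : ℂ) - 1 - 1 / ω = z by ring])).comp z
      (f := fun z => z + 1 + 1 / (ω : ℂ)) (by fun_prop)
  have dγ : DifferentiableAt ℂ (fun z => angleBr ω (z + γ)) z :=
    (differentiableAt_angleBr hω hγ).comp z (f := fun z => z + γ) (by fun_prop)
  have dα : DifferentiableAt ℂ (fun z => (angleBr ω (z + α))⁻¹) z :=
    (differentiableAt_inv_angleBr hω hα).comp z (f := fun z => z + α) (by fun_prop)
  have dβ : DifferentiableAt ℂ (fun z => (angleBr ω (z + β))⁻¹) z :=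
    (differentiableAt_inv_angleBr hω hβ).comp z (f := fun z => z + β) (by fun_prop)
  exact (DifferentiableAt.mul (by fun_prop) (d0.mul dγ)).mul (dα.mul dβ)

theorem meromorphicAt_barnesPhi (hω : 0 < ω) (α β γ x z : ℂ) :
    MeromorphicAt (barnesPhi ω α β γ x) z := by
  have hm : ∀ u : ℂ, MeromorphicAt (fun z => angleBr ω (z + u)) z := fun u =>
    (meromorphicAt_angleBr hω (z + u)).comp_analyticAt (g := fun z => z + u) (by fun_prop)
  have h0 : MeromorphicAt (fun z => angleBr ω (z + 1 + 1 / ω)) z := by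
    simp only [add_assoc]
    exact hm _
  unfold barnesPhi
  exact ((AnalyticAt.meromorphicAt (by fun_prop)).fun_mul (h0.fun_mul (hm γ))).fun_div
    ((hm α).fun_mul (hm β))

theorem barnesPhi_comm (ω : ℝ) (α β γ x z : ℂ) :
    barnesPhi ω α β γ x z = barnesPhi ω β α γ x z := by
  rw [barnesPhi, barnesPhi, mul_comm (angleBr ω (z + α))]

theorem add_mem_poleCone {u v : ℂ} (hu : u ∈ poleCone ω) (hv : v ∈ poleCone ω) :
    u + v ∈ poleCone ω := by
  obtain ⟨m, n, rfl⟩ := hu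
  obtain ⟨m', n', rfl⟩ := hv
  exact ⟨m + m', n + n', by push_cast; ring⟩

theorem mem_poleCone_of_one_sub_exp_eq_zero (ω : ℝ) {v : ℂ}
    (hv : 1 - Complex.exp (2 * Real.pi * Complex.I * v) = 0) :
    v ∈ poleCone ω ∨ -v ∈ poleCone ω := by
  obtain ⟨n, hn⟩ := Complex.exp_eq_one_iff.1 (sub_eq_zero.1 hv).symm
  have hvn : v = n := by
    rw [mul_comm (n : ℂ)] at hn
    exact mul_left_cancel₀ Complex.two_pi_I_ne_zero hn
  rcases Int.eq_nat_or_neg n with ⟨m, rfl | rfl⟩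
  · left
    rw [hvn, Int.cast_natCast]
    exact natCast_mem_poleCone ω m
  · right
    rw [hvn, Int.cast_neg, Int.cast_natCast, neg_neg]
    exact natCast_mem_poleCone ω m

theorem finite_poleCone_inter (hω : 0 < ω) (r : ℝ) : (poleCone ω ∩ Metric.ball 0 r).Finite := by
  obtain ⟨N, hN⟩ := exists_nat_ge (max r (r * ω))
  refine ((finite_Iic N).prod (finite_Iic N)).image (fun q : ℕ × ℕ => (q.1 : ℂ) + (q.2 : ℂ) / ω)
    |>.subset ?_
  rintro _ ⟨⟨m, n, rfl⟩, h⟩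
  rw [mem_ball_zero_iff] at h
  have h1 : (m : ℝ) + n / ω < r := by
    refine lt_of_le_of_lt ?_ h
    have := Complex.re_le_norm ((m : ℂ) + (n : ℂ) / ω)
    simpa [Complex.div_ofReal_re] using this
  have hm : (0 : ℝ) ≤ m := by positivity
  have hn : (0 : ℝ) ≤ n / ω := by positivity
  refine ⟨(m, n), ⟨?_, ?_⟩, rfl⟩
  · have : (m : ℝ) ≤ N := by linarith [le_max_left r (r * ω)]
    exact_mod_cast this
  · have h2 : (n : ℝ) < r * ω := by
      rw [← div_lt_iff₀ hω]
      linarith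
    have : (n : ℝ) ≤ N := by linarith [le_max_right r (r * ω)]
    exact_mod_cast this

theorem im_eq_zero_of_mem_poleCone {z : ℂ} (hz : z ∈ poleCone ω) : z.im = 0 := by
  obtain ⟨m, n, rfl⟩ := hz
  simp [Complex.div_ofReal_im]

/-- The union of the real lattices through the points of `S` spanned by `poleCone ω`. -/
def shiftedLattice (ω : ℝ) (S : Finset ℂ) : Set ℂ :=
  {z | ∃ u ∈ S, z - u ∈ poleCone ω ∨ u - z ∈ poleCone ω}

theorem finite_shiftedLattice_inter (hω : 0 < ω) (S : Finset ℂ) (r : ℝ) :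
    (shiftedLattice ω S ∩ Metric.ball 0 r).Finite := by
  have : shiftedLattice ω S ∩ Metric.ball 0 r ⊆ ⋃ u ∈ S,
      ((fun z => u + z) '' (poleCone ω ∩ Metric.ball 0 (r + ‖u‖)) ∪
        (fun z => u - z) '' (poleCone ω ∩ Metric.ball 0 (r + ‖u‖))) := by
    rintro z ⟨⟨u, hu, h⟩, hz⟩
    rw [mem_ball_zero_iff] at hz
    refine mem_biUnion hu ?_
    rcases h with h | h
    · refine Or.inl ⟨z - u, ⟨h, ?_⟩, by ring⟩
      rw [mem_ball_zero_iff]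
      exact (norm_sub_le _ _).trans_lt (by linarith)
    · refine Or.inr ⟨u - z, ⟨h, ?_⟩, by ring⟩
      rw [mem_ball_zero_iff]
      exact (norm_sub_le _ _).trans_lt (by linarith)
  refine Finite.subset ?_ this
  refine S.finite_toSet.biUnion fun u _ => ?_
  exact ((finite_poleCone_inter hω _).image _).union ((finite_poleCone_inter hω _).image _)

theorem exists_im_bound_shiftedLattice (ω : ℝ) (S : Finset ℂ) :
    ∃ Y, ∀ z ∈ shiftedLattice ω S, |z.im| ≤ Y := by
  refine ⟨∑ u ∈ S, |u.im|, ?_⟩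
  rintro z ⟨u, hu, h⟩
  have : z.im = u.im := by
    rcases h with h | h
    · have := im_eq_zero_of_mem_poleCone h
      rw [Complex.sub_im] at this
      linarith
    · have := im_eq_zero_of_mem_poleCone h
      rw [Complex.sub_im] at this
      linarith
  rw [this]
  exact Finset.single_le_sum (f := fun u : ℂ => |u.im|) (fun _ _ => abs_nonneg _) hu

/-- Each bracket on the left is a reflected bracket, so numerator and denominator trade places. In
the resulting product of factors σ the terms quadratic in w cancel and the linear ones combine with
the exponential into q^{xw}. -/
theorem barnesPhi_reflect (hω : 0 < ω) (α β γ x w : ℂ) :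
    barnesPhi ω α (1 + α - γ) (1 + α - β) (1 + 1 / ω + γ - α - β - x) (-α - w) =
      sigmaFn ω (β - α + 1 / ω) * sigmaFn ω x / (sigmaFn ω (γ - α + 1 / ω) * sigmaFn ω (x + α)) *
      (Complex.exp (2 * Real.pi * Complex.I * ω * x * w) *
        (angleBr ω (w + 1 + 1 / ω) * angleBr ω (w + γ + 1 / ω)) /
          (angleBr ω (w + α) * angleBr ω (w + β + 1 / ω))) := by
  have hω' : (ω : ℂ) ≠ 0 := by exact_mod_cast hω.ne'
  have e1 : -α - w + 1 + 1 / (ω : ℂ) = 1 + 1 / ω - (w + α) := by ring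
  have e2 : -α - w + (1 + α - β) = 1 + 1 / (ω : ℂ) - (w + β + 1 / ω) := by ring
  have e3 : -α - w + α = 1 + 1 / (ω : ℂ) - (w + 1 + 1 / ω) := by ring
  have e4 : -α - w + (1 + α - γ) = 1 + 1 / (ω : ℂ) - (w + γ + 1 / ω) := by ring
  rw [barnesPhi, e1, e2, e3, e4, angleBr_reflect hω, angleBr_reflect hω, angleBr_reflect hω,
    angleBr_reflect hω]
  have key : Complex.exp (2 * Real.pi * Complex.I * ω * (1 + 1 / ω + γ - α - β - x) * (-α - w)) *
      (sigmaFn ω (w + α) * sigmaFn ω (w + β + 1 / ω)) /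
        (sigmaFn ω (w + 1 + 1 / ω) * sigmaFn ω (w + γ + 1 / ω)) =
      sigmaFn ω (β - α + 1 / ω) * sigmaFn ω x / (sigmaFn ω (γ - α + 1 / ω) * sigmaFn ω (x + α)) *
        Complex.exp (2 * Real.pi * Complex.I * ω * x * w) := by
    simp only [sigmaFn, ← Complex.exp_add, ← Complex.exp_sub]
    congr 1
    field_simp
    ring
  generalize angleBr ω (w + α) = a at *
  generalize angleBr ω (w + β + 1 / ω) = b at *
  generalize angleBr ω (w + 1 + 1 / ω) = c at *
  generalize angleBr ω (w + γ + 1 / ω) = d at *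
  calc _ = (Complex.exp (2 * Real.pi * Complex.I * ω * (1 + 1 / ω + γ - α - β - x) * (-α - w)) *
      (sigmaFn ω (w + α) * sigmaFn ω (w + β + 1 / ω)) /
        (sigmaFn ω (w + 1 + 1 / ω) * sigmaFn ω (w + γ + 1 / ω))) * ((c * d) / (a * b)) := by
        simp only [div_eq_mul_inv, mul_inv, inv_inv]
        ring
    _ = _ := by
        rw [key]
        ring

/-- Translating the brackets at w+β and w+γ by 1/ω exposes Φ(w) itself; the price is a ratio of
functions with period 1. -/
theorem barnesPhi_reflect_eq_mul (hω : 0 < ω) {α β γ x w : ℂ}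
    (hβ : 1 - Complex.exp (2 * Real.pi * Complex.I * (w + β)) ≠ 0)
    (hγ : 1 - Complex.exp (2 * Real.pi * Complex.I * (w + γ)) ≠ 0) :
    barnesPhi ω α (1 + α - γ) (1 + α - β) (1 + 1 / ω + γ - α - β - x) (-α - w) =
      sigmaFn ω (β - α + 1 / ω) * sigmaFn ω x / (sigmaFn ω (γ - α + 1 / ω) * sigmaFn ω (x + α)) *
      (barnesPhi ω α β γ x w * ((1 - Complex.exp (2 * Real.pi * Complex.I * (w + β))) /
        (1 - Complex.exp (2 * Real.pi * Complex.I * (w + γ))))) := by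
  rw [barnesPhi_reflect hω, barnesPhi, angleBr_add_inv_mul hω hβ, angleBr_add_inv_mul hω hγ]
  congr 1
  generalize angleBr ω (w + α) = a
  generalize angleBr ω (w + β + 1 / ω) = b
  generalize angleBr ω (w + 1 + 1 / ω) = c
  generalize angleBr ω (w + γ + 1 / ω) = d
  generalize Complex.exp (2 * Real.pi * Complex.I * ω * x * w) = e
  generalize 1 - Complex.exp (2 * Real.pi * Complex.I * (w + β)) = g at *
  generalize 1 - Complex.exp (2 * Real.pi * Complex.I * (w + γ)) = h at *
  calc e * (c * d) / (a * b) = e * (c * d) / (a * b) * (g / g) * (h / h) := by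
        rw [div_self hβ, div_self hγ, mul_one, mul_one]
    _ = _ := by
        simp only [div_eq_mul_inv, mul_inv]
        ring

theorem IsBarnesContour.isOnSide_right {α β γ : ℂ} {c : ℝ → ℂ} (hc : IsBarnesContour ω α β γ c)
    {z : ℂ} (hz : z ∈ poleCone ω ∨ z + γ - 1 - 1 / ω ∈ poleCone ω) : IsOnSide (-1) c z := by
  rcases hz with h | h
  · exact (hc.right_zero z h).isOnSide
  · have := (hc.right_γ _ h).isOnSide
    rwa [show -γ + 1 + 1 / (ω : ℂ) + (z + γ - 1 - 1 / ω) = z by ring] at this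

theorem IsBarnesContour.isOnSide_left {α β γ : ℂ} {c : ℝ → ℂ} (hc : IsBarnesContour ω α β γ c)
    {z : ℂ} (hz : -(z + α) ∈ poleCone ω ∨ -(z + β) ∈ poleCone ω) : IsOnSide 1 c z := by
  rcases hz with h | h
  · have := (hc.left_α _ h).isOnSide
    rwa [show -α - -(z + α) = z by ring] at this
  · have := (hc.left_β _ h).isOnSide
    rwa [show -β - -(z + β) = z by ring] at this

theorem exists_norm_barnesPhi_reflect_le (hω : 0 < ω) {α β γ x : ℂ} (hx : 0 < x.re)
    (hx' : x.re < 1 + 1 / ω + γ.re - α.re - β.re) (u : ℂ) (M : ℝ) : ∃ C δ T₀ : ℝ, 0 ≤ C ∧ 0 < δ ∧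
      ∀ z : ℂ, |z.re| ≤ M → T₀ ≤ |z.im| →
        ‖barnesPhi ω α β γ x (u - z)‖ ≤ C * Real.exp (-δ * |z.im|) := by
  obtain ⟨C, δ, T, hC, hδ, -, h⟩ := exists_norm_barnesPhi_le hω hx hx' (|u.re| + M)
  refine ⟨C * Real.exp (δ * |u.im|), δ, T + |u.im|, by positivity, hδ, fun z hz hi => ?_⟩
  have h1 : |z.im| - |u.im| ≤ |(u - z).im| := by
    rw [Complex.sub_im, abs_sub_comm]
    exact abs_sub_abs_le_abs_sub _ _
  refine (h (u - z) ?_ (by linarith)).trans ?_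
  · rw [Complex.sub_re]
    exact (abs_sub _ _).trans (by linarith)
  · rw [mul_assoc, ← Real.exp_add]
    refine mul_le_mul_of_nonneg_left (Real.exp_le_exp.2 ?_) hC.le
    have := mul_le_mul_of_nonneg_left h1 hδ.le
    linarith

/-- Reflection and reversal of the parameter each change the sign of the velocity, so the integral
over the line is unchanged. -/
theorem reflected_barnesIntegrand (ω : ℝ) (c : ℝ → ℂ) (α β γ x u : ℂ) :
    (fun t => barnesPhi ω α β γ x (u - (u - c (-t))) * deriv (fun t => u - c (-t)) t) =
      fun t => barnesIntegrand ω c α β γ x (-t) := by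
  ext t
  rw [deriv_reflect_contour, sub_sub_cancel, barnesIntegrand]

end Barnes

/-! ### The connection formula. -/

section Connection

variable {ω : ℝ} {α β γ : ℂ} {c : ℝ → ℂ}

theorem IsBarnesContour.isOnSide_of_mem_barnesPoles
    (hc : IsBarnesContour ω α β γ c) {p : ℂ} (hp : p ∈ barnesPoles ω α β γ) :
    ((-(p + α) ∈ poleCone ω ∨ -(p + β) ∈ poleCone ω) ∧ IsOnSide 1 c p) ∨
      ((p ∈ poleCone ω ∨ p + γ - 1 ∈ poleCone ω) ∧ IsOnSide (-1) c p) := by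
  rcases hp with h | h | h | h
  · exact Or.inr ⟨Or.inl h, hc.isOnSide_right (Or.inl h)⟩
  · refine Or.inr ⟨Or.inr ?_, hc.isOnSide_right (Or.inr h)⟩
    simpa using add_inv_mem_poleCone h
  · exact Or.inl ⟨Or.inl h, hc.isOnSide_left (Or.inl h)⟩
  · exact Or.inl ⟨Or.inr h, hc.isOnSide_left (Or.inr h)⟩

/-- Reflection brings the poles into the same left and right families as those of Φ. The right
family is 1-γ+Λ rather than 1+1/ω-γ+Λ because the reflected integrand has the larger set of poles;
the left one at -β shrinks instead. -/
theorem IsBarnesContour.isOnSide_reflect_of_mem_barnesPoles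
    (hc : IsBarnesContour ω α (1 + α - γ) (1 + α - β) c) {p : ℂ}
    (hp : -α - p ∈ barnesPoles ω α (1 + α - γ) (1 + α - β)) :
    ((-(p + α) ∈ poleCone ω ∨ -(p + β) ∈ poleCone ω) ∧ IsOnSide 1 (fun t => -α - c (-t)) p) ∨
      ((p ∈ poleCone ω ∨ p + γ - 1 ∈ poleCone ω) ∧ IsOnSide (-1) (fun t => -α - c (-t)) p) := by
  rcases hp with h | h | h | h
  · refine Or.inl ⟨Or.inl ?_, by simpa using (hc.isOnSide_right (Or.inl h)).reflect⟩
    rwa [show -(p + α) = -α - p by ring]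
  · refine Or.inl ⟨Or.inr ?_, by simpa using (hc.isOnSide_right (Or.inr h)).reflect⟩
    rw [show -(p + β) = -α - p + (1 + α - β) - 1 - 1 / (ω : ℂ) + 1 / ω by ring]
    exact add_inv_mem_poleCone h
  · refine Or.inr ⟨Or.inl ?_, (hc.isOnSide_left (Or.inl h)).reflect⟩
    rwa [show p = -(-α - p + α) by ring]
  · refine Or.inr ⟨Or.inr ?_, (hc.isOnSide_left (Or.inr h)).reflect⟩
    rwa [show p + γ - 1 = -(-α - p + (1 + α - γ)) by ring]

theorem one_sub_exp_ne_zero_of_notMem (ω : ℝ) {u : ℂ} (h : u ∉ poleCone ω) (h' : -u ∉ poleCone ω) :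
    1 - Complex.exp (2 * Real.pi * Complex.I * u) ≠ 0 := fun h0 =>
  (mem_poleCone_of_one_sub_exp_eq_zero ω h0).elim h h'

theorem one_sub_exp_add_ne_zero {S : Finset ℂ} {z a : ℂ} (ha : -a ∈ S)
    (hz : z ∉ shiftedLattice ω S) : 1 - Complex.exp (2 * Real.pi * Complex.I * (z + a)) ≠ 0 := by
  refine one_sub_exp_ne_zero_of_notMem ω (fun h => hz ⟨-a, ha, Or.inl ?_⟩)
    (fun h => hz ⟨-a, ha, Or.inr ?_⟩)
  · rwa [sub_neg_eq_add]
  · rwa [show -a - z = -(z + a) by ring]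

/-- The partial fraction identity behind the connection formula. -/
theorem one_sub_exp_partial_fraction {z : ℂ}
    (hαβ : 1 - Complex.exp (2 * Real.pi * Complex.I * (α - β)) ≠ 0) :
    (1 - Complex.exp (2 * Real.pi * Complex.I * (γ - α))) /
          (1 - Complex.exp (2 * Real.pi * Complex.I * (β - α))) *
        (1 - Complex.exp (2 * Real.pi * Complex.I * (z + β))) +
      (1 - Complex.exp (2 * Real.pi * Complex.I * (γ - β))) /
          (1 - Complex.exp (2 * Real.pi * Complex.I * (α - β))) *
        (1 - Complex.exp (2 * Real.pi * Complex.I * (z + α))) =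
      1 - Complex.exp (2 * Real.pi * Complex.I * (z + γ)) := by
  simp only [mul_sub, mul_add, Complex.exp_add, Complex.exp_sub] at *
  have ha := Complex.exp_ne_zero (2 * Real.pi * Complex.I * α)
  have hb := Complex.exp_ne_zero (2 * Real.pi * Complex.I * β)
  generalize Complex.exp (2 * Real.pi * Complex.I * α) = a at *
  generalize Complex.exp (2 * Real.pi * Complex.I * β) = b at *
  generalize Complex.exp (2 * Real.pi * Complex.I * γ) = d at *
  generalize Complex.exp (2 * Real.pi * Complex.I * z) = w at *
  have h1 : b - a ≠ 0 := fun h => hαβ (by rw [sub_eq_zero.1 h, div_self ha, sub_self])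
  have h2 : a - b ≠ 0 := fun h => h1 (by rw [← neg_sub, h, neg_zero])
  rw [one_sub_div ha, one_sub_div hb, one_sub_div ha, one_sub_div hb]
  field_simp
  rw [show b - a = -(a - b) by ring]
  field_simp
  ring

/-- The reflection constant of `barnesPhi_reflect_eq_mul`. -/
noncomputable def reflectConst (ω : ℝ) (α β γ x : ℂ) : ℂ :=
  sigmaFn ω (β - α + 1 / ω) * sigmaFn ω x / (sigmaFn ω (γ - α + 1 / ω) * sigmaFn ω (x + α))

theorem reflectConst_ne_zero (ω : ℝ) (α β γ x : ℂ) : reflectConst ω α β γ x ≠ 0 :=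
  div_ne_zero (mul_ne_zero (sigmaFn_ne_zero _ _) (sigmaFn_ne_zero _ _))
    (mul_ne_zero (sigmaFn_ne_zero _ _) (sigmaFn_ne_zero _ _))

/-- The products ⟨u⟩⟨1-u⟩ at u = γ-α and u = β-α produce the factors 1-e(u), and their σ factors are
those in `reflectConst`. -/
theorem connection_coefficient (hω : 0 < ω) (x : ℂ)
    (hγα : γ - α - 1 ∉ poleCone ω) (hαγ : α - γ - 1 / ω ∉ poleCone ω)
    (hαβ : α - β ∉ poleCone ω) (hβα : β - α ∉ poleCone ω) :
    angleBr ω β * angleBr ω (γ - α) / (angleBr ω γ * angleBr ω (β - α)) *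
          (sigmaFn ω (x + α) / sigmaFn ω x) *
        (angleBr ω α * angleBr ω (1 + α - γ) / (angleBr ω 1 * angleBr ω (1 + α - β))) =
      angleBr ω α * angleBr ω β / (angleBr ω 1 * angleBr ω γ) *
        ((1 - Complex.exp (2 * Real.pi * Complex.I * (γ - α))) /
          (1 - Complex.exp (2 * Real.pi * Complex.I * (β - α))) / reflectConst ω α β γ x) := by
  have e1 := angleBr_mul_angleBr_one_sub hω (u := γ - α)
    (by rwa [show -(γ - α) - 1 / (ω : ℂ) = α - γ - 1 / ω by ring]) hγα
  have e2 := angleBr_mul_angleBr_one_sub hω (u := β - α)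
    (fun h => hαβ (by
      rw [show α - β = -(β - α) - 1 / (ω : ℂ) + 1 / ω by ring]
      exact add_inv_mem_poleCone h))
    (fun h => hβα (by
      rw [show β - α = β - α - 1 + 1 by ring]
      exact add_one_mem_poleCone h))
  rw [show 1 - (γ - α) = 1 + α - γ by ring] at e1
  rw [show 1 - (β - α) = 1 + α - β by ring] at e2
  have h1 := sigmaFn_ne_zero ω (γ - α + 1 / ω)
  have h2 := sigmaFn_ne_zero ω (β - α + 1 / ω)
  calc _ = angleBr ω α * angleBr ω β / (angleBr ω 1 * angleBr ω γ) *
        ((angleBr ω (γ - α) * angleBr ω (1 + α - γ)) /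
          (angleBr ω (β - α) * angleBr ω (1 + α - β)) * (sigmaFn ω (x + α) / sigmaFn ω x)) := by
        simp only [div_eq_mul_inv, mul_inv]
        ring
    _ = _ := by
        rw [e1, e2, reflectConst]
        congr 1
        simp only [div_eq_mul_inv, mul_inv, inv_inv]
        ring

end Connection

theorem connection_integral {ω : ℝ} (hω : 0 < ω) {α β γ x : ℂ}
    (hα : -α ∉ poleCone ω) (hβ : -β ∉ poleCone ω)
    (hαβ : α - β ∉ poleCone ω) (hβα : β - α ∉ poleCone ω)
    (hγα : γ - α - 1 ∉ poleCone ω) (hγβ : γ - β - 1 ∉ poleCone ω)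
    (hx : 0 < x.re) (hx' : x.re < 1 + 1 / ω + γ.re - α.re - β.re)
    {c₀ c₁ c₂ : ℝ → ℂ}
    (hc₀ : IsBarnesContour ω α β γ c₀)
    (hc₁ : IsBarnesContour ω α (1 + α - γ) (1 + α - β) c₁)
    (hc₂ : IsBarnesContour ω β (1 + β - γ) (1 + β - α) c₂) :
    Integrable (barnesIntegrand ω c₀ α β γ x) ∧
    Integrable (barnesIntegrand ω c₁ α (1 + α - γ) (1 + α - β) (1 + 1 / ω + γ - α - β - x)) ∧
    Integrable (barnesIntegrand ω c₂ β (1 + β - γ) (1 + β - α) (1 + 1 / ω + γ - α - β - x)) ∧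
    ∫ t, barnesIntegrand ω c₀ α β γ x t =
      (1 - Complex.exp (2 * Real.pi * Complex.I * (γ - α))) /
          (1 - Complex.exp (2 * Real.pi * Complex.I * (β - α))) / reflectConst ω α β γ x *
        (∫ t, barnesIntegrand ω c₁ α (1 + α - γ) (1 + α - β) (1 + 1 / ω + γ - α - β - x) t) +
      (1 - Complex.exp (2 * Real.pi * Complex.I * (γ - β))) /
          (1 - Complex.exp (2 * Real.pi * Complex.I * (α - β))) / reflectConst ω β α γ x *
        (∫ t, barnesIntegrand ω c₂ β (1 + β - γ) (1 + β - α) (1 + 1 / ω + γ - α - β - x) t) := by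
  classical
  obtain ⟨R₀, h₀⟩ := hc₀.contour.exists_isShiftedContour
  obtain ⟨R₁, h₁⟩ := hc₁.contour.exists_isShiftedContour
  obtain ⟨R₂, h₂⟩ := hc₂.contour.exists_isShiftedContour
  set x' : ℂ := 1 + 1 / ω + γ - α - β - x with hxdef
  have hxx : x' = 1 + 1 / ω + γ - β - α - x := by rw [hxdef]; ring
  have hgαβ : 1 - Complex.exp (2 * Real.pi * Complex.I * (α - β)) ≠ 0 :=
    one_sub_exp_ne_zero_of_notMem ω hαβ (by rwa [neg_sub])
  -- The left and right families are disjoint: a common point would put -α, -β, γ-α-1 or γ-β-1 into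
  -- the cone, which is closed under addition.
  have hright : ∀ p, p ∈ poleCone ω ∨ p + γ - 1 ∈ poleCone ω →
      ¬(-(p + α) ∈ poleCone ω ∨ -(p + β) ∈ poleCone ω) := by
    rintro p (h | h) (h' | h')
    · exact hα (by simpa using add_mem_poleCone h h')
    · exact hβ (by simpa using add_mem_poleCone h h')
    · exact hγα (by rw [show γ - α - 1 = p + γ - 1 + -(p + α) by ring]; exact add_mem_poleCone h h')
    · exact hγβ (by rw [show γ - β - 1 = p + γ - 1 + -(p + β) by ring]; exact add_mem_poleCone h h')
  let L : ℂ → Prop := fun p => -(p + α) ∈ poleCone ω ∨ -(p + β) ∈ poleCone ω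
  -- One choice of side per point, shared by the three contours.
  let ε : ℂ → ℝ := fun p => if L p then 1 else -1
  -- The lattices through these points contain all poles and also all zeros of 1-e(z+α), 1-e(z+β),
  -- 1-e(z+γ), so off them the linear relation holds literally.
  let S : Finset ℂ := {0, 1 - γ, -α, -β, -γ}
  let F : Fin 3 → ℂ → ℂ := ![barnesPhi ω α β γ x,
    fun w => barnesPhi ω α (1 + α - γ) (1 + α - β) x' (-α - w),
    fun w => barnesPhi ω β (1 + β - γ) (1 + β - α) x' (-β - w)]
  let c : Fin 3 → ℝ → ℂ := ![c₀, fun t => -α - c₁ (-t), fun t => -β - c₂ (-t)]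
  let P : Fin 3 → Set ℂ := ![barnesPoles ω α β γ,
    {w | -α - w ∈ barnesPoles ω α (1 + α - γ) (1 + α - β)},
    {w | -β - w ∈ barnesPoles ω β (1 + β - γ) (1 + β - α)}]
  let A : ℂ := (1 - Complex.exp (2 * Real.pi * Complex.I * (γ - α))) /
          (1 - Complex.exp (2 * Real.pi * Complex.I * (β - α)))
  let B : ℂ := (1 - Complex.exp (2 * Real.pi * Complex.I * (γ - β))) /
          (1 - Complex.exp (2 * Real.pi * Complex.I * (α - β)))
  have hP : ∀ i, ∀ p ∈ P i, (L p ∧ IsOnSide 1 (c i) p) ∨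
      ((p ∈ poleCone ω ∨ p + γ - 1 ∈ poleCone ω) ∧ IsOnSide (-1) (c i) p) := by
    intro i p hp
    fin_cases i
    · exact hc₀.isOnSide_of_mem_barnesPoles hp
    · exact hc₁.isOnSide_reflect_of_mem_barnesPoles hp
    · rcases hc₂.isOnSide_reflect_of_mem_barnesPoles hp with h | h
      · exact Or.inl ⟨h.1.symm, h.2⟩
      · exact Or.inr h
  have key := sum_contourIntegral_eq_zero (F := F) (c := c) (s := ![0, -α, -β])
    (k := ![1, -(A / reflectConst ω α β γ x), -(B / reflectConst ω β α γ x)]) (R := ![R₀, R₁, R₂])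
    (P := P) (E := shiftedLattice ω S) (ε := ε)
    (Y := (exists_im_bound_shiftedLattice ω S).choose) ?_ ?_ ?_ ?_ ?_ ?_ ?_ ?_ ?_ ?_
  · obtain ⟨hint, hsum⟩ := key
    have i0 : Integrable (barnesIntegrand ω c₀ α β γ x) := hint 0
    have i1 := hint 1
    have i2 := hint 2
    have e1 := reflected_barnesIntegrand ω c₁ α (1 + α - γ) (1 + α - β) x' (-α)
    have e2 := reflected_barnesIntegrand ω c₂ β (1 + β - γ) (1 + β - α) x' (-β)
    change Integrable (fun t => barnesPhi ω α (1 + α - γ) (1 + α - β) x' (-α - (-α - c₁ (-t))) *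
      deriv (fun t => -α - c₁ (-t)) t) at i1
    change Integrable (fun t => barnesPhi ω β (1 + β - γ) (1 + β - α) x' (-β - (-β - c₂ (-t))) *
      deriv (fun t => -β - c₂ (-t)) t) at i2
    rw [e1] at i1
    rw [e2] at i2
    have hsum' : 1 * (∫ t, barnesIntegrand ω c₀ α β γ x t) +
        -(A / reflectConst ω α β γ x) * (∫ t, barnesPhi ω α (1 + α - γ) (1 + α - β) x'
          (-α - (-α - c₁ (-t))) * deriv (fun t => -α - c₁ (-t)) t) +
        -(B / reflectConst ω β α γ x) * (∫ t, barnesPhi ω β (1 + β - γ) (1 + β - α) x'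
          (-β - (-β - c₂ (-t))) * deriv (fun t => -β - c₂ (-t)) t) = 0 := by
      rw [Fin.sum_univ_three] at hsum
      exact hsum
    rw [e1, e2, integral_neg_eq_self, integral_neg_eq_self] at hsum'
    refine ⟨i0, by simpa using i1.comp_neg, by simpa using i2.comp_neg, ?_⟩
    linear_combination hsum'
  · intro i
    fin_cases i
    · exact h₀
    · exact h₁.reflect _
    · exact h₂.reflect _
  · intro i z hz
    fin_cases i
    · exact differentiableAt_barnesPhi hω hz
    · exact (differentiableAt_barnesPhi hω hz).comp z (differentiableAt_id.const_sub _)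
    · exact (differentiableAt_barnesPhi hω hz).comp z (differentiableAt_id.const_sub _)
  · intro i z
    fin_cases i
    · exact meromorphicAt_barnesPhi hω _ _ _ _ _
    · exact (meromorphicAt_barnesPhi hω _ _ _ _ _).comp_analyticAt
        (analyticAt_const.sub analyticAt_id)
    · exact (meromorphicAt_barnesPhi hω _ _ _ _ _).comp_analyticAt
        (analyticAt_const.sub analyticAt_id)
  · intro p
    change (if L p then (1 : ℝ) else -1) ≠ 0
    split_ifs <;> norm_num
  · intro i p hp
    rcases hP i p hp with ⟨h, h'⟩ | ⟨h, h'⟩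
    · change IsOnSide (if L p then (1 : ℝ) else -1) (c i) p
      rwa [if_pos h]
    · change IsOnSide (if L p then (1 : ℝ) else -1) (c i) p
      rwa [if_neg (hright p h)]
  · intro i p hp
    rcases hP i p hp with ⟨h | h, -⟩ | ⟨h | h, -⟩
    · exact ⟨-α, by simp [S], Or.inr (by rwa [show -α - p = -(p + α) by ring])⟩
    · exact ⟨-β, by simp [S], Or.inr (by rwa [show -β - p = -(p + β) by ring])⟩
    · exact ⟨0, by simp [S], Or.inl (by rwa [sub_zero])⟩
    · exact ⟨1 - γ, by simp [S], Or.inl (by rwa [show p - (1 - γ) = p + γ - 1 by ring])⟩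
  · exact finite_shiftedLattice_inter hω S
  · exact (exists_im_bound_shiftedLattice ω S).choose_spec
  · intro z hz
    have gα := one_sub_exp_add_ne_zero (a := α) (by simp [S]) hz
    have gβ := one_sub_exp_add_ne_zero (a := β) (by simp [S]) hz
    have gγ := one_sub_exp_add_ne_zero (a := γ) (by simp [S]) hz
    have hf := one_sub_exp_partial_fraction (γ := γ) (z := z) hgαβ
    have r1 := barnesPhi_reflect_eq_mul hω (α := α) (x := x) gβ gγ
    have r2 := barnesPhi_reflect_eq_mul hω (α := β) (x := x) gα gγ
    -- Both the reflected argument and Φ are symmetric in α and β, so the second reflection is the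
    -- first with these exchanged.
    rw [← hxx, barnesPhi_comm ω β α] at r2
    rw [← hxdef] at r1
    rw [Fin.sum_univ_three]
    change 1 * barnesPhi ω α β γ x z + -(A / reflectConst ω α β γ x) *
      barnesPhi ω α (1 + α - γ) (1 + α - β) x' (-α - z) + -(B / reflectConst ω β α γ x) *
      barnesPhi ω β (1 + β - γ) (1 + β - α) x' (-β - z) = 0
    have k1 := reflectConst_ne_zero ω α β γ x
    have k2 := reflectConst_ne_zero ω β α γ x
    change A * _ + B * _ = _ at hf
    change _ = reflectConst ω α β γ x * _ at r1
    change _ = reflectConst ω β α γ x * _ at r2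
    rw [r1, r2]
    generalize reflectConst ω α β γ x = K at *
    generalize reflectConst ω β α γ x = K' at *
    field_simp
    linear_combination (-barnesPhi ω α β γ x z) * hf
  · have hre : (1 / (ω : ℂ)).re = 1 / ω := by
      rw [← Complex.ofReal_one, ← Complex.ofReal_div, Complex.ofReal_re]
    have hre' : x'.re = 1 + 1 / ω + γ.re - α.re - β.re - x.re := by
      rw [hxdef]
      simp only [Complex.sub_re, Complex.add_re, Complex.one_re, hre]
    have p0 : 0 < x'.re := by rw [hre']; linarith
    intro i
    fin_cases i
    · obtain ⟨C, δ, T, hC, hδ, -, h⟩ := exists_norm_barnesPhi_le hω hx hx' |(0 : ℂ).re|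
      exact ⟨C, δ, T, hC.le, hδ, h⟩
    · refine exists_norm_barnesPhi_reflect_le hω p0 ?_ (-α) _
      simp only [Complex.sub_re, Complex.add_re, Complex.one_re, hre']
      linarith
    · refine exists_norm_barnesPhi_reflect_le hω p0 ?_ (-β) _
      simp only [Complex.sub_re, Complex.add_re, Complex.one_re, hre']
      linarith

end

theorem mainTheorem2 (ω : ℝ) (hω : 0 < ω) (hirr : Irrational ω) (α β γ x : ℂ)
    -- the parameters are such that every factor and every contour below is defined
    (hα : -α ∉ poleCone ω) (hβ : -β ∉ poleCone ω) (hγ : -γ ∉ poleCone ω)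
    (hα' : α - 1 - 1 / ω ∉ poleCone ω) (hβ' : β - 1 - 1 / ω ∉ poleCone ω)
    (hαβ : α - β ∉ poleCone ω) (hβα : β - α ∉ poleCone ω)
    (hγα : γ - α - 1 ∉ poleCone ω) (hγβ : γ - β - 1 ∉ poleCone ω)
    (hαγ : α - γ - 1 / ω ∉ poleCone ω) (hβγ : β - γ - 1 / ω ∉ poleCone ω)
    -- the domain of convergence
    (hx : 0 < x.re) (hx' : x.re < 1 + 1 / ω + γ.re - α.re - β.re)
    -- any admissible contours for the three integrals
    (c₀ c₁ c₂ : ℝ → ℂ)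
    (hc₀ : IsBarnesContour ω α β γ c₀)
    (hc₁ : IsBarnesContour ω α (1 + α - γ) (1 + α - β) c₁)
    (hc₂ : IsBarnesContour ω β (1 + β - γ) (1 + β - α) c₂) :
    MeasureTheory.Integrable (barnesIntegrand ω c₀ α β γ x) ∧
    MeasureTheory.Integrable
      (barnesIntegrand ω c₁ α (1 + α - γ) (1 + α - β) (1 + 1 / ω + γ - α - β - x)) ∧
    MeasureTheory.Integrable
      (barnesIntegrand ω c₂ β (1 + β - γ) (1 + β - α) (1 + 1 / ω + γ - α - β - x)) ∧
    barnesPsi ω c₀ α β γ x =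
      angleBr ω β * angleBr ω (γ - α) / (angleBr ω γ * angleBr ω (β - α)) *
          (sigmaFn ω (x + α) / sigmaFn ω x) *
          barnesPsi ω c₁ α (1 + α - γ) (1 + α - β) (1 + 1 / ω + γ - α - β - x) +
        angleBr ω α * angleBr ω (γ - β) / (angleBr ω γ * angleBr ω (α - β)) *
          (sigmaFn ω (x + β) / sigmaFn ω x) *
          barnesPsi ω c₂ β (1 + β - γ) (1 + β - α) (1 + 1 / ω + γ - α - β - x) := by
  obtain ⟨h0, h1, h2, h⟩ := connection_integral hω hα hβ hαβ hβα hγα hγβ hx hx' hc₀ hc₁ hc₂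
  refine ⟨h0, h1, h2, ?_⟩
  have k1 := connection_coefficient hω x hγα hαγ hαβ hβα
  have k2 := connection_coefficient hω x hγβ hβγ hβα hαβ
  unfold barnesPsi
  rw [h, ← mul_assoc (_ * _), ← mul_assoc (_ * _), k1, k2, mul_comm (angleBr ω β) (angleBr ω α)]
  ring
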